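/- Let $G$ be a finite simple undirected graph without isolated vertices, with $n$ vertices and $m\ge 2$ edges. A $k$-truss of $G$ is the largest subgraph $H$ of $G$ in which every edge lies in at least $k$ triangles of $H$, and the trussness $t_G$ is the largest integer $k\ge 0$ for which the $k$-truss of $G$ is nonempty (has at least one edge). Let $T_G$ be the number of triangles of $G$ and $\alpha_G$ its arboricity, i.e. the minimum number of forests into which the edges of $G$ can be partitioned. The model of computation is a randomized word RAM with words of $\Theta(\log(n+m+1/\varepsilon))$ bits (with arithmetic operations, comparisons, memory accesses and the drawing of a uniformly random word at unit cost). The input is $n$, $m$, a list of the edges of $G$ in arbitrary order, and the accuracy $\varepsilon$, given through the integer $\lceil 1/\varepsilon\rceil$. Space is counted in words. **Theorem.** For every constant $a$ there is a randomized algorithm (one program for all $G$ and all $\varepsilon$) and a constant $C$ (depending only on $a$) such that for every such graph $G$ and every real $0<\varepsilon<1$ the following hold. 1. With probability at least $1-m^{-a}$ the algorithm halts and outputs a rational number $\tilde t$ with $(1-\varepsilon)\,t_G\le \tilde t\le (1+\varepsilon)\,t_G$. 2. The expected running time is at most $$C\,\varepsilon^{-3}\,\min\left\{\frac{m\log m}{T_G+1},\,1\right\}\,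 m\,\alpha_G\,\log(t_G+2).$$ 3. The space used is, on every run, at most $C\,\varepsilon^{-2}\,m\log m$. -/

import Mathlib

open MeasureTheory

namespace Truss

/-! ### Graph parameters -/

section Graphs

variable {V : Type*}

/-- Every edge of `H` lies in at least `k` triangles of `H`: the support of an edge `uv` is the
number of common neighbours of `u` and `v`. -/
def MinSupportGE (k : ℕ) (H : SimpleGraph V) : Prop :=
  ∀ u v, H.Adj u v → k ≤ (H.commonNeighbors u v).ncard

/-- The `k`-truss of `G` (in the 0-based convention): the largest subgraph all of whose edges have
support at least `k` in the subgraph. Edge-induced subgraphs are represented by their edges,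
i.e. by graphs `H ≤ G` on the same vertex set, isolated vertices being irrelevant. -/
def kTruss (G : SimpleGraph V) (k : ℕ) : SimpleGraph V :=
  sSup {H | H ≤ G ∧ MinSupportGE k H}

/-- The supremum defining the `k`-truss is attained. -/
theorem kTruss_isGreatest [Finite V] (G : SimpleGraph V) (k : ℕ) :
    IsGreatest {H | H ≤ G ∧ MinSupportGE k H} (kTruss G k) := by
  refine ⟨⟨sSup_le fun H hH => hH.1, ?_⟩, fun H hH => le_sSup hH⟩
  intro u v huv
  obtain ⟨H, hH, hadj⟩ := SimpleGraph.sSup_adj.1 huv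
  refine (hH.2 u v hadj).trans (Set.ncard_le_ncard ?_ (Set.toFinite _))
  have hle : H ≤ kTruss G k := le_sSup hH
  intro x hx
  exact ⟨hle hx.1, hle hx.2⟩

/-- The trussness `t_G`: the largest `k` for which `G` has a (nonempty) `k`-truss. -/
noncomputable def trussness (G : SimpleGraph V) : ℕ :=
  sSup {k | kTruss G k ≠ ⊥}

/-- The number `m` of edges. -/
noncomputable def numEdges (G : SimpleGraph V) : ℕ :=
  G.edgeSet.ncard

/-- The number `T_G` of triangles. -/
noncomputable def numTriangles (G : SimpleGraph V) : ℕ :=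
  (G.cliqueSet 3).ncard

/-- The arboricity `α_G`: the least number of forests into which the edges can be partitioned. -/
noncomputable def arboricity (G : SimpleGraph V) : ℕ :=
  sInf {k | ∃ F : Fin k → SimpleGraph V,
    (∀ i, (F i).IsAcyclic) ∧ (∀ i j, i ≠ j → Disjoint (F i) (F j)) ∧ ⨆ i, F i = G}

/-- `x` is a `(1 ± ε)`-approximation of `t`. -/
def IsApprox (ε t x : ℝ) : Prop :=
  (1 - ε) * t ≤ x ∧ x ≤ (1 + ε) * t

/-- `L` lists every edge of `G` exactly once, in any order and with any orientation. -/
def IsEdgeList (G : SimpleGraph V) (L : List (V × V)) : Prop :=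
  (L.map fun p => s(p.1, p.2)).Nodup ∧
    ∀ e : Sym2 V, e ∈ (L.map fun p => s(p.1, p.2)) ↔ e ∈ G.edgeSet

end Graphs

/-! ### A randomized word RAM

Words are natural numbers below `2 ^ w`. A program is a fixed finite term; it works on the finitely
many registers that it names and on a random access memory, and can draw uniformly random words.
It does not depend on `w`. Time is the number of steps. Since the expressions of a program are
fixed, one step performs a bounded number of word operations. -/

/-- The word operations. -/
inductive Op
  | add | sub | mul | div | mod | lt | eq

/-- Values are reduced modulo `2 ^ w`. Subtraction is cut off at `0`, `x / 0 = 0`, `x % 0 = x`,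
and comparisons return `0` or `1`. -/
def Op.eval (w : ℕ) : Op → ℕ → ℕ → ℕ
  | .add, x, y => (x + y) % 2 ^ w
  | .sub, x, y => (x - y) % 2 ^ w
  | .mul, x, y => (x * y) % 2 ^ w
  | .div, x, y => (x / y) % 2 ^ w
  | .mod, x, y => (x % y) % 2 ^ w
  | .lt, x, y => (if x < y then 1 else 0) % 2 ^ w
  | .eq, x, y => (if x = y then 1 else 0) % 2 ^ w

/-- Expressions over registers. -/
inductive Expr
  | const (a : ℕ)
  | reg (i : ℕ)
  | op (o : Op) (e₁ e₂ : Expr)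

/-- The value of an expression for given register contents. -/
def Expr.eval (w : ℕ) (reg : ℕ → ℕ) : Expr → ℕ
  | .const a => a % 2 ^ w
  | .reg i => reg i
  | .op o e₁ e₂ => o.eval w (e₁.eval w reg) (e₂.eval w reg)

/-- Programs. -/
inductive Prog
  /-- do nothing -/
  | skip
  /-- register `i` gets the value of `e` -/
  | set (i : ℕ) (e : Expr)
  /-- register `i` gets the content of the memory cell with address `e` -/
  | load (i : ℕ) (e : Expr)
  /-- the memory cell with address `e₁` gets the value of `e₂` -/
  | store (e₁ e₂ : Expr)
  /-- register `i` gets a fresh uniformly random word -/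
  | rand (i : ℕ)
  /-- sequential composition -/
  | seq (p q : Prog)
  /-- if `e ≠ 0` then `p` else `q` -/
  | ite (e : Expr) (p q : Prog)
  /-- while `e ≠ 0` do `p` -/
  | loop (e : Expr) (p : Prog)

/-- Machine configurations. -/
structure Config where
  /-- the programs that remain to be executed, the next one first; empty when halted -/
  todo : List Prog
  /-- the registers -/
  reg : ℕ → ℕ
  /-- the memory -/
  mem : ℕ → ℕ
  /-- the number of random words drawn so far -/
  drawn : ℕ
  /-- the number of memory cells used so far: all addresses that have been accessed, and those of
  the input, are below it -/
  space : ℕ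

/-- A random tape: an infinite sequence of `w`-bit words. -/
abbrev Tape (w : ℕ) : Type := ℕ → Fin (2 ^ w)

/-- The words on a random tape are independent and uniformly distributed. -/
noncomputable def tapeMeasure (w : ℕ) : Measure (Tape w) :=
  Measure.infinitePi fun _ : ℕ => (PMF.uniformOfFintype (Fin (2 ^ w))).toMeasure

/-- One step of the machine. A halted configuration does not change. -/
def step {w : ℕ} (ω : Tape w) (s : Config) : Config :=
  match s.todo with
  | [] => s
  | .skip :: K => { s with todo := K }
  | .set i e :: K => { s with todo := K, reg := Function.update s.reg i (e.eval w s.reg) }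
  | .load i e :: K =>
      { s with
        todo := K
        reg := Function.update s.reg i (s.mem (e.eval w s.reg))
        space := max s.space (e.eval w s.reg + 1) }
  | .store e₁ e₂ :: K =>
      { s with
        todo := K
        mem := Function.update s.mem (e₁.eval w s.reg) (e₂.eval w s.reg)
        space := max s.space (e₁.eval w s.reg + 1) }
  | .rand i :: K =>
      { s with
        todo := K
        reg := Function.update s.reg i (ω s.drawn : ℕ)
        drawn := s.drawn + 1 }
  | .seq p q :: K => { s with todo := p :: q :: K }
  | .ite e p q :: K => { s with todo := (if e.eval w s.reg ≠ 0 then p else q) :: K }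
  | .loop e p :: K =>
      { s with todo := if e.eval w s.reg ≠ 0 then p :: .loop e p :: K else K }

/-- The configuration after `τ` steps. -/
def run {w : ℕ} (ω : Tape w) (s : Config) (τ : ℕ) : Config :=
  (step ω)^[τ] s

/-- The configuration `s` has halted. -/
def Halted (s : Config) : Prop :=
  s.todo = []

/-- The number of steps until the machine halts, `⊤` if it never does. -/
noncomputable def runTime {w : ℕ} (ω : Tape w) (s : Config) : ENNReal :=
  ⨅ (τ : ℕ) (_ : Halted (run ω s τ)), (τ : ENNReal)

/-- The machine halts with `x = p / q` in its output registers: `p` in register `0` and `q ≠ 0`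
in register `1`. -/
def Outputs {w : ℕ} (ω : Tape w) (s : Config) (x : ℝ) : Prop :=
  ∃ τ, Halted (run ω s τ) ∧ (run ω s τ).reg 1 ≠ 0 ∧
    x = ((run ω s τ).reg 0 : ℝ) / ((run ω s τ).reg 1 : ℝ)

/-- The start of program `P` on a graph with vertices `0, …, n - 1`, given by a list `L` of its
edges, and on a further input word `k`. Registers `0`, `1`, `2` hold `n`, the number of edges, and
`k`; cells `2 i` and `2 i + 1` of the memory hold the endpoints of the `i`-th edge. Everything
else is `0`. -/
def start (P : Prog) {n : ℕ} (L : List (Fin n × Fin n)) (k : ℕ) : Config where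
  todo := [P]
  reg := fun i => [n, L.length, k].getD i 0
  mem := fun j => (L.flatMap fun p => [(p.1 : ℕ), (p.2 : ℕ)]).getD j 0
  drawn := 0
  space := 2 * L.length

/-- The number of bits of `n + m + k`. -/
def inputBits (n m k : ℕ) : ℕ :=
  Nat.size (n + m + k)

end Truss

namespace Truss

/-! ### A verification calculus for the machine

The memory is viewed as sixteen interleaved arrays: entry `i` of array `j` is the cell
`16 * i + j`. The state of a program is augmented by a clock. -/

/-! Regard the edges of the graph as the vertices of a 3-uniform hypergraph whose hyperedges are the
triangles. The trussness `t` is the degeneracy of this hypergraph: the largest `k` for which some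
nonempty set of edges has all degrees at least `k` in the hypergraph induced on it
(`Net.exists_truss`). Peeling computes a degeneracy exactly (`wp_peel`). To meet the time and space
bounds, only a random sample of the triangles is peeled.

Sampling. Vertices are ordered by degree. A candidate is an edge together with a neighbour of its
lower end. Every triangle is found at exactly one candidate, and there are `W ≤ 2 m α` candidates,
since the sum of the minimum end degrees over the edges is bounded through the arboricity
(`Net.W_le_arboricity`). The candidates are numbered and cut into blocks of length `B = 2 ^ b`; one
random word selects one candidate of each block. If the sampled hypergraph has degeneracy `τ`, the
estimate is `τ B`.

Accuracy. A lower bound on `τ` needs only the edge set `R` of the `t`-truss, each edge of which lies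
in at least `t` triangles within `R` (`Net.le_core`). For the upper bound, delete the edges in an
order in which each lies in at most `t` remaining triangles, and charge those triangles to it. In
any set `A` of edges, the first deleted edge has all its triangles within `A` among its charges
(`Net.exists_charge`, `Net.core_le`). These at most `2 m` sets of triangles are fixed before
sampling, so a Chernoff bound and a union bound over them suffice, rather than over all `A`
(`Net.not_balanced_le`). The relative error is at most `1 / k`, with `k = ⌈1/ε⌉`, as soon as `t / B`
is at least about half of `L = Θ(k² log m)`.

Rounds. The first `B` is chosen with `W` about `B m L`, so that the sample fits into `O(m L)` cells;
then `B` is halved until `τ ≥ L` or `B = 1`. A balanced round costs `O((W + m t) / B)`, so the total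
is geometric and dominated by the last round (`MainInv.round`). Here `W + m t = O(m α)`, because `t
< 2 α` (`trussness_lt_two_mul_arboricity`). The last `B` is at least of order `(T + 1) / (m L)`,
because the number `T` of triangles is at most `W` and at most `m t`; this produces the minimum in
the time bound (`good_time_le`). The argument gives `ε ^ (-2)` and no `log t`; the remaining factors
of the statement are slack. On the other tapes a polynomial worst case is outweighed by the failure
probability (`bad_time_le`), and the cap on stored triangles bounds the space on every run. -/

/-- The word size bound. -/
def wordBound (w : ℕ) : ℕ := 2 ^ w

/-- Program states with arrays and a clock. -/
@[ext] structure St where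
  /-- registers -/
  r : ℕ → ℕ
  /-- arrays -/
  A : ℕ → ℕ → ℕ
  /-- the number of random words drawn -/
  d : ℕ
  /-- the clock -/
  t : ℕ

namespace St

/-- One time unit passes. -/
def tick (s : St) : St := { s with t := s.t + 1 }

/-- Register assignment. -/
def setR (s : St) (i v : ℕ) : St := { s with r := Function.update s.r i v, t := s.t + 1 }

/-- Array assignment. -/
def setA (s : St) (j i v : ℕ) : St :=
  { s with A := Function.update s.A j (Function.update (s.A j) i v), t := s.t + 1 }

/-- Drawing a random word `v`. -/
def draw (s : St) (i v : ℕ) : St :=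
  { s with r := Function.update s.r i v, d := s.d + 1, t := s.t + 1 }

variable (s : St) (i j v x : ℕ)

@[simp] theorem tick_r : s.tick.r = s.r := rfl
@[simp] theorem tick_A : s.tick.A = s.A := rfl
@[simp] theorem tick_d : s.tick.d = s.d := rfl
@[simp] theorem tick_t : s.tick.t = s.t + 1 := rfl
@[simp] theorem setR_r : (s.setR i v).r x = if x = i then v else s.r x := by
  simp [setR, Function.update_apply]
@[simp] theorem setR_A : (s.setR i v).A = s.A := rfl
@[simp] theorem setR_d : (s.setR i v).d = s.d := rfl
@[simp] theorem setR_t : (s.setR i v).t = s.t + 1 := rfl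
@[simp] theorem setA_r : (s.setA j i v).r = s.r := rfl
@[simp] theorem setA_A :
    (s.setA j i v).A x = if x = j then Function.update (s.A j) i v else s.A x := by
  simp only [setA, Function.update_apply]
@[simp] theorem setA_d : (s.setA j i v).d = s.d := rfl
@[simp] theorem setA_t : (s.setA j i v).t = s.t + 1 := rfl
@[simp] theorem draw_r : (s.draw i v).r x = if x = i then v else s.r x := by
  simp [draw, Function.update_apply]
@[simp] theorem draw_A : (s.draw i v).A = s.A := rfl
@[simp] theorem draw_d : (s.draw i v).d = s.d + 1 := rfl
@[simp] theorem draw_t : (s.draw i v).t = s.t + 1 := rfl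

/-- `s'` differs from `s` only in the registers `R`, the arrays `J`, the clock and the number of
drawn words. -/
def Frame (s s' : St) (R J : List ℕ) : Prop :=
  (∀ i, i ∉ R → s'.r i = s.r i) ∧ ∀ j, j ∉ J → s'.A j = s.A j

variable {s} {s' s'' : St} {R J R' J' : List ℕ} {i j v x : ℕ}

@[simp] theorem Frame.refl : Frame s s R J := ⟨fun _ _ => rfl, fun _ _ => rfl⟩

@[simp] theorem Frame.tick_iff : Frame s s'.tick R J ↔ Frame s s' R J := Iff.rfl

@[simp] theorem Frame.setR_iff (hi : i ∈ R) : Frame s (s'.setR i v) R J ↔ Frame s s' R J :=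
  and_congr (forall₂_congr fun x hx => by
    rw [setR_r, if_neg (by rintro rfl; exact hx hi)]) Iff.rfl

@[simp] theorem Frame.draw_iff (hi : i ∈ R) : Frame s (s'.draw i v) R J ↔ Frame s s' R J :=
  and_congr (forall₂_congr fun x hx => by
    rw [draw_r, if_neg (by rintro rfl; exact hx hi)]) Iff.rfl

@[simp] theorem Frame.setA_iff (hj : j ∈ J) : Frame s (s'.setA j i v) R J ↔ Frame s s' R J :=
  and_congr Iff.rfl (forall₂_congr fun x hx => by
    rw [setA_A, if_neg (by rintro rfl; exact hx hj)])

theorem Frame.trans (h : Frame s s' R J) (h' : Frame s' s'' R' J') (hR : R' ⊆ R) (hJ : J' ⊆ J) :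
    Frame s s'' R J :=
  ⟨fun x hx => (h'.1 x fun hx' => hx (hR hx')).trans (h.1 x hx),
    fun x hx => (h'.2 x fun hx' => hx (hJ hx')).trans (h.2 x hx)⟩

theorem Frame.mono (h : Frame s s' R' J') (hR : R' ⊆ R) (hJ : J' ⊆ J) :
    Frame s s' R J :=
  Frame.refl.trans h hR hJ

end St

instance : Add Expr := ⟨.op .add⟩
instance : Sub Expr := ⟨.op .sub⟩
instance : Mul Expr := ⟨.op .mul⟩
instance : Div Expr := ⟨.op .div⟩
instance : Mod Expr := ⟨.op .mod⟩
instance (a : ℕ) : OfNat Expr a := ⟨.const a⟩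

/-- `e₁ < e₂` -/
def Expr.lt (e₁ e₂ : Expr) : Expr := .op .lt e₁ e₂

/-- `e₁ = e₂` -/
def Expr.eq (e₁ e₂ : Expr) : Expr := .op .eq e₁ e₂

/-- The operations without overflow. -/
def Op.val : Op → ℕ → ℕ → ℕ
  | .add, x, y => x + y
  | .sub, x, y => x - y
  | .mul, x, y => x * y
  | .div, x, y => x / y
  | .mod, x, y => x % y
  | .lt, x, y => if x < y then 1 else 0
  | .eq, x, y => if x = y then 1 else 0

/-- The value of an expression without overflow. -/
def Expr.val (r : ℕ → ℕ) : Expr → ℕ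
  | .const a => a
  | .reg i => r i
  | .op o e₁ e₂ => o.val (e₁.val r) (e₂.val r)

/-- The evaluation of the expression does not overflow the word bound `E`. -/
def Expr.fits (E : ℕ) (r : ℕ → ℕ) : Expr → Prop
  -- The first alternative lets small literals pass without knowledge of `E`; `Mach.const_lt`
  -- justifies it.
  | .const a => a ≤ 16 ∨ a < E
  | .reg _ => True
  | .op .add e₁ e₂ => e₁.fits E r ∧ e₂.fits E r ∧ e₁.val r + e₂.val r < E
  | .op .mul e₁ e₂ => e₁.fits E r ∧ e₂.fits E r ∧ e₁.val r * e₂.val r < E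
  -- The remaining operations return at most their first argument, or at most `1`, and so never
  -- overflow.
  | .op _ e₁ e₂ => e₁.fits E r ∧ e₂.fits E r

section
variable (E : ℕ) (r : ℕ → ℕ) (e e' : Expr) (a i : ℕ)

@[simp] theorem Expr.val_ofNat : Expr.val r ofNat(a) = (OfNat.ofNat a : ℕ) := rfl
@[simp] theorem Expr.val_const : Expr.val r (.const a) = a := rfl
@[simp] theorem Expr.val_reg : Expr.val r (.reg i) = r i := rfl
@[simp] theorem Expr.val_add : (e + e').val r = e.val r + e'.val r := rfl
@[simp] theorem Expr.val_sub : (e - e').val r = e.val r - e'.val r := rfl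
@[simp] theorem Expr.val_mul : (e * e').val r = e.val r * e'.val r := rfl
@[simp] theorem Expr.val_div : (e / e').val r = e.val r / e'.val r := rfl
@[simp] theorem Expr.val_mod : (e % e').val r = e.val r % e'.val r := rfl
@[simp] theorem Expr.val_lt : (e.lt e').val r = if e.val r < e'.val r then 1 else 0 := rfl
@[simp] theorem Expr.val_eq : (e.eq e').val r = if e.val r = e'.val r then 1 else 0 := rfl
@[simp] theorem Expr.val_lt_ne_zero : (e.lt e').val r ≠ 0 ↔ e.val r < e'.val r := by simp
@[simp] theorem Expr.val_lt_eq_zero : (e.lt e').val r = 0 ↔ e'.val r ≤ e.val r := by simp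
@[simp] theorem Expr.val_eq_ne_zero : (e.eq e').val r ≠ 0 ↔ e.val r = e'.val r := by simp
@[simp] theorem Expr.val_eq_eq_zero : (e.eq e').val r = 0 ↔ e.val r ≠ e'.val r := by simp
@[simp] theorem Expr.fits_ofNat : Expr.fits E r ofNat(a) ↔ (OfNat.ofNat a : ℕ) ≤ 16 ∨ (OfNat.ofNat a : ℕ) < E := Iff.rfl
@[simp] theorem Expr.fits_const : Expr.fits E r (.const a) ↔ a ≤ 16 ∨ a < E := Iff.rfl
@[simp] theorem Expr.fits_reg : Expr.fits E r (.reg i) ↔ True := Iff.rfl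
@[simp] theorem Expr.fits_add : (e + e').fits E r ↔
    e.fits E r ∧ e'.fits E r ∧ e.val r + e'.val r < E := Iff.rfl
@[simp] theorem Expr.fits_mul : (e * e').fits E r ↔
    e.fits E r ∧ e'.fits E r ∧ e.val r * e'.val r < E := Iff.rfl
@[simp] theorem Expr.fits_sub : (e - e').fits E r ↔ e.fits E r ∧ e'.fits E r := Iff.rfl
@[simp] theorem Expr.fits_div : (e / e').fits E r ↔ e.fits E r ∧ e'.fits E r := Iff.rfl
@[simp] theorem Expr.fits_mod : (e % e').fits E r ↔ e.fits E r ∧ e'.fits E r := Iff.rfl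
@[simp] theorem Expr.fits_lt : (e.lt e').fits E r ↔ e.fits E r ∧ e'.fits E r := Iff.rfl
@[simp] theorem Expr.fits_eq : (e.eq e').fits E r ↔ e.fits E r ∧ e'.fits E r := Iff.rfl
end

theorem Expr.eval_lt {w : ℕ} {r : ℕ → ℕ} (hr : ∀ i, r i < wordBound w) (e : Expr) :
    e.eval w r < wordBound w := by
  have h2 : 0 < 2 ^ w := by positivity
  cases e with
  | const a => exact Nat.mod_lt _ h2
  | reg i => exact hr i
  | op o e₁ e₂ => cases o <;> exact Nat.mod_lt _ h2

theorem Expr.eval_eq_val {w : ℕ} {r : ℕ → ℕ} (hw : 16 < wordBound w)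
    (hr : ∀ i, r i < wordBound w) (e : Expr) (h : e.fits (wordBound w) r) :
    e.eval w r = e.val r := by
  have hsmall : ∀ p : Prop, ∀ [Decidable p], (if p then 1 else 0) < 2 ^ w := by
    intro p _
    have : 16 < 2 ^ w := hw
    split_ifs <;> omega
  induction e with
  | const a =>
    refine Nat.mod_eq_of_lt ?_
    have : 16 < 2 ^ w := hw
    rcases h with h | h
    · omega
    · exact h
  | reg i => rfl
  | op o e₁ e₂ ih₁ ih₂ =>
    have l₁ := Expr.eval_lt hr e₁
    have l₂ := Expr.eval_lt hr e₂
    cases o with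
    | add =>
      obtain ⟨h1, h2, h3⟩ := h
      simp only [Expr.eval, Op.eval, ih₁ h1, ih₂ h2]
      exact Nat.mod_eq_of_lt h3
    | mul =>
      obtain ⟨h1, h2, h3⟩ := h
      simp only [Expr.eval, Op.eval, ih₁ h1, ih₂ h2]
      exact Nat.mod_eq_of_lt h3
    | sub =>
      obtain ⟨h1, h2⟩ := h
      rw [ih₁ h1] at l₁
      simp only [Expr.eval, Op.eval, ih₁ h1, ih₂ h2]
      exact Nat.mod_eq_of_lt ((Nat.sub_le _ _).trans_lt l₁)
    | div =>
      obtain ⟨h1, h2⟩ := h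
      rw [ih₁ h1] at l₁
      simp only [Expr.eval, Op.eval, ih₁ h1, ih₂ h2]
      exact Nat.mod_eq_of_lt ((Nat.div_le_self _ _).trans_lt l₁)
    | mod =>
      obtain ⟨h1, h2⟩ := h
      rw [ih₁ h1] at l₁
      simp only [Expr.eval, Op.eval, ih₁ h1, ih₂ h2]
      exact Nat.mod_eq_of_lt ((Nat.mod_le _ _).trans_lt l₁)
    | lt =>
      obtain ⟨h1, h2⟩ := h
      simp only [Expr.eval, Op.eval, ih₁ h1, ih₂ h2]
      exact Nat.mod_eq_of_lt (hsmall _)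
    | eq =>
      obtain ⟨h1, h2⟩ := h
      simp only [Expr.eval, Op.eval, ih₁ h1, ih₂ h2]
      exact Nat.mod_eq_of_lt (hsmall _)

/-- The memory that holds the given arrays. -/
def memOf (A : ℕ → ℕ → ℕ) : ℕ → ℕ := fun x => A (x % 16) (x / 16)

theorem memOf_update (A : ℕ → ℕ → ℕ) (x v : ℕ) :
    memOf (Function.update A (x % 16) (Function.update (A (x % 16)) (x / 16) v)) =
      Function.update (memOf A) x v := by
  funext y
  simp only [memOf, Function.update_apply]
  by_cases h : y = x
  · simp [h]
  · by_cases h' : y % 16 = x % 16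
    · have : y / 16 ≠ x / 16 := by omega
      simp [h, h', this]
    · simp [h, h']

/-- The assumptions on the word size `w` and the number `I` of entries of the arrays. -/
class Mach (w I : ℕ) : Prop where
  -- All addresses `16 * i + j` with `i < I` and `j < 16` are then words.
  index_lt : 16 * I < wordBound w
  const_lt : 16 < wordBound w

/-- The configuration `c` is in the state `s` with `K` to be done. -/
structure Sim (w I : ℕ) (K : List Prog) (s : St) (c : Config) : Prop where
  todo : c.todo = K
  reg : c.reg = s.r
  mem : c.mem = memOf s.A
  drawn : c.drawn = s.d
  space : c.space ≤ 16 * I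
  reg_lt : ∀ i, s.r i < wordBound w
  mem_lt : ∀ j i, s.A j i < wordBound w

section
variable {w I : ℕ}

/-- Program `P` started in `s` ends in a state with property `Q`. -/
def WP (ω : Tape w) (I : ℕ) (P : Prog) (s : St) (Q : St → Prop) : Prop :=
  -- The tape is fixed, so a run is deterministic and the clock difference is the exact number of
  -- steps. The continuation `K` is arbitrary, which makes specifications compose.
  ∃ s' : St, Q s' ∧ s.t ≤ s'.t ∧
    ∀ K c, Sim w I (P :: K) s c → Sim w I K s' (run ω c (s'.t - s.t))

/-- The verification condition for a program; loops are left to `WP`. -/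
def vc (ω : Tape w) (I : ℕ) : Prog → St → (St → Prop) → Prop
  | .skip, s, Q => Q s.tick
  | .set i e, s, Q => e.fits (wordBound w) s.r ∧ Q (s.setR i (e.val s.r))
  | .load i e, s, Q =>
      e.fits (wordBound w) s.r ∧ e.val s.r / 16 < I ∧ Q (s.setR i (memOf s.A (e.val s.r)))
  | .store e₁ e₂, s, Q =>
      e₁.fits (wordBound w) s.r ∧ e₂.fits (wordBound w) s.r ∧ e₁.val s.r / 16 < I ∧
        Q (s.setA (e₁.val s.r % 16) (e₁.val s.r / 16) (e₂.val s.r))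
  | .rand i, s, Q => Q (s.draw i (ω s.d))
  | .seq p q, s, Q => vc ω I p s.tick fun s' => vc ω I q s' Q
  | .ite e p q, s, Q => e.fits (wordBound w) s.r ∧
      (e.val s.r ≠ 0 → vc ω I p s.tick Q) ∧ (e.val s.r = 0 → vc ω I q s.tick Q)
  | .loop e p, s, Q => WP ω I (.loop e p) s Q

theorem run_add (ω : Tape w) (c : Config) (a b : ℕ) : run ω c (a + b) = run ω (run ω c a) b := by
  simp only [run]
  rw [add_comm, Function.iterate_add_apply]

theorem WP.mono {ω : Tape w} {P : Prog} {s : St} {Q Q' : St → Prop} (h : WP ω I P s Q)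
    (hQ : ∀ s', Q s' → Q' s') : WP ω I P s Q' := by
  obtain ⟨s', h1, h2⟩ := h
  exact ⟨s', hQ _ h1, h2⟩

theorem WP.of_step {ω : Tape w} {P : Prog} {s s' : St} {Q : St → Prop} (hQ : Q s')
    (ht : s'.t = s.t + 1) (h : ∀ K c, Sim w I (P :: K) s c → Sim w I K s' (step ω c)) :
    WP ω I P s Q := by
  refine ⟨s', hQ, by omega, fun K c hc => ?_⟩
  rw [ht, Nat.add_sub_cancel_left]
  exact h K c hc

/-- If one step leads to the program list `Ps`, it suffices to run that list. -/
theorem WP.of_step_of_seq {ω : Tape w} {P p q : Prog} {s : St} {Q : St → Prop}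
    (h : ∀ K c, Sim w I (P :: K) s c → Sim w I (p :: q :: K) s.tick (step ω c))
    (hp : WP ω I p s.tick fun s' => WP ω I q s' Q) : WP ω I P s Q := by
  obtain ⟨s1, ⟨s2, hQ, ht2, h2⟩, ht1, h1⟩ := hp
  simp only [St.tick_t] at ht1
  refine ⟨s2, hQ, by omega, fun K c hc => ?_⟩
  have e : s2.t - s.t = 1 + ((s1.t - s.tick.t) + (s2.t - s1.t)) := by
    simp only [St.tick_t]; omega
  rw [e, run_add, run_add]
  exact h2 _ _ (h1 _ _ (h _ _ hc))

theorem WP.of_step_of_one {ω : Tape w} {P p : Prog} {s : St} {Q : St → Prop}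
    (h : ∀ K c, Sim w I (P :: K) s c → Sim w I (p :: K) s.tick (step ω c))
    (hp : WP ω I p s.tick Q) : WP ω I P s Q := by
  obtain ⟨s1, hQ, ht1, h1⟩ := hp
  simp only [St.tick_t] at ht1
  refine ⟨s1, hQ, by omega, fun K c hc => ?_⟩
  have e : s1.t - s.t = 1 + (s1.t - s.tick.t) := by
    simp only [St.tick_t]; omega
  rw [e, run_add]
  exact h1 _ _ (h _ _ hc)

theorem Sim.eval [Mach w I] {K : List Prog} {s : St} {c : Config} (h : Sim w I K s c) {e : Expr}
    (he : e.fits (wordBound w) s.r) : e.eval w c.reg = e.val s.r := by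
  rw [h.reg]
  exact Expr.eval_eq_val (Mach.const_lt I) h.reg_lt e he

theorem Sim.val_lt [Mach w I] {K : List Prog} {s : St} {c : Config} (h : Sim w I K s c) {e : Expr}
    (he : e.fits (wordBound w) s.r) : e.val s.r < wordBound w := by
  rw [← Expr.eval_eq_val (Mach.const_lt I) h.reg_lt e he]
  exact Expr.eval_lt h.reg_lt e

theorem update_lt {f : ℕ → ℕ} {E : ℕ} (hf : ∀ i, f i < E) {i v : ℕ} (hv : v < E) (x : ℕ) :
    Function.update f i v x < E := by
  rw [Function.update_apply]; split_ifs
  · exact hv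
  · exact hf x

theorem WP.seq {ω : Tape w} {p q : Prog} {s : St} {Q : St → Prop}
    (h : WP ω I p s.tick fun s' => WP ω I q s' Q) : WP ω I (.seq p q) s Q := by
  refine WP.of_step_of_seq (p := p) (q := q) (fun K c hc => ?_) h
  have := hc.todo
  simp only [step, this]
  exact ⟨rfl, hc.reg, hc.mem, hc.drawn, hc.space, hc.reg_lt, hc.mem_lt⟩

theorem WP.ite [Mach w I] {ω : Tape w} {e : Expr} {p q : Prog} {s : St} {Q : St → Prop}
    (he : e.fits (wordBound w) s.r) (hp : e.val s.r ≠ 0 → WP ω I p s.tick Q)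
    (hq : e.val s.r = 0 → WP ω I q s.tick Q) : WP ω I (.ite e p q) s Q := by
  by_cases h0 : e.val s.r = 0
  · refine WP.of_step_of_one (p := q) (fun K c hc => ?_) (hq h0)
    have := hc.todo
    simp only [step, this, hc.eval he, h0]
    exact ⟨by simp, hc.reg, hc.mem, hc.drawn, hc.space, hc.reg_lt, hc.mem_lt⟩
  · refine WP.of_step_of_one (p := p) (fun K c hc => ?_) (hp h0)
    have := hc.todo
    simp only [step, this, hc.eval he]
    exact ⟨by simp [h0], hc.reg, hc.mem, hc.drawn, hc.space, hc.reg_lt, hc.mem_lt⟩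

/-- The condition `vc` is computed by recursion on the program, so `simp` can unfold straight-line
code into arithmetic side conditions; loops and called subprograms are supplied as `WP` facts. -/
theorem vc.sound [Mach w I] {ω : Tape w} {P : Prog} {s : St} {Q : St → Prop}
    (h : vc ω I P s Q) : WP ω I P s Q := by
  induction P generalizing s Q with
  | skip =>
    refine WP.of_step h rfl fun K c hc => ?_
    have := hc.todo
    simp only [step, this]
    exact ⟨rfl, hc.reg, hc.mem, hc.drawn, hc.space, hc.reg_lt, hc.mem_lt⟩
  | set i e =>
    refine WP.of_step h.2 rfl fun K c hc => ?_
    have := hc.todo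
    simp only [step, this, hc.eval h.1]
    refine ⟨rfl, ?_, hc.mem, hc.drawn, hc.space, update_lt hc.reg_lt (hc.val_lt h.1), hc.mem_lt⟩
    simp only [hc.reg, St.setR]
  | load i e =>
    refine WP.of_step h.2.2 rfl fun K c hc => ?_
    have := hc.todo
    simp only [step, this, hc.eval h.1]
    refine ⟨rfl, ?_, hc.mem, hc.drawn, ?_, update_lt hc.reg_lt (hc.mem_lt _ _), hc.mem_lt⟩
    · simp only [hc.reg, St.setR, hc.mem]
    · have := h.2.1
      have := hc.space
      simp only [max_le_iff]
      omega
  | store e₁ e₂ =>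
    refine WP.of_step h.2.2.2 rfl fun K c hc => ?_
    have := hc.todo
    simp only [step, this, hc.eval h.1, hc.eval h.2.1]
    refine ⟨rfl, hc.reg, ?_, hc.drawn, ?_, hc.reg_lt, ?_⟩
    · simp only [hc.mem, St.setA, memOf_update]
    · have := h.2.2.1
      have := hc.space
      simp only [max_le_iff]
      omega
    · intro j x
      rw [St.setA_A]
      split_ifs
      · exact update_lt (hc.mem_lt _) (hc.val_lt h.2.1) x
      · exact hc.mem_lt j x
  | rand i =>
    refine WP.of_step h rfl fun K c hc => ?_
    have := hc.todo
    simp only [step, this]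
    refine ⟨rfl, ?_, hc.mem, ?_, hc.space, update_lt hc.reg_lt (Fin.is_lt _), hc.mem_lt⟩
    · simp only [hc.reg, St.draw, hc.drawn]
    · simp only [hc.drawn, St.draw]
  | seq p q ihp ihq => exact WP.seq ((ihp h).mono fun s' hs' => ihq hs')
  | ite e p q ihp ihq =>
    exact WP.ite h.1 (fun he => ihp (h.2.1 he)) fun he => ihq (h.2.2 he)
  | loop e p => exact h

/-- The rule for loops, with an invariant and a variant. -/
theorem WP.loop [Mach w I] {ω : Tape w} {e : Expr} {p : Prog} {s : St} {Q : St → Prop}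
    (Inv : St → Prop) (μ : St → ℕ) (hs : Inv s)
    (h : ∀ s, Inv s → e.fits (wordBound w) s.r ∧
      (e.val s.r ≠ 0 → WP ω I p s.tick fun s' => Inv s' ∧ μ s' < μ s) ∧
      (e.val s.r = 0 → Q s.tick)) : WP ω I (.loop e p) s Q := by
  -- The variant serves termination only. Running times are tracked by bounds on the clock inside
  -- `Inv`.
  induction hn : μ s using Nat.strong_induction_on generalizing s with
  | _ n ih =>
    obtain ⟨hf, h1, h0⟩ := h s hs
    by_cases he : e.val s.r = 0
    · refine WP.of_step (h0 he) rfl fun K c hc => ?_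
      have := hc.todo
      simp only [step, this, hc.eval hf, he]
      exact ⟨by simp, hc.reg, hc.mem, hc.drawn, hc.space, hc.reg_lt, hc.mem_lt⟩
    · refine WP.of_step_of_seq (p := p) (q := .loop e p) (fun K c hc => ?_)
        ((h1 he).mono fun s' hs' => ih (μ s') (hn ▸ hs'.2) hs'.1 rfl)
      have := hc.todo
      simp only [step, this, hc.eval hf]
      exact ⟨by simp [he], hc.reg, hc.mem, hc.drawn, hc.space, hc.reg_lt, hc.mem_lt⟩

/-- Register `i` gets entry `e` of array `j`. -/
def ld (i j : ℕ) (e : Expr) : Prog := .load i (.const 16 * e + .const j)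

/-- Entry `e₁` of array `j` gets the value of `e₂`. -/
def st (j : ℕ) (e₁ e₂ : Expr) : Prog := .store (.const 16 * e₁ + .const j) e₂

@[simp] theorem vc_ld [Mach w I] (ω : Tape w) {i j : ℕ} (hj : j < 16) (e : Expr) (s : St)
    (Q : St → Prop) : vc ω I (ld i j e) s Q ↔
      e.fits (wordBound w) s.r ∧ e.val s.r < I ∧ Q (s.setR i (s.A j (e.val s.r))) := by
  have := Mach.index_lt (w := w) (I := I)
  have h1 : (16 * e.val s.r + j) / 16 = e.val s.r := by omega
  have h2 : (16 * e.val s.r + j) % 16 = j := by omega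
  simp only [ld, vc, Expr.fits_add, Expr.fits_mul, Expr.fits_const, Expr.val_add, Expr.val_mul,
    Expr.val_const, h1, memOf, h2]
  constructor
  · rintro ⟨⟨⟨_, h, _⟩, _, _⟩, h3⟩
    exact ⟨h, h3⟩
  · rintro ⟨h, h3, h4⟩
    exact ⟨⟨⟨Or.inl le_rfl, h, by omega⟩, Or.inl hj.le, by omega⟩, h3, h4⟩

@[simp] theorem vc_st [Mach w I] (ω : Tape w) {j : ℕ} (hj : j < 16) (e₁ e₂ : Expr) (s : St)
    (Q : St → Prop) : vc ω I (st j e₁ e₂) s Q ↔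
      e₁.fits (wordBound w) s.r ∧ e₂.fits (wordBound w) s.r ∧ e₁.val s.r < I ∧
        Q (s.setA j (e₁.val s.r) (e₂.val s.r)) := by
  have := Mach.index_lt (w := w) (I := I)
  have h1 : (16 * e₁.val s.r + j) / 16 = e₁.val s.r := by omega
  have h2 : (16 * e₁.val s.r + j) % 16 = j := by omega
  simp only [st, vc, Expr.fits_add, Expr.fits_mul, Expr.fits_const, Expr.val_add, Expr.val_mul,
    Expr.val_const, h1, h2]
  constructor
  · rintro ⟨⟨⟨_, h, _⟩, _, _⟩, h3⟩
    exact ⟨h, h3⟩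
  · rintro ⟨h, h3, h4⟩
    exact ⟨⟨⟨Or.inl le_rfl, h, by omega⟩, Or.inl hj.le, by omega⟩, h3, h4⟩

variable (ω : Tape w) (s : St) (Q : St → Prop)

@[simp] theorem vc_skip : vc ω I .skip s Q = Q s.tick := rfl
@[simp] theorem vc_set (i : ℕ) (e : Expr) : vc ω I (.set i e) s Q =
    (e.fits (wordBound w) s.r ∧ Q (s.setR i (e.val s.r))) := rfl
@[simp] theorem vc_rand (i : ℕ) : vc ω I (.rand i) s Q = Q (s.draw i (ω s.d)) := rfl
@[simp] theorem vc_seq (p q : Prog) : vc ω I (.seq p q) s Q =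
    vc ω I p s.tick fun s' => vc ω I q s' Q := rfl
@[simp] theorem vc_ite (e : Expr) (p q : Prog) : vc ω I (.ite e p q) s Q =
    (e.fits (wordBound w) s.r ∧
      (e.val s.r ≠ 0 → vc ω I p s.tick Q) ∧ (e.val s.r = 0 → vc ω I q s.tick Q)) := rfl
@[simp] theorem vc_loop (e : Expr) (p : Prog) : vc ω I (.loop e p) s Q = WP ω I (.loop e p) s Q := rfl

end

/-- Sequential composition. -/
infixr:60 " ;; " => Prog.seq

end Truss

namespace Truss

/-! ### Counting sort -/

/-- The number of items with key `v` among the first `N`. -/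
def cEq (c : ℕ → ℕ) (N v : ℕ) : ℕ := Nat.count (fun q => c q = v) N

/-- The number of items with key less than `v` among the first `N`. -/
def cLt (c : ℕ → ℕ) (N v : ℕ) : ℕ := Nat.count (fun q => c q < v) N

/-- The position of item `q` in the stable order by keys. -/
def rho (c : ℕ → ℕ) (N q : ℕ) : ℕ := cLt c N (c q) + cEq c q (c q)

section
variable (c : ℕ → ℕ) (N v q : ℕ)

theorem cEq_succ : cEq c (N + 1) v = cEq c N v + if c N = v then 1 else 0 := Nat.count_succ _ _

theorem cEq_zero : cEq c 0 v = 0 := Nat.count_zero _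

theorem cLt_zero_right : cLt c N 0 = 0 := by
  simp [cLt, Nat.count_eq_card_filter_range]

theorem cLt_succ_right : cLt c N (v + 1) = cLt c N v + cEq c N v := by
  induction N with
  | zero => simp [cLt, cEq]
  | succ N ih =>
    simp only [cLt, cEq, Nat.count_succ] at ih ⊢
    split_ifs <;> omega

theorem cLt_le : cLt c N v ≤ N := Nat.count_le _

theorem cEq_le : cEq c N v ≤ N := Nat.count_le _

theorem cLt_add_cEq_le : cLt c N v + cEq c N v ≤ N := by
  rw [← cLt_succ_right]; exact cLt_le c N _

theorem cLt_mono {v v' : ℕ} (h : v ≤ v') : cLt c N v ≤ cLt c N v' :=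
  by
  refine Nat.count_mono_left fun _ _ h' => ?_
  exact lt_of_lt_of_le h' h

variable {c N v q}

theorem cEq_lt (hq : q < N) : cEq c q (c q) < cEq c N (c q) :=
  Nat.count_strict_mono rfl hq

theorem rho_lt_end (hq : q < N) : rho c N q < cLt c N (c q) + cEq c N (c q) :=
  Nat.add_lt_add_left (cEq_lt hq) _

theorem rho_lt (hq : q < N) : rho c N q < N :=
  (rho_lt_end hq).trans_le (cLt_add_cEq_le c N _)

theorem le_rho : cLt c N (c q) ≤ rho c N q := Nat.le_add_right _ _

theorem rho_inj {q' : ℕ} (hq : q < N) (hq' : q' < N) (h : rho c N q = rho c N q') : q = q' := by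
  have key : ∀ a b, a < N → c a < c b → rho c N a < rho c N b := by
    intro a b ha hab
    calc rho c N a < cLt c N (c a + 1) := by rw [cLt_succ_right]; exact rho_lt_end ha
      _ ≤ cLt c N (c b) := cLt_mono c N hab
      _ ≤ rho c N b := le_rho
  rcases lt_trichotomy (c q) (c q') with h1 | h1 | h1
  · have := key _ _ hq h1; omega
  · by_contra hne
    simp only [rho, h1] at h
    rcases Nat.lt_or_gt_of_ne hne with h2 | h2
    · have := cEq_lt (c := c) h2; rw [h1] at this; omega
    · have := cEq_lt (c := c) h2; omega
  · have := key _ _ hq' h1; omega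

theorem exists_rho_eq {h : ℕ} (hh : h < N) : ∃ q < N, rho c N q = h := by
  have hinj : Set.InjOn (rho c N) (Finset.range N) := fun a ha b hb => rho_inj
    (Finset.mem_range.1 (Finset.mem_coe.1 ha)) (Finset.mem_range.1 (Finset.mem_coe.1 hb))
  have hmap : Set.MapsTo (rho c N) (Finset.range N) (Finset.range N) := fun a ha => by
    simp only [Finset.coe_range, Set.mem_Iio] at ha ⊢
    exact rho_lt ha
  obtain ⟨q, hq, e⟩ := Finset.surjOn_of_injOn_of_card_le _ hmap hinj le_rfl
    (show h ∈ (Finset.range N : Set ℕ) by simpa using hh)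
  exact ⟨q, by simpa using hq, e⟩

/-- An inverse of the sorting permutation: position `h` holds an item whose key has `h` in its
interval. -/
theorem perm_spec {π : ℕ → ℕ} (hπ : ∀ q < N, π (rho c N q) = q) {h : ℕ} (hh : h < N) :
    π h < N ∧ rho c N (π h) = h ∧ cLt c N (c (π h)) ≤ h ∧
      h < cLt c N (c (π h)) + cEq c N (c (π h)) := by
  obtain ⟨q, hq, rfl⟩ := exists_rho_eq (c := c) hh
  rw [hπ q hq]
  exact ⟨hq, rfl, le_rho, rho_lt_end hq⟩

/-- The position intervals of distinct keys are disjoint, so a position inside the interval of `v`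
can only hold an item with key `v`. -/
theorem perm_key {π : ℕ → ℕ} (hπ : ∀ q < N, π (rho c N q) = q) {h v : ℕ}
    (h1 : cLt c N v ≤ h) (h2 : h < cLt c N v + cEq c N v) : h < N ∧ c (π h) = v := by
  have hh : h < N := h2.trans_le (cLt_add_cEq_le c N v)
  obtain ⟨_, _, h3, h4⟩ := perm_spec hπ hh
  refine ⟨hh, ?_⟩
  rw [← cLt_succ_right] at h2 h4
  by_contra hne
  rcases Nat.lt_or_gt_of_ne hne with h5 | h5
  · have := cLt_mono c N (show c (π h) + 1 ≤ v from h5); omega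
  · have := cLt_mono c N (show v + 1 ≤ c (π h) from h5); omega

end

variable {w I : ℕ}

/-- Set the first entries of array `j` to `0`, their number being in register `14`. -/
def clear (j : ℕ) : Prog :=
  .set 10 0 ;; .loop ((Expr.reg 10).lt (.reg 14)) (st j (.reg 10) 0 ;; .set 10 (.reg 10 + 1))

theorem wp_clear [Mach w I] (ω : Tape w) (s : St) {j : ℕ} (hj : j < 16) (hI : s.r 14 ≤ I) :
    WP ω I (clear j) s fun s' => s.Frame s' [10] [j] ∧ (∀ v < s.r 14, s'.A j v = 0) ∧
      s'.d = s.d ∧ s'.t ≤ s.t + (4 * s.r 14 + 5) := by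
  have hE := Mach.index_lt (w := w) (I := I)
  refine vc.sound ?_
  simp only [clear, vc_seq, vc_set, vc_loop]
  refine ⟨by simp, WP.loop (fun s' => s.Frame s' [10] [j] ∧ s'.r 10 ≤ s.r 14 ∧
    (∀ v < s'.r 10, s'.A j v = 0) ∧ s'.d = s.d ∧ s'.t ≤ s.t + (4 * s'.r 10 + 2))
    (fun s' => s.r 14 - s'.r 10) (by simp) ?_⟩
  rintro s' ⟨hF, hle, hz, hd, ht⟩
  have e := hF.1 14 (by simp)
  refine ⟨by simp, fun hlt => vc.sound ?_, fun hge => ?_⟩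
  · simp [e] at hlt
    simp [hj, hF, hd, Function.update_apply]
    refine ⟨by omega, by omega, ⟨by omega, fun v hv hne => hz v (by omega), by omega⟩, by omega⟩
  · simp [e] at hge
    have : s'.r 10 = s.r 14 := by omega
    rw [this] at hz ht
    exact ⟨hF, hz, hd, by simp; omega⟩

/-- The counting loop of counting sort. -/
def csortCount (o : ℕ) : Prog :=
  .set 10 0 ;; .loop ((Expr.reg 10).lt (.reg 13))
    (ld 11 o (.reg 10) ;; ld 12 (o + 1) (.reg 11) ;; st (o + 1) (.reg 11) (.reg 12 + 1) ;;
      .set 10 (.reg 10 + 1))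

theorem wp_csortCount [Mach w I] (ω : Tape w) (s : St) {o : ℕ} (ho : o < 12) (hI : s.r 14 ≤ I)
    (hN : s.r 13 ≤ I) (hc : ∀ q < s.r 13, s.A o q < s.r 14)
    (hz : ∀ v < s.r 14, s.A (o + 1) v = 0) :
    WP ω I (csortCount o) s fun s' => s.Frame s' [10, 11, 12] [o + 1] ∧
      (∀ v < s.r 14, s'.A (o + 1) v = cEq (s.A o) (s.r 13) v) ∧
      s'.d = s.d ∧ s'.t ≤ s.t + (8 * s.r 13 + 5) := by
  have hE := Mach.index_lt (w := w) (I := I)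
  refine vc.sound ?_
  simp only [csortCount, vc_seq, vc_set, vc_loop]
  refine ⟨by simp, WP.loop (fun s' => s.Frame s' [10, 11, 12] [o + 1] ∧ s'.r 10 ≤ s.r 13 ∧
    (∀ v < s.r 14, s'.A (o + 1) v = cEq (s.A o) (s'.r 10) v) ∧ s'.d = s.d ∧
    s'.t ≤ s.t + (8 * s'.r 10 + 2))
    (fun s' => s.r 13 - s'.r 10) ?_ ?_⟩
  · simp [cEq_zero]; exact hz
  rintro s' ⟨hF, hle, hz, hd, ht⟩
  have e := hF.1 13 (by simp)
  have eo := hF.2 o (by simp)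
  refine ⟨by simp, fun hlt => vc.sound ?_, fun hge => ?_⟩
  · simp [e] at hlt
    have hcq := hc _ hlt
    have hcnt := cEq_le (s.A o) (s'.r 10) (s.A o (s'.r 10))
    have h0 : o < 16 := by omega
    have h1 : o + 1 < 16 := by omega
    simp [h0, h1, hF, hd, Function.update_apply, cEq_succ, eo, hz _ hcq]
    refine ⟨by omega, by omega, by omega, by omega, by omega, ⟨by omega, ?_, by omega⟩, by omega⟩
    intro v hv
    split_ifs with h2 h3 h3
    · rw [h2]
    · omega
    · omega
    · exact hz v hv
  · simp [e] at hge
    have : s'.r 10 = s.r 13 := by omega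
    rw [this] at hz ht
    exact ⟨hF, hz, hd, by simp; omega⟩

/-- The prefix sum loop of counting sort. -/
def csortPrefix (o : ℕ) : Prog :=
  .set 10 0 ;; .set 11 0 ;; .loop ((Expr.reg 10).lt (.reg 14))
    (st (o + 2) (.reg 10) (.reg 11) ;; st (o + 3) (.reg 10) (.reg 11) ;; ld 12 (o + 1) (.reg 10) ;;
      .set 11 (.reg 11 + .reg 12) ;; .set 10 (.reg 10 + 1))

theorem wp_csortPrefix [Mach w I] (ω : Tape w) (s : St) {o : ℕ} (ho : o < 12) (hI : s.r 14 ≤ I)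
    (hN : s.r 13 ≤ I) {c : ℕ → ℕ} (hz : ∀ v < s.r 14, s.A (o + 1) v = cEq c (s.r 13) v) :
    WP ω I (csortPrefix o) s fun s' => s.Frame s' [10, 11, 12] [o + 2, o + 3] ∧
      (∀ v < s.r 14, s'.A (o + 2) v = cLt c (s.r 13) v) ∧
      (∀ v < s.r 14, s'.A (o + 3) v = cLt c (s.r 13) v) ∧
      s'.d = s.d ∧ s'.t ≤ s.t + (10 * s.r 14 + 6) := by
  have hE := Mach.index_lt (w := w) (I := I)
  refine vc.sound ?_
  simp only [csortPrefix, vc_seq, vc_set, vc_loop]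
  refine ⟨by simp, by simp, WP.loop (fun s' => s.Frame s' [10, 11, 12] [o + 2, o + 3] ∧
    s'.r 10 ≤ s.r 14 ∧ s'.r 11 = cLt c (s.r 13) (s'.r 10) ∧
    (∀ v < s'.r 10, s'.A (o + 2) v = cLt c (s.r 13) v) ∧
    (∀ v < s'.r 10, s'.A (o + 3) v = cLt c (s.r 13) v) ∧ s'.d = s.d ∧
    s'.t ≤ s.t + (10 * s'.r 10 + 4))
    (fun s' => s.r 14 - s'.r 10) (by simp [cLt_zero_right]) ?_⟩
  rintro s' ⟨hF, hle, h11, h2, h3, hd, ht⟩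
  have e := hF.1 14 (by simp)
  have eo := hF.2 (o + 1) (by simp)
  refine ⟨by simp, fun hlt => vc.sound ?_, fun hge => ?_⟩
  · simp [e] at hlt
    have i1 : o + 1 < 16 := by omega
    have i2 : o + 2 < 16 := by omega
    have i3 : o + 3 < 16 := by omega
    have hb := cLt_add_cEq_le c (s.r 13) (s'.r 10)
    simp [i1, i2, i3, hF, hd, Function.update_apply, eo, hz _ hlt, h11, cLt_succ_right]
    refine ⟨by omega, by omega, by omega, ⟨by omega, ?_, ?_, by omega⟩, by omega⟩
    · intro v hv
      split_ifs with h4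
      · rw [h4]
      · exact h2 v (by omega)
    · intro v hv
      split_ifs with h4
      · rw [h4]
      · exact h3 v (by omega)
  · simp [e] at hge
    have : s'.r 10 = s.r 14 := by omega
    rw [this] at h2 h3 ht
    exact ⟨hF, h2, h3, hd, by simp; omega⟩

/-- The distribution loop of counting sort. -/
def csortFill (o : ℕ) : Prog :=
  .set 10 0 ;; .loop ((Expr.reg 10).lt (.reg 13))
    (ld 11 o (.reg 10) ;; ld 12 (o + 3) (.reg 11) ;; st (o + 4) (.reg 12) (.reg 10) ;;
      st (o + 3) (.reg 11) (.reg 12 + 1) ;; .set 10 (.reg 10 + 1))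

theorem wp_csortFill [Mach w I] (ω : Tape w) (s : St) {o : ℕ} (ho : o < 12) (hI : s.r 14 ≤ I)
    (hN : s.r 13 ≤ I) (hc : ∀ q < s.r 13, s.A o q < s.r 14)
    (hz : ∀ v < s.r 14, s.A (o + 3) v = cLt (s.A o) (s.r 13) v) :
    WP ω I (csortFill o) s fun s' => s.Frame s' [10, 11, 12] [o + 3, o + 4] ∧
      (∀ v < s.r 14, s'.A (o + 3) v = cLt (s.A o) (s.r 13) v + cEq (s.A o) (s.r 13) v) ∧
      (∀ q < s.r 13, s'.A (o + 4) (rho (s.A o) (s.r 13) q) = q) ∧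
      s'.d = s.d ∧ s'.t ≤ s.t + (10 * s.r 13 + 5) := by
  have hE := Mach.index_lt (w := w) (I := I)
  refine vc.sound ?_
  simp only [csortFill, vc_seq, vc_set, vc_loop]
  refine ⟨by simp, WP.loop (fun s' => s.Frame s' [10, 11, 12] [o + 3, o + 4] ∧ s'.r 10 ≤ s.r 13 ∧
    -- Array `o + 3` holds the next free position of each key. It starts as the beginning of the
    -- interval and ends as its end, which is what `Sorted.finish` records.
    (∀ v < s.r 14, s'.A (o + 3) v = cLt (s.A o) (s.r 13) v + cEq (s.A o) (s'.r 10) v) ∧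
    (∀ q < s'.r 10, s'.A (o + 4) (rho (s.A o) (s.r 13) q) = q) ∧ s'.d = s.d ∧
    s'.t ≤ s.t + (10 * s'.r 10 + 2))
    (fun s' => s.r 13 - s'.r 10) ?_ ?_⟩
  · simp [cEq_zero]; exact hz
  rintro s' ⟨hF, hle, h3, h4, hd, ht⟩
  have e := hF.1 13 (by simp)
  have eo := hF.2 o (by simp)
  refine ⟨by simp, fun hlt => vc.sound ?_, fun hge => ?_⟩
  · simp [e] at hlt
    have hcq := hc _ hlt
    have hr := rho_lt (c := s.A o) hlt
    have hinj := fun q (hq : q < s.r 13) => rho_inj (c := s.A o) hq hlt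
    simp only [rho] at hr hinj h4
    have h0 : o < 16 := by omega
    have i3 : o + 3 < 16 := by omega
    have i4 : o + 4 < 16 := by omega
    simp [h0, i3, i4, hF, hd, Function.update_apply, cEq_succ, eo, h3 _ hcq, rho]
    refine ⟨by omega, by omega, by omega, by omega, by omega, by omega,
      ⟨by omega, ?_, ?_, by omega⟩, by omega⟩
    · intro v hv
      split_ifs with h5 h6 h6
      · rw [h5]; omega
      · omega
      · omega
      · exact h3 v hv
    · intro q hq
      split_ifs with h5
      · exact (hinj q (by omega) h5).symm
      · refine h4 q ?_
        by_contra h6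
        have : q = s'.r 10 := by omega
        exact h5 (by rw [this])
  · simp [e] at hge
    have : s'.r 10 = s.r 13 := by omega
    rw [this] at h3 h4 ht
    exact ⟨hF, h3, h4, hd, by simp; omega⟩

/-- Counting sort of `r 13` items by keys below `r 14`. The keys are in array `o`; the arrays
`o + 1`, …, `o + 4` get, for each key, the number of items, the start and the end of the interval
of positions, and, for each position, the item. -/
def csort (o : ℕ) : Prog :=
  clear (o + 1) ;; csortCount o ;; csortPrefix o ;; csortFill o

/-- The items `q < N` with keys `c q < n` have been sorted by key. -/
structure Sorted (A : ℕ → ℕ → ℕ) (o : ℕ) (c : ℕ → ℕ) (N n : ℕ) : Prop where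
  num : ∀ v < n, A (o + 1) v = cEq c N v
  start : ∀ v < n, A (o + 2) v = cLt c N v
  finish : ∀ v < n, A (o + 3) v = cLt c N v + cEq c N v
  perm : ∀ q < N, A (o + 4) (rho c N q) = q

theorem wp_csort [Mach w I] (ω : Tape w) (s : St) {o : ℕ} (ho : o < 12) (hI : s.r 14 ≤ I)
    (hN : s.r 13 ≤ I) (hc : ∀ q < s.r 13, s.A o q < s.r 14) :
    WP ω I (csort o) s fun s' => s.Frame s' [10, 11, 12] [o + 1, o + 2, o + 3, o + 4] ∧
      Sorted s'.A o (s.A o) (s.r 13) (s.r 14) ∧ s'.d = s.d ∧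
      s'.t ≤ s.t + (18 * s.r 13 + 14 * s.r 14 + 30) := by
  refine WP.seq ((wp_clear ω s.tick (j := o + 1) (by omega) hI).mono ?_)
  rintro s1 ⟨F1, z1, d1, t1⟩
  simp only [St.tick_r, St.tick_t, St.tick_d] at z1 d1 t1
  have e13 : s1.r 13 = s.r 13 := F1.1 13 (by simp)
  have e14 : s1.r 14 = s.r 14 := F1.1 14 (by simp)
  have ec : s1.A o = s.A o := F1.2 o (by simp)
  refine WP.seq ((wp_csortCount ω s1.tick ho ?_ ?_ ?_ ?_).mono ?_) <;>
    simp only [St.tick_r, St.tick_A, St.tick_t, St.tick_d, e13, e14, ec]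
  · exact hI
  · exact hN
  · exact hc
  · exact z1
  rintro s2 ⟨F2, z2, d2, t2⟩
  have e13 : s2.r 13 = s.r 13 := (F2.1 13 (by simp)).trans e13
  have e14 : s2.r 14 = s.r 14 := (F2.1 14 (by simp)).trans e14
  have ec : s2.A o = s.A o := (F2.2 o (by simp)).trans ec
  refine WP.seq ((wp_csortPrefix ω s2.tick (c := s.A o) ho ?_ ?_ ?_).mono ?_) <;>
    simp only [St.tick_r, St.tick_A, St.tick_t, St.tick_d, e13, e14]
  · exact hI
  · exact hN
  · exact z2
  rintro s3 ⟨F3, z3, z3', d3, t3⟩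
  have e13 : s3.r 13 = s.r 13 := (F3.1 13 (by simp)).trans e13
  have e14 : s3.r 14 = s.r 14 := (F3.1 14 (by simp)).trans e14
  have ec : s3.A o = s.A o := (F3.2 o (by simp)).trans ec
  refine (wp_csortFill ω s3 ho ?_ ?_ ?_ ?_).mono ?_ <;> simp only [e13, e14, ec]
  · exact hI
  · exact hN
  · exact hc
  · exact z3'
  rintro s4 ⟨F4, z4, z4', d4, t4⟩
  refine ⟨?_, ⟨?_, ?_, z4, z4'⟩, by omega, by omega⟩
  · refine St.Frame.trans (St.Frame.trans (St.Frame.trans (s' := s1) (R := [10, 11, 12])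
      (J := [o + 1, o + 2, o + 3, o + 4]) ?_ F2 ?_ ?_) F3 ?_ ?_) F4 ?_ ?_ <;> try simp
    exact St.Frame.mono F1 (by simp) (by simp)
  · intro v hv
    rw [F4.2 (o + 1) (by simp), F3.2 (o + 1) (by simp)]
    exact z2 v hv
  · intro v hv
    rw [F4.2 (o + 2) (by simp)]
    exact z3 v hv

end Truss

namespace Truss

/-! ### Peeling -/

open Classical in
/-- The hyperedges are the triples `3 x, 3 x + 1, 3 x + 2` of nodes; the node `y` lies at the
vertex `ed y`. In the hypergraph induced on `A` all degrees are at least `K`. -/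
def Feasible (ed : ℕ → ℕ) (N K : ℕ) (A : Finset ℕ) : Prop :=
  ∀ e ∈ A, K ≤ ((Finset.range N).filter fun y : ℕ =>
    ed y = e ∧ ∀ i < 3, ed (3 * (y / 3) + i) ∈ A).card

theorem Feasible.anti {ed : ℕ → ℕ} {N K K' : ℕ} {A : Finset ℕ} (h : Feasible ed N K A)
    (hK : K' ≤ K) : Feasible ed N K' A := fun e he => hK.trans (h e he)

/-- The invariant of peeling at threshold `K`: `dead` marks the vertices in the queue `Q`, of
length `qt`, and `sup` counts the remaining nodes, `U`, at each vertex. -/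
structure PeelInv (ed : ℕ → ℕ) (N m K : ℕ) (U : Finset ℕ) (sup dead Q : ℕ → ℕ) (qt : ℕ) :
    Prop where
  Q_lt : ∀ i < qt, Q i < m
  Q_inj : ∀ i < qt, ∀ j < qt, Q i = Q j → i = j
  Q_dead : ∀ i < qt, dead (Q i) ≠ 0
  dead_Q : ∀ e < m, dead e ≠ 0 → ∃ i < qt, Q i = e
  sup_eq : ∀ e < m, sup e = (U.filter fun y => ed y = e).card
  U_lt : ∀ y ∈ U, y < N
  gone : ∀ y < N, y ∉ U → ∃ i < 3, dead (ed (3 * (y / 3) + i)) ≠ 0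
  -- Peeling at threshold `K` never kills an edge of a set feasible at `K`; once everything is dead,
  -- no nonempty feasible set exists.
  sound : ∀ A : Finset ℕ, (∀ e ∈ A, e < m) → Feasible ed N K A → ∀ e ∈ A, dead e = 0

section
variable {ed : ℕ → ℕ} {N m K : ℕ} {U : Finset ℕ} {sup dead Q : ℕ → ℕ} {qt : ℕ}

theorem PeelInv.le_of (h : PeelInv ed N m K U sup dead Q qt) : qt ≤ m := by
  have := Finset.card_le_card_of_injOn (s := Finset.range qt) (t := Finset.range m) Q
    (fun i hi => by
      simp only [Finset.coe_range, Set.mem_Iio] at hi ⊢; exact h.Q_lt i hi)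
    (fun i hi j hj hij => h.Q_inj i (by simpa using hi) j (by simpa using hj) hij)
  simpa using this

theorem PeelInv.exists_alive (h : PeelInv ed N m K U sup dead Q qt) (hlt : qt < m) :
    ∃ e < m, dead e = 0 := by
  by_contra! hall
  have hsub : Finset.range m ⊆ (Finset.range qt).image Q := fun e he => by
    obtain ⟨i, hi, rfl⟩ := h.dead_Q e (by simpa using he) (hall e (by simpa using he))
    exact Finset.mem_image_of_mem _ (by simpa using hi)
  have := (Finset.card_le_card hsub).trans Finset.card_image_le
  simp at this
  omega

theorem PeelInv.lt_of (h : PeelInv ed N m K U sup dead Q qt) {f : ℕ} (hf : f < m)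
    (hd : dead f = 0) : qt < m := by
  refine lt_of_le_of_ne h.le_of ?_
  rintro rfl
  have hinj : Set.InjOn Q (Finset.range qt) := fun i hi j hj hij =>
    h.Q_inj i (by simpa using hi) j (by simpa using hj) hij
  have hmap : Set.MapsTo Q (Finset.range qt) (Finset.range qt) := fun i hi => by
    simp only [Finset.coe_range, Set.mem_Iio] at hi ⊢; exact h.Q_lt i hi
  obtain ⟨i, hi, e⟩ := Finset.surjOn_of_injOn_of_card_le _ hmap hinj le_rfl
    (show f ∈ (Finset.range qt : Set ℕ) by simpa using hf)
  exact h.Q_dead i (by simpa using hi) (e ▸ hd)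

/-- The point is `sound`. Were `f` in a feasible set `A`, then every node counted at `f` by
feasibility would still be in `U`: by `gone`, a removed one would have a dead edge in its triangle,
which lies in `A`. Hence `sup f ≥ K`, a contradiction. -/
theorem PeelInv.push (h : PeelInv ed N m K U sup dead Q qt) {f : ℕ} (hf : f < m)
    (hd : dead f = 0) (hs : sup f < K) :
    PeelInv ed N m K U sup (Function.update dead f 1) (Function.update Q qt f) (qt + 1) := by
  have hmono : ∀ e, dead e ≠ 0 → Function.update dead f 1 e ≠ 0 := fun e he => by
    rw [Function.update_apply]; split_ifs <;> simp [he]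
  have hQ : ∀ i < qt, Q i ≠ f := fun i hi e => h.Q_dead i hi (e ▸ hd)
  constructor
  · intro i hi
    rw [Function.update_apply]; split_ifs
    · exact hf
    · exact h.Q_lt i (by omega)
  · intro i hi j hj hij
    simp only [Function.update_apply] at hij
    split_ifs at hij with h1 h2 h2
    · omega
    · exact absurd hij.symm (hQ j (by omega))
    · exact absurd hij (hQ i (by omega))
    · exact h.Q_inj i (by omega) j (by omega) hij
  · intro i hi
    by_cases h1 : i = qt
    · simp [h1]
    · rw [Function.update_of_ne h1]
      exact hmono _ (h.Q_dead i (by omega))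
  · intro e he hde
    by_cases h1 : e = f
    · exact ⟨qt, by omega, by simp [h1]⟩
    · rw [Function.update_of_ne h1] at hde
      obtain ⟨i, hi, hie⟩ := h.dead_Q e he hde
      exact ⟨i, by omega, by rw [Function.update_of_ne (by omega), hie]⟩
  · exact h.sup_eq
  · exact h.U_lt
  · intro y hy hyU
    obtain ⟨i, hi, hdi⟩ := h.gone y hy hyU
    exact ⟨i, hi, hmono _ hdi⟩
  · intro A hA hF e he
    have hA0 := h.sound A hA hF
    by_cases h1 : e = f
    · exfalso
      subst h1
      have h2 := hF e he
      rw [h.sup_eq e hf] at hs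
      refine absurd (h2.trans (Finset.card_le_card ?_)) (not_le.2 hs)
      intro y hy
      simp only [Finset.mem_filter, Finset.mem_range] at hy ⊢
      refine ⟨?_, hy.2.1⟩
      by_contra hyU
      obtain ⟨i, hi, hdi⟩ := h.gone y hy.1 hyU
      exact hdi (hA0 _ (hy.2.2 i hi))
    · rw [Function.update_of_ne h1]
      exact hA0 e he

theorem PeelInv.erase (h : PeelInv ed N m K U sup dead Q qt) {y : ℕ} (hy : y ∈ U)
    (hd : ∃ i < 3, dead (ed (3 * (y / 3) + i)) ≠ 0) :
    PeelInv ed N m K (U.erase y) (Function.update sup (ed y) (sup (ed y) - 1)) dead Q qt := by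
  refine ⟨h.Q_lt, h.Q_inj, h.Q_dead, h.dead_Q, ?_, fun z hz => h.U_lt z (Finset.mem_of_mem_erase hz),
    ?_, h.sound⟩
  · intro e he
    rw [Finset.filter_erase]
    by_cases h1 : e = ed y
    · subst h1
      rw [Function.update_self, Finset.card_erase_of_mem (by simp [hy]), h.sup_eq _ he]
    · rw [Function.update_of_ne h1, Finset.erase_eq_of_notMem, h.sup_eq e he]
      simp [Ne.symm h1]
  · intro z hz hzU
    by_cases h1 : z = y
    · rw [h1]; exact hd
    · exact h.gone z hz fun hz' => hzU (Finset.mem_erase.2 ⟨h1, hz'⟩)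

/-- The sum of the numbers of nodes over distinct vertices. -/
theorem sum_cEq_le (hinj : ∀ i < qt, ∀ j < qt, Q i = Q j → i = j) {qh : ℕ}
    (hq : qh ≤ qt) : ∑ i ∈ Finset.range qh, cEq ed N (Q i) ≤ N := by
  have h1 : ∀ i, cEq ed N (Q i) = ((Finset.range N).filter fun y => ed y = Q i).card := fun i =>
    Nat.count_eq_card_filter_range _ _
  simp only [h1]
  rw [← Finset.card_biUnion]
  · refine (Finset.card_le_card ?_).trans (Finset.card_range N).le
    intro y hy
    simp only [Finset.mem_biUnion, Finset.mem_filter] at hy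
    obtain ⟨_, _, h, _⟩ := hy
    exact h
  · intro i hi j hj hij
    simp only [Finset.coe_range, Set.mem_Iio] at hi hj
    rw [Function.onFun, Finset.disjoint_left]
    intro y hy hy'
    simp only [Finset.mem_filter] at hy hy'
    exact hij (hinj i (by omega) j (by omega) (hy.2.symm.trans hy'.2))

end

variable {w I : ℕ}

/-- The edge in register `22` is killed if its support is at most the level, register `15`. -/
def tryPush : Prog :=
  ld 23 8 (.reg 22) ;; .ite ((Expr.reg 23).lt (.reg 15 + 1))
    (ld 23 12 (.reg 22) ;; .ite ((Expr.reg 23).eq 0)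
      (st 12 (.reg 22) 1 ;; st 14 (.reg 17) (.reg 22) ;; .set 17 (.reg 17 + 1)) .skip) .skip

/-- The invariant of peeling, for a machine state. -/
abbrev StInv (ed : ℕ → ℕ) (N m : ℕ) (U : Finset ℕ) (s : St) : Prop :=
  PeelInv ed N m (s.r 15 + 1) U (s.A 8) (s.A 12) (s.A 14) (s.r 17)

/-- What the queue operations preserve. -/
structure QueueMono (s s' : St) : Prop where
  dead : ∀ e, s.A 12 e ≠ 0 → s'.A 12 e ≠ 0
  le : s.r 17 ≤ s'.r 17
  queue : ∀ i < s.r 17, s'.A 14 i = s.A 14 i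

theorem QueueMono.trans {s s' s'' : St} (h : QueueMono s s') (h' : QueueMono s' s'') :
    QueueMono s s'' :=
  ⟨fun e he => h'.dead e (h.dead e he), h.le.trans h'.le,
    fun i hi => (h'.queue i (hi.trans_le h.le)).trans (h.queue i hi)⟩

theorem wp_tryPush [Mach w I] (ω : Tape w) (s : St) {ed : ℕ → ℕ} {N m : ℕ} {U : Finset ℕ}
    (hm : m ≤ I) (hk : s.r 15 ≤ I) (hf : s.r 22 < m) (h : StInv ed N m U s) :
    WP ω I tryPush s fun s' => s.Frame s' [17, 23] [12, 14] ∧ StInv ed N m U s' ∧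
      QueueMono s s' ∧ (s'.A 12 (s.r 22) = 0 → s.r 15 < s.A 8 (s.r 22)) ∧
      s'.d = s.d ∧ s'.t ≤ s.t + 12 := by
  have hE := Mach.index_lt (w := w) (I := I)
  have hI : s.r 22 < I := by omega
  refine vc.sound ?_
  simp [tryPush, hI]
  refine ⟨by omega, ?_, ?_⟩
  · intro h1
    constructor
    · intro h2
      have hq := h.lt_of hf h2
      refine ⟨by omega, by omega, h.push hf h2 (by omega), ⟨?_, by simp, ?_⟩, fun h3 => ?_⟩
      · intro e he
        simp [Function.update_apply]
        split_ifs <;> simp [he]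
      · intro i hi
        have : i ≠ s.r 17 := by omega
        simp [this]
      · exact absurd h3 (by rw [Function.update_apply]; simp)
    · intro h2
      exact ⟨h, ⟨fun e he => by simpa using he, by simp, by simp⟩, by omega⟩
  · intro h1
    exact ⟨h, ⟨fun e he => by simpa using he, by simp, by simp⟩, by omega⟩

/-- The scan for edges of small support. -/
def scan : Prog :=
  .set 22 0 ;; .loop ((Expr.reg 22).lt (.reg 1)) (tryPush ;; .set 22 (.reg 22 + 1))

theorem wp_scan [Mach w I] (ω : Tape w) (s : St) {ed : ℕ → ℕ} {N : ℕ} {U : Finset ℕ}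
    (hm : s.r 1 ≤ I) (hk : s.r 15 ≤ I) (h : StInv ed N (s.r 1) U s) :
    WP ω I scan s fun s' => s.Frame s' [17, 22, 23] [12, 14] ∧ StInv ed N (s.r 1) U s' ∧
      QueueMono s s' ∧ (∀ f < s.r 1, s'.A 12 f = 0 → s.r 15 < s.A 8 f) ∧
      s'.d = s.d ∧ s'.t ≤ s.t + (15 * s.r 1 + 5) := by
  have hE := Mach.index_lt (w := w) (I := I)
  refine vc.sound ?_
  simp only [scan, vc_seq, vc_set, vc_loop]
  refine ⟨by simp, WP.loop (fun s' => s.Frame s' [17, 22, 23] [12, 14] ∧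
    StInv ed N (s.r 1) U s' ∧ QueueMono s s' ∧ s'.r 22 ≤ s.r 1 ∧
    (∀ f < s'.r 22, s'.A 12 f = 0 → s.r 15 < s.A 8 f) ∧
      s'.d = s.d ∧ s'.t ≤ s.t + (15 * s'.r 22 + 2)) (fun s' => s.r 1 - s'.r 22) ?_ ?_⟩
  · simp only [St.tick_t, St.tick_d, St.setR_t, St.setR_d]
    simp
    exact ⟨h, ⟨fun e he => he, by simp, fun i hi => rfl⟩⟩
  rintro s1 ⟨hF, hI, hM, hle, hz, hd, ht⟩
  have e1 := hF.1 1 (by simp)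
  have e15 := hF.1 15 (by simp)
  have e8 := hF.2 8 (by simp)
  refine ⟨by simp, fun hlt => ?_, fun hge => ?_⟩
  · simp [e1] at hlt
    refine WP.seq ((wp_tryPush ω s1.tick.tick hm (by simpa [e15] using hk) hlt hI).mono ?_)
    rintro s2 ⟨F2, I2, M2, c2, d2, t2⟩
    simp [e8, e15] at c2 d2 t2
    have e22 : s2.r 22 = s1.r 22 := F2.1 22 (by simp)
    refine vc.sound ?_
    simp [e22]
    refine ⟨by omega, ⟨(St.Frame.tick_iff.2 (St.Frame.tick_iff.2 hF)).trans F2 (by simp) (by simp), I2, ?_, by omega, ?_, by omega,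
      by omega⟩, by omega⟩
    · exact QueueMono.trans (s' := s2) (hM.trans ⟨M2.dead, M2.le, M2.queue⟩) ⟨fun _ h => h, le_rfl, fun _ _ => rfl⟩
    · intro f hf hf0
      by_cases h1 : f = s1.r 22
      · subst h1; exact c2 hf0
      · refine hz f (by omega) ?_
        by_contra h2
        exact M2.dead f h2 hf0
  · simp [e1] at hge
    have : s1.r 22 = s.r 1 := by omega
    rw [this] at hz ht
    exact ⟨hF, hI, ⟨hM.dead, hM.le, hM.queue⟩, hz, hd, by simp; omega⟩

/-- Node `i` of the triangle in register `21` is removed. -/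
def hit (i : ℕ) : Prog :=
  ld 22 7 (3 * .reg 21 + .const i) ;; ld 23 8 (.reg 22) ;; st 8 (.reg 22) (.reg 23 - 1) ;; tryPush

/-- Removing one node lowers the support of a single edge, and that edge is tested again at once. So
every edge not yet killed keeps support above the level. -/
theorem wp_hit [Mach w I] (ω : Tape w) (s : St) {N m i : ℕ} {U : Finset ℕ} (hi : i < 3)
    (hm : m ≤ I) (hN : N ≤ I) (hk : s.r 15 ≤ I) (hed : ∀ y < N, s.A 7 y < m)
    (hy : 3 * s.r 21 + i ∈ U) (hd : ∃ i < 3, s.A 12 (s.A 7 (3 * s.r 21 + i)) ≠ 0)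
    (h : StInv (s.A 7) N m U s) (hc : ∀ f < m, s.A 12 f = 0 → s.r 15 < s.A 8 f) :
    WP ω I (hit i) s fun s' => s.Frame s' [17, 22, 23] [8, 12, 14] ∧
      StInv (s.A 7) N m (U.erase (3 * s.r 21 + i)) s' ∧
      QueueMono s s' ∧ (∀ f < m, s'.A 12 f = 0 → s.r 15 < s'.A 8 f) ∧
      s'.d = s.d ∧ s'.t ≤ s.t + 18 := by
  have hE := Mach.index_lt (w := w) (I := I)
  have hyN := h.U_lt _ hy
  have hf := hed _ hyN
  have hdiv : (3 * s.r 21 + i) / 3 = s.r 21 := by omega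
  have h' := h.erase hy (by rw [hdiv]; exact hd)
  refine WP.seq (vc.sound ?_)
  have g1 : 3 * s.r 21 + i < wordBound w := by omega
  have g2 : 3 * s.r 21 < wordBound w := by omega
  have g3 : 3 * s.r 21 + i < I := by omega
  have g4 : s.A 7 (3 * s.r 21 + i) < I := by omega
  have g5 : i ≤ 16 := by omega
  simp [g1, g2, g3, g5]
  refine WP.seq (vc.sound ?_)
  simp [g4]
  refine WP.seq (vc.sound ?_)
  simp [g4]
  refine (wp_tryPush (ed := s.A 7) (N := N) (U := U.erase (3 * s.r 21 + i)) ω _ hm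
    (by simpa using hk) (by simpa using hf) (by simpa [StInv] using h')).mono ?_
  rintro s2 ⟨F2, I2, M2, c2, d2, t2⟩
  simp at c2 d2 t2
  refine ⟨?_, I2, ⟨fun e he => M2.dead e (by simpa using he), by simpa using M2.le,
    fun i hi => by simpa using M2.queue i (by simpa using hi)⟩, ?_, by omega, by omega⟩
  · exact St.Frame.trans (R := [17, 22, 23]) (J := [8, 12, 14]) (by simp) F2 (by simp) (by simp)
  · intro f hf' hf0
    have e8 := congrFun (F2.2 8 (by simp)) f
    simp at e8
    rw [e8]
    by_cases h1 : f = s.A 7 (3 * s.r 21 + i)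
    · subst h1
      simpa using c2 hf0
    · rw [Function.update_of_ne h1]
      refine hc f hf' ?_
      by_contra h2
      exact M2.dead f (by simpa using h2) hf0

/-- All nodes of the triangle in register `21` are removed. -/
def kill : Prog := st 13 (.reg 21) 1 ;; hit 0 ;; hit 1 ;; hit 2

/-- The flag in array `13` is set before the three nodes leave `U` one by one. In between, `U` is
not described by the flags and has to be carried explicitly; the two agree again at the end. -/
theorem wp_kill [Mach w I] (ω : Tape w) (s : St) {N m : ℕ} {U : Finset ℕ}
    (hm : m ≤ I) (hN : N ≤ I) (hk : s.r 15 ≤ I) (hed : ∀ y < N, s.A 7 y < m)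
    (hU : ∀ y, y ∈ U ↔ y < N ∧ s.A 13 (y / 3) = 0) (h3 : 3 * s.r 21 + 2 < N)
    (h0 : s.A 13 (s.r 21) = 0) (hd : ∃ i < 3, s.A 12 (s.A 7 (3 * s.r 21 + i)) ≠ 0)
    (h : StInv (s.A 7) N m U s) (hc : ∀ f < m, s.A 12 f = 0 → s.r 15 < s.A 8 f) :
    WP ω I kill s fun s' => s.Frame s' [17, 22, 23] [8, 12, 13, 14] ∧
      (∃ U', StInv (s.A 7) N m U' s' ∧ ∀ y, y ∈ U' ↔ y < N ∧ s'.A 13 (y / 3) = 0) ∧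
      s'.A 13 = Function.update (s.A 13) (s.r 21) 1 ∧
      QueueMono s s' ∧ (∀ f < m, s'.A 12 f = 0 → s.r 15 < s'.A 8 f) ∧
      s'.d = s.d ∧ s'.t ≤ s.t + 58 := by
  have hE := Mach.index_lt (w := w) (I := I)
  have mem : ∀ i < 3, 3 * s.r 21 + i ∈ U := fun i hi =>
    (hU _).2 ⟨by omega, by rw [show (3 * s.r 21 + i) / 3 = s.r 21 by omega]; exact h0⟩
  refine WP.seq (vc.sound ?_)
  have g : s.r 21 < I := by omega
  simp [g]
  refine WP.seq ((wp_hit (N := N) (m := m) (U := U) (i := 0) ω _ (by simp) hm hN (by simpa using hk)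
    (by simpa using hed) (by simpa using mem 0 (by simp)) (by simpa using hd)
    (by simpa [StInv] using h) (by simpa using hc)).mono ?_)
  rintro s1 ⟨F1, I1, M1, c1, d1, t1⟩
  simp at I1 c1 d1 t1
  have q15 : s1.r 15 = s.r 15 := F1.1 15 (by simp)
  have q21 : s1.r 21 = s.r 21 := F1.1 21 (by simp)
  have q7 : s1.A 7 = s.A 7 := F1.2 7 (by simp)
  have q13 : s1.A 13 = Function.update (s.A 13) (s.r 21) 1 := by rw [F1.2 13 (by simp)]; simp
  have D1 : ∀ e, s.A 12 e ≠ 0 → s1.A 12 e ≠ 0 := fun e he => M1.dead e (by simpa using he)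
  obtain ⟨i, hi, hdi⟩ := hd
  refine WP.seq ((wp_hit (N := N) (m := m) (U := U.erase (3 * s.r 21)) (i := 1) ω s1.tick
    (by simp) hm hN (by simpa [q15] using hk) (by simpa [q7] using hed)
    (by simpa [q21] using mem 1 (by simp)) (by simpa [q7, q21] using ⟨i, hi, D1 _ hdi⟩)
    (by simpa [StInv, q7, q15] using I1) (by simpa [q15] using c1)).mono ?_)
  rintro s2 ⟨F2, I2, M2, c2, d2, t2⟩
  simp [q7, q15, q21] at I2 c2 d2 t2
  have p15 : s2.r 15 = s.r 15 := (F2.1 15 (by simp)).trans q15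
  have p21 : s2.r 21 = s.r 21 := (F2.1 21 (by simp)).trans q21
  have p7 : s2.A 7 = s.A 7 := (F2.2 7 (by simp)).trans q7
  have p13 := (F2.2 13 (by simp)).trans q13
  refine (wp_hit (N := N) (m := m) (U := (U.erase (3 * s.r 21)).erase (3 * s.r 21 + 1)) (i := 2)
    ω s2 (by simp) hm hN (by simpa [p15] using hk) (by simpa [p7] using hed)
    (by simpa [p21] using mem 2 (by simp))
    (by simpa [p7, p21] using ⟨i, hi, M2.dead _ (D1 _ hdi)⟩)
    (by simpa [StInv, p7, p15] using I2) (by simpa [p15] using c2)).mono ?_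
  rintro s3 ⟨F3, I3, M3, c3, d3, t3⟩
  simp only [p7, p15, p21] at I3 c3 d3 t3
  have r13 := (F3.2 13 (by simp)).trans p13
  refine ⟨?_, ⟨_, I3, ?_⟩, r13, ?_, c3, by omega, by omega⟩
  · have F0 : s.Frame s1 [17, 22, 23] [8, 12, 13, 14] :=
      St.Frame.trans (by simp) F1 (by simp) (by simp)
    have F02 := F0.trans (St.Frame.tick_iff.1 F2) (by simp) (by simp)
    exact F02.trans F3 (by simp) (by simp)
  · intro y
    rw [r13]
    simp only [Finset.mem_erase, hU, Function.update_apply]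
    constructor
    · rintro ⟨h1, h2, h3', h4, h5⟩
      refine ⟨h4, ?_⟩
      rw [if_neg (by omega)]
      exact h5
    · rintro ⟨h1, h2⟩
      split_ifs at h2 with h4
      exact ⟨by omega, by omega, by omega, h1, h2⟩
  · refine QueueMono.trans (s' := s1) ⟨D1, by simpa using M1.le, fun i hi => ?_⟩
      (QueueMono.trans (s' := s2) ⟨M2.dead, M2.le, M2.queue⟩ M3)
    simpa using M1.queue i (by simpa using hi)

/-- The triangles of the edge in register `18` are removed. -/
def expand : Prog :=
  ld 19 9 (.reg 18) ;; ld 20 10 (.reg 18) ;; .loop ((Expr.reg 19).lt (.reg 20))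
    (ld 21 11 (.reg 19) ;; .set 21 (.reg 21 / 3) ;; .set 19 (.reg 19 + 1) ;; ld 23 13 (.reg 21) ;;
      .ite ((Expr.reg 23).eq 0) kill .skip)

/-- The state of the triangle flags during peeling. -/
def TriInv (N m : ℕ) (s : St) : Prop :=
  (∃ U, StInv (s.A 7) N m U s ∧ ∀ y, y ∈ U ↔ y < N ∧ s.A 13 (y / 3) = 0) ∧
    ∀ f < m, s.A 12 f = 0 → s.r 15 < s.A 8 f

/-- The nodes at the edge occupy one interval of the sorted order, so the loop visits precisely the
triangles at that edge. The cost is charged to the degree `cEq` of the edge; triangles already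
removed are skipped. -/
theorem wp_expand [Mach w I] (ω : Tape w) (s : St) {N m : ℕ} (hN3 : 3 ∣ N)
    (hm : m ≤ I) (hN : N ≤ I) (hk : s.r 15 ≤ I) (hed : ∀ y < N, s.A 7 y < m)
    (hS2 : ∀ v < m, s.A 9 v = cLt (s.A 7) N v)
    (hS3 : ∀ v < m, s.A 10 v = cLt (s.A 7) N v + cEq (s.A 7) N v)
    (hS4 : ∀ q < N, s.A 11 (rho (s.A 7) N q) = q)
    (he : s.r 18 < m) (hde : s.A 12 (s.r 18) ≠ 0) (h : TriInv N m s) :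
    WP ω I expand s fun s' => s.Frame s' [17, 19, 20, 21, 22, 23] [8, 12, 13, 14] ∧
      TriInv N m s' ∧ QueueMono s s' ∧ (∀ x, s.A 13 x ≠ 0 → s'.A 13 x ≠ 0) ∧
      (∀ y < N, s.A 7 y = s.r 18 → s'.A 13 (y / 3) ≠ 0) ∧
      s'.d = s.d ∧ s'.t ≤ s.t + (80 * cEq (s.A 7) N (s.r 18) + 5) := by
  have hE := Mach.index_lt (w := w) (I := I)
  have hle := cLt_add_cEq_le (s.A 7) N (s.r 18)
  have hvI : s.r 18 < I := by omega
  refine WP.seq (vc.sound ?_)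
  simp [hvI]
  refine WP.seq (vc.sound ?_)
  simp [hvI, hS2 _ he, hS3 _ he]
  set v := s.r 18 with hv
  set a := cLt (s.A 7) N v with ha
  set b := cEq (s.A 7) N v with hb
  refine WP.loop (fun s' => s.Frame s' [17, 19, 20, 21, 22, 23] [8, 12, 13, 14] ∧ s'.r 20 = a + b ∧
    a ≤ s'.r 19 ∧ s'.r 19 ≤ a + b ∧ TriInv N m s' ∧ QueueMono s s' ∧
    (∀ x, s.A 13 x ≠ 0 → s'.A 13 x ≠ 0) ∧
    (∀ j, a ≤ j → j < s'.r 19 → s'.A 13 (s.A 11 j / 3) ≠ 0) ∧ s'.d = s.d ∧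
    s'.t + 80 * a ≤ s.t + (80 * s'.r 19 + 4)) (fun s' => a + b - s'.r 19) ?_ ?_
  · simp
    refine ⟨by simpa [TriInv, StInv] using h, ⟨fun e he => by simpa using he, by simp, by simp⟩,
      fun j h1 h2 => by omega, by omega⟩
  rintro s1 ⟨F1, e20, l1, l2, T1, M1, m1, z1, d1, t1⟩
  have q15 : s1.r 15 = s.r 15 := F1.1 15 (by simp)
  have q18 : s1.r 18 = v := F1.1 18 (by simp)
  have q7 : s1.A 7 = s.A 7 := F1.2 7 (by simp)
  have q11 : s1.A 11 = s.A 11 := F1.2 11 (by simp)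
  refine ⟨by simp, fun hlt => ?_, fun hge => ?_⟩
  · simp [e20] at hlt
    obtain ⟨hjN, hkey⟩ := perm_key (c := s.A 7) hS4 l1 hlt
    obtain ⟨hyN, -, -, -⟩ := perm_spec (c := s.A 7) hS4 hjN
    set y := s.A 11 (s1.r 19) with hy
    obtain ⟨N', rfl⟩ := hN3
    have hx3 : 3 * (y / 3) + 2 < 3 * N' := by omega
    have g1 : s1.r 19 < I := by omega
    have g2 : y / 3 < I := by omega
    refine WP.seq (vc.sound ?_)
    simp [q11, ← hy, g1]
    refine WP.seq (vc.sound ?_)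
    simp
    refine WP.seq (vc.sound ?_)
    simp
    refine ⟨by omega, WP.seq (vc.sound ?_)⟩
    simp [g2]
    refine WP.ite (by simp) (fun h0 => ?_) fun h0 => vc.sound ?_
    · simp at h0
      obtain ⟨⟨U, hI1, hU1⟩, hc1⟩ := T1
      rw [q7] at hI1
      refine (wp_kill (N := 3 * N') (m := m) (U := U) ω _ hm hN (by simpa [q15] using hk)
        (by simpa [q7] using hed) (by simpa using hU1) (by simpa using hx3) (by simpa using h0) ?_
        (by simpa [StInv, q7] using hI1) (by simpa using hc1)).mono ?_
      · refine ⟨y % 3, Nat.mod_lt _ (by simp), ?_⟩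
        simp [q7, show 3 * (y / 3) + y % 3 = y by omega, hkey]
        exact M1.dead _ hde
      · rintro s2 ⟨F2, ⟨U', I2, hU2⟩, k2, M2, c2, d2, t2⟩
        simp [q7] at I2 d2 t2 c2 k2
        have p19 : s2.r 19 = s1.r 19 + 1 := by rw [F2.1 19 (by simp)]; simp
        have p20 : s2.r 20 = a + b := by rw [F2.1 20 (by simp)]; simp [e20]
        have p15 : s2.r 15 = s1.r 15 := by rw [F2.1 15 (by simp)]; simp
        have p7 : s2.A 7 = s.A 7 := by rw [F2.2 7 (by simp)]; simp [q7]
        refine ⟨⟨?_, p20, by omega, by omega, ⟨⟨U', by rw [p7]; exact I2, hU2⟩, by rw [p15]; exact c2⟩,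
          ?_, ?_, ?_, by omega, by omega⟩, by omega⟩
        · exact St.Frame.trans (by simpa using F1) F2 (by simp) (by simp)
        · exact M1.trans ⟨fun e he => M2.dead e (by simpa using he), by simpa using M2.le,
            fun i hi => by simpa using M2.queue i (by simpa using hi)⟩
        · intro x hx
          rw [k2, Function.update_apply]
          split_ifs
          · simp
          · exact m1 x hx
        · intro j hj1 hj2
          rw [k2, Function.update_apply]
          split_ifs with h5
          · simp
          · refine z1 j hj1 ?_
            rcases Nat.lt_or_ge j (s1.r 19) with h6 | h6
            · exact h6
            · exfalso
              have : j = s1.r 19 := by omega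
              subst this
              exact h5 rfl
    · simp at h0
      simp [F1, e20, d1]
      refine ⟨⟨by omega, by omega, by simpa [TriInv, StInv] using T1, ⟨by simpa using M1.dead,
        by simpa using M1.le, by simpa using M1.queue⟩, by simpa using m1, ?_, by omega⟩, by omega⟩
      intro j hj1 hj2
      rcases Nat.lt_or_ge j (s1.r 19) with h6 | h6
      · exact z1 j hj1 h6
      · have : j = s1.r 19 := by omega
        subst this
        exact h0
  · simp [e20] at hge
    refine ⟨F1, T1, ⟨M1.dead, M1.le, M1.queue⟩, m1, ?_, d1, by simp; omega⟩
    intro y hyN hyv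
    have := z1 (rho (s.A 7) N y) (by rw [ha, ← hyv]; exact le_rho)
      (by have := rho_lt_end (c := s.A 7) hyN; rw [hyv] at this; omega)
    rwa [hS4 y hyN] at this

/-- The queue is processed. -/
def process : Prog :=
  .loop ((Expr.reg 16).lt (.reg 17)) (ld 18 14 (.reg 16) ;; .set 16 (.reg 16 + 1) ;; expand)

/-- The amortized cost of the processed part of the queue. -/
def queueCost (ed : ℕ → ℕ) (N : ℕ) (s : St) : ℕ :=
  ∑ i ∈ Finset.range (s.r 16), (20 + 80 * cEq ed N (s.A 14 i))

/-- The triangles of the processed edges are removed. -/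
def Processed (N : ℕ) (s : St) : Prop :=
  ∀ i < s.r 16, ∀ y < N, s.A 7 y = s.A 14 i → s.A 13 (y / 3) ≠ 0

/-- Time is measured by the growth of the potential `queueCost`. The queue entries are distinct
edges, so the potential stays bounded over all levels together. -/
theorem wp_process [Mach w I] (ω : Tape w) (s : St) {N m : ℕ} (hN3 : 3 ∣ N)
    (hm : m ≤ I) (hN : N ≤ I) (hk : s.r 15 ≤ I) (hed : ∀ y < N, s.A 7 y < m)
    (hS2 : ∀ v < m, s.A 9 v = cLt (s.A 7) N v)
    (hS3 : ∀ v < m, s.A 10 v = cLt (s.A 7) N v + cEq (s.A 7) N v)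
    (hS4 : ∀ q < N, s.A 11 (rho (s.A 7) N q) = q)
    (hq : s.r 16 ≤ s.r 17) (hP : Processed N s) (h : TriInv N m s) :
    WP ω I process s fun s' =>
      s.Frame s' [16, 17, 18, 19, 20, 21, 22, 23] [8, 12, 13, 14] ∧
      TriInv N m s' ∧ s'.r 16 = s'.r 17 ∧ Processed N s' ∧ s'.d = s.d ∧
      s'.t + queueCost (s.A 7) N s ≤ s.t + queueCost (s.A 7) N s' + 1 := by
  have hE := Mach.index_lt (w := w) (I := I)
  refine WP.loop (fun s' => s.Frame s' [16, 17, 18, 19, 20, 21, 22, 23] [8, 12, 13, 14] ∧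
      TriInv N m s' ∧ s'.r 16 ≤ s'.r 17 ∧ Processed N s' ∧ s'.d = s.d ∧
      s'.t + queueCost (s.A 7) N s ≤ s.t + queueCost (s.A 7) N s') (fun s' => m - s'.r 16)
      ⟨by simp, h, hq, hP, rfl, le_rfl⟩ ?_
  rintro s1 ⟨F1, T1, l1, P1, d1, t1⟩
  have q15 : s1.r 15 = s.r 15 := F1.1 15 (by simp)
  have q7 : s1.A 7 = s.A 7 := F1.2 7 (by simp)
  have q9 : s1.A 9 = s.A 9 := F1.2 9 (by simp)
  have q10 : s1.A 10 = s.A 10 := F1.2 10 (by simp)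
  have q11 : s1.A 11 = s.A 11 := F1.2 11 (by simp)
  refine ⟨by simp, fun hlt => ?_, fun hge => ?_⟩
  · simp only [Expr.val_lt_ne_zero, Expr.val_reg] at hlt
    obtain ⟨⟨U, hI1, hU1⟩, hc1⟩ := T1
    have hqt := hI1.le_of
    have hQm := hI1.Q_lt _ hlt
    have hQd := hI1.Q_dead _ hlt
    have g : s1.r 16 < I := by omega
    refine WP.seq (vc.sound ?_)
    simp [g]
    refine WP.seq (vc.sound ?_)
    simp
    refine ⟨by omega, ?_⟩
    refine (wp_expand (N := N) (m := m) ω _ hN3 hm hN (by simpa [q15] using hk)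
      (by simpa [q7] using hed) (by simpa [q9, q7] using hS2) (by simpa [q10, q7] using hS3)
      (by simpa [q11, q7] using hS4) (by simpa using hQm) (by simpa using hQd)
      (by exact ⟨⟨U, hI1, hU1⟩, hc1⟩)).mono ?_
    rintro s2 ⟨F2, T2, M2, m2, z2, d2, t2⟩
    simp [q7] at d2 t2 z2 m2
    have p16 : s2.r 16 = s1.r 16 + 1 := by rw [F2.1 16 (by simp)]; simp
    have p7 : s2.A 7 = s.A 7 := by rw [F2.2 7 (by simp)]; simp [q7]
    have hle := M2.le
    simp at hle
    have hqu : ∀ i < s1.r 17, s2.A 14 i = s1.A 14 i := fun i hi => by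
      simpa using M2.queue i (by simpa using hi)
    refine ⟨⟨?_, T2, by omega, ?_, by omega, ?_⟩, by omega⟩
    · exact St.Frame.trans (by simpa using F1) F2 (by simp) (by simp)
    · intro i hi y hy hyi
      rw [p7] at hyi
      rcases Nat.lt_or_ge i (s1.r 16) with h6 | h6
      · exact m2 _ (P1 i h6 y hy (by rw [q7, hyi, hqu i (by omega)]))
      · have : i = s1.r 16 := by omega
        subst this
        exact z2 y hy (by rw [hyi, hqu _ hlt])
    · have : queueCost (s.A 7) N s2 = queueCost (s.A 7) N s1 +
          (20 + 80 * cEq (s.A 7) N (s1.A 14 (s1.r 16))) := by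
        rw [queueCost, p16, Finset.sum_range_succ, hqu _ hlt]
        congr 1
        refine Finset.sum_congr rfl fun i hi => ?_
        rw [hqu i (by simp at hi; omega)]
      rw [this]
      omega
  · simp only [Expr.val_lt_eq_zero, Expr.val_reg] at hge
    exact ⟨F1, T1, by simp; omega, P1, d1, by
      have : queueCost (s.A 7) N s1.tick = queueCost (s.A 7) N s1 := rfl
      rw [this, St.tick_t]
      omega⟩

/-- One level of peeling after the other, until no edge is left. -/
def levels : Prog :=
  .loop ((Expr.reg 17).lt (.reg 1)) (scan ;; process ;; .set 15 (.reg 15 + 1))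

/-- An alive edge has more than `r 15` nodes left in `U`. No triangle of such a node has a dead
edge: dead edges are in the queue, the queue has been processed completely, and the triangles of
processed edges are flagged. -/
theorem feasible_alive {s : St} {N m : ℕ} (hed : ∀ y < N, s.A 7 y < m) (hN3 : 3 ∣ N)
    (hT : TriInv N m s) (hP : Processed N s) (hq : s.r 16 = s.r 17) :
    Feasible (s.A 7) N (s.r 15 + 1) ((Finset.range m).filter fun e => s.A 12 e = 0) := by
  obtain ⟨⟨U, hI, hU⟩, hc⟩ := hT
  intro e he
  simp only [Finset.mem_filter, Finset.mem_range] at he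
  have h1 := hc e he.1 he.2
  rw [hI.sup_eq e he.1] at h1
  refine le_trans h1 (Finset.card_le_card ?_)
  intro y hy
  simp only [Finset.mem_filter, Finset.mem_range] at hy ⊢
  obtain ⟨hyN, hyt⟩ := (hU y).1 hy.1
  refine ⟨hyN, hy.2, fun i hi => ?_⟩
  obtain ⟨N', rfl⟩ := hN3
  have hz : 3 * (y / 3) + i < 3 * N' := by omega
  refine ⟨hed _ hz, ?_⟩
  by_contra hd
  obtain ⟨j, hj, hje⟩ := hI.dead_Q _ (hed _ hz) hd
  refine hP j (by omega) _ hz hje.symm ?_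
  rw [show (3 * (y / 3) + i) / 3 = y / 3 by omega]
  exact hyt

/-- The degeneracy of the hypergraph is `k`. -/
def IsCore (ed : ℕ → ℕ) (N m k : ℕ) : Prop :=
  (∃ A : Finset ℕ, A.Nonempty ∧ (∀ e ∈ A, e < m) ∧ Feasible ed N k A) ∧
    ∀ A : Finset ℕ, (∀ e ∈ A, e < m) → Feasible ed N (k + 1) A → A = ∅

theorem Feasible.le {ed : ℕ → ℕ} {N k : ℕ} {A : Finset ℕ} (h : Feasible ed N k A)
    (hA : A.Nonempty) : k ≤ N := by
  obtain ⟨e, he⟩ := hA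
  refine (h e he).trans (le_trans (Finset.card_le_card (t := Finset.range N) fun y hy => ?_) (Finset.card_range N).le)
  simp only [Finset.mem_filter] at hy
  exact hy.1

/-- On entering a level the alive edges are feasible at `r 15`, and `sound` holds at `r 15`. When
all edges are dead at `r 15 = k + 1`, the alive set at the start of level `k` witnesses the lower
half of `IsCore`, and `sound` gives the upper half. -/
theorem wp_levels [Mach w I] (ω : Tape w) (s : St) {N : ℕ} (hN3 : 3 ∣ N)
    (hm : s.r 1 ≤ I) (hm1 : 1 ≤ s.r 1) (hN : N ≤ I) (hed : ∀ y < N, s.A 7 y < s.r 1)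
    (hS : Sorted s.A 7 (s.A 7) N (s.r 1))
    (hdE : ∀ e < s.r 1, s.A 12 e = 0) (hdT : ∀ x < N / 3, s.A 13 x = 0)
    (h15 : s.r 15 = 0) (h16 : s.r 16 = 0) (h17 : s.r 17 = 0) :
    WP ω I levels s fun s' =>
      s.Frame s' [15, 16, 17, 18, 19, 20, 21, 22, 23] [8, 12, 13, 14] ∧
      (∃ k, s'.r 15 = k + 1 ∧ IsCore (s.A 7) N (s.r 1) k ∧
        s'.t ≤ s.t + (40 * (s.r 1 + 1) * (k + 1) + 80 * N + 1)) ∧ s'.d = s.d := by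
  have hE := Mach.index_lt (w := w) (I := I)
  set m := s.r 1 with hm_def
  refine WP.loop (fun s' => s.Frame s' [15, 16, 17, 18, 19, 20, 21, 22, 23] [8, 12, 13, 14] ∧
      (∃ U, PeelInv (s.A 7) N m (s'.r 15) U (s'.A 8) (s'.A 12) (s'.A 14) (s'.r 17) ∧
        ∀ y, y ∈ U ↔ y < N ∧ s'.A 13 (y / 3) = 0) ∧
      s'.r 16 = s'.r 17 ∧ Processed N s' ∧
      (Feasible (s.A 7) N (s'.r 15) ((Finset.range m).filter fun e => s'.A 12 e = 0)) ∧
      (s'.r 15 = 0 → s'.r 17 = 0) ∧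
      (∀ k, s'.r 15 = k + 1 → ∃ A : Finset ℕ, A.Nonempty ∧ (∀ e ∈ A, e < m) ∧
        Feasible (s.A 7) N k A) ∧ s'.d = s.d ∧
      s'.t ≤ s.t + (20 * (m + 1) * s'.r 15 + queueCost (s.A 7) N s'))
      (fun s' => N + 1 - s'.r 15) ?_ ?_
  · refine ⟨by simp, ⟨Finset.range N, ?_, ?_⟩, by omega, ?_, ?_, by simp [h17], by simp [h15], rfl, by simp⟩
    · rw [h15, h17]
      refine ⟨by simp, by simp, by simp, fun e he h => absurd (hdE e he) h, ?_, by simp, ?_, ?_⟩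
      · intro e he
        rw [hS.num e he]
        exact Nat.count_eq_card_filter_range _ _
      · intro y hy hy'
        simp [hy] at hy'
      · intro A hA _ e he
        exact hdE e (hA e he)
    · intro y
      simp only [Finset.mem_range]
      exact ⟨fun h => ⟨h, hdT _ (by omega)⟩, fun h => h.1⟩
    · intro i hi
      omega
    · rw [h15]
      exact fun _ _ => Nat.zero_le _
  rintro s1 ⟨F1, ⟨U, I1, hU1⟩, q1, P1, A1, b1, c1, d1, t1⟩
  have q1m : s1.r 1 = m := F1.1 1 (by simp)
  have q7 : s1.A 7 = s.A 7 := F1.2 7 (by simp)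
  have q9 : s1.A 9 = s.A 9 := F1.2 9 (by simp)
  have q10 : s1.A 10 = s.A 10 := F1.2 10 (by simp)
  have q11 : s1.A 11 = s.A 11 := F1.2 11 (by simp)
  refine ⟨by simp, fun hlt => ?_, fun hge => ?_⟩
  · simp [q1m] at hlt
    have hne : ((Finset.range m).filter fun e => s1.A 12 e = 0).Nonempty := by
      obtain ⟨e, he, he0⟩ := I1.exists_alive hlt
      exact ⟨e, by simp [he, he0]⟩
    have hkN := A1.le hne
    -- Raising the threshold by one is harmless for `sound`, since a set feasible at `K + 1` is
    -- feasible at `K`.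
    have I1' : StInv (s.A 7) N m U s1 :=
      ⟨I1.Q_lt, I1.Q_inj, I1.Q_dead, I1.dead_Q, I1.sup_eq, I1.U_lt, I1.gone,
        fun A hA hF => I1.sound A hA (hF.anti (Nat.le_succ _))⟩
    refine WP.seq ((wp_scan (ed := s.A 7) (N := N) (U := U) ω s1.tick.tick (by simp [q1m, hm])
      (by simp; omega) (by simpa [StInv, q1m] using I1')).mono ?_)
    rintro s2 ⟨F2, I2, M2, c2, d2, t2⟩
    simp only [St.tick_r, St.tick_A, St.tick_d, St.tick_t, q1m] at I2 c2 d2 t2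
    have p15 : s2.r 15 = s1.r 15 := F2.1 15 (by simp)
    have p16 : s2.r 16 = s1.r 16 := F2.1 16 (by simp)
    have p7 : s2.A 7 = s.A 7 := (F2.2 7 (by simp)).trans q7
    have p8 : s2.A 8 = s1.A 8 := F2.2 8 (by simp)
    have p9 : s2.A 9 = s.A 9 := (F2.2 9 (by simp)).trans q9
    have p10 : s2.A 10 = s.A 10 := (F2.2 10 (by simp)).trans q10
    have p11 : s2.A 11 = s.A 11 := (F2.2 11 (by simp)).trans q11
    have p13 : s2.A 13 = s1.A 13 := F2.2 13 (by simp)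
    have hqu : ∀ i < s1.r 17, s2.A 14 i = s1.A 14 i := M2.queue
    have hle : s1.r 17 ≤ s2.r 17 := M2.le
    have T2 : TriInv N m s2 := by
      refine ⟨⟨U, by rw [p7]; exact I2, by rw [p13]; exact hU1⟩, ?_⟩
      rw [p15, p8]
      exact c2
    have P2 : Processed N s2 := by
      intro i hi y hy hyi
      rw [p13]
      refine P1 i (by omega) y hy ?_
      rw [q7, ← p7, hyi, hqu i (by omega)]
    refine WP.seq ((wp_process (N := N) (m := m) ω s2.tick hN3 hm hN (by simp; omega)
      (by simpa [p7] using hed) (by simpa [p9, p7] using hS.start) (by simpa [p10, p7] using hS.finish)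
      (by simpa [p11, p7] using hS.perm) (by simp; omega) P2 T2).mono ?_)
    rintro s3 ⟨F3, T3, e3, P3, d3, t3⟩
    have r15 : s3.r 15 = s1.r 15 := (F3.1 15 (by simp)).trans p15
    have r7 : s3.A 7 = s.A 7 := (F3.2 7 (by simp)).trans p7
    have hA3 := feasible_alive (by rw [r7]; exact hed) hN3 T3 P3 e3
    obtain ⟨⟨U3, I3, hU3⟩, hc3⟩ := T3
    have hcost : queueCost (s.A 7) N s2 = queueCost (s.A 7) N s1 := by
      rw [queueCost, queueCost, p16]
      refine Finset.sum_congr rfl fun i hi => ?_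
      rw [hqu i (by simp at hi; omega)]
    have hcost2 : queueCost (s.A 7) N s2.tick = queueCost (s.A 7) N s2 := rfl
    rw [r7] at I3 hA3
    simp only [St.tick_A, St.tick_d, St.tick_t, p7, hcost2, hcost] at d3 t3
    refine vc.sound ?_
    simp only [vc_set]
    refine ⟨by simp; omega, ⟨?_, ⟨U3, by simpa using I3, by simpa using hU3⟩, by simpa using e3, P3, hA3,
      by simp, ?_, by simp; omega, ?_⟩, by simp; omega⟩
    · refine St.Frame.trans (s' := s3) ?_ (by simp : s3.Frame _ [15] []) (by simp) (by simp)
      refine St.Frame.trans (s' := s2.tick) ?_ F3 (by simp) (by simp)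
      exact St.Frame.trans (s' := s1.tick.tick) F1 F2 (by simp) (by simp)
    · intro k hk
      simp at hk
      -- The witness is the set alive when the level began; it is nonempty because the loop was
      -- entered.
      refine ⟨_, hne, fun e he => ?_, hk ▸ r15.symm ▸ A1⟩
      simp at he
      exact he.1
    · have : ∀ v, queueCost (s.A 7) N (s3.setR 15 v) = queueCost (s.A 7) N s3 := fun _ => rfl
      simp only [St.setR_r, if_true, Expr.val_add, Expr.val_reg, Expr.val_ofNat, this, St.setR_t, r15,
        mul_add (20 * (m + 1))]
      omega
  · simp [q1m] at hge
    have hqm : s1.r 17 = m := le_antisymm I1.le_of hge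
    have h0 : s1.r 15 ≠ 0 := fun h => by have := b1 h; omega
    obtain ⟨k, hk⟩ := Nat.exists_eq_succ_of_ne_zero h0
    refine ⟨F1, ⟨k, hk, ⟨c1 k hk, ?_⟩, ?_⟩, d1⟩
    · intro A hA hF
      rw [Finset.eq_empty_iff_forall_notMem]
      intro e he
      have hd := I1.sound A hA (by rw [hk]; exact hF) e he
      have := I1.lt_of (hA e he) hd
      omega
    -- The scans cost `20 (m + 1)` for each of the `k + 1` levels; the queue costs `20 m + 80 N` in
    -- total, by amortization.
    · have hs := sum_cEq_le (ed := s.A 7) (N := N) I1.Q_inj (q1.le)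
      have : queueCost (s.A 7) N s1 = 20 * m + 80 * ∑ i ∈ Finset.range (s1.r 16), cEq (s.A 7) N (s1.A 14 i) := by
        rw [queueCost, Finset.sum_add_distrib, Finset.mul_sum, Finset.sum_const, Finset.card_range,
          q1, hqm, smul_eq_mul]
        ring
      rw [this, hk] at t1
      simp only [St.tick_t]
      have e1 : 40 * (m + 1) * (k + 1) = 20 * (m + 1) * (k + 1) + 20 * (m + 1) * (k + 1) := by ring
      have e2 : m ≤ (m + 1) * (k + 1) := by nlinarith
      have e3 : 20 * (m + 1) * (k + 1) = 20 * ((m + 1) * (k + 1)) := by ring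
      have e4 : 20 * (m + 1) * k.succ = 20 * ((m + 1) * (k + 1)) := e3
      omega

/-- The degeneracy of the stored triangles is computed in register `8`. -/
def peel : Prog :=
  .set 13 (3 * .reg 7) ;; .set 14 (.reg 1) ;; csort 7 ;; clear 12 ;; .set 14 (.reg 7) ;; clear 13 ;;
    .set 15 0 ;; .set 16 0 ;; .set 17 0 ;; levels ;; .set 8 (.reg 15 - 1)

theorem wp_peel [Mach w I] (ω : Tape w) (s : St) (hm : s.r 1 ≤ I) (hm1 : 1 ≤ s.r 1)
    (hN : 3 * s.r 7 ≤ I) (hed : ∀ y < 3 * s.r 7, s.A 7 y < s.r 1) :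
    WP ω I peel s fun s' =>
      s.Frame s' [8, 10, 11, 12, 13, 14, 15, 16, 17, 18, 19, 20, 21, 22, 23]
        [8, 9, 10, 11, 12, 13, 14] ∧
      IsCore (s.A 7) (3 * s.r 7) (s.r 1) (s'.r 8) ∧
        s'.t ≤ s.t + (60 * (s.r 1 + 1) * (s'.r 8 + 1) + 300 * s.r 7 + 100) ∧ s'.d = s.d := by
  have hE := Mach.index_lt (w := w) (I := I)
  refine WP.seq (vc.sound ?_)
  simp
  refine ⟨by omega, WP.seq (vc.sound ?_)⟩
  simp
  refine WP.seq ((wp_csort ω _ (o := 7) (by simp) (by simpa using hm) (by simpa using hN)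
    (by simpa using hed)).mono ?_)
  rintro s1 ⟨F1, S1, d1, t1⟩
  simp at S1 d1 t1
  have q1 : s1.r 1 = s.r 1 := by rw [F1.1 1 (by simp)]; simp
  have q7 : s1.r 7 = s.r 7 := by rw [F1.1 7 (by simp)]; simp
  have q14 : s1.r 14 = s.r 1 := by rw [F1.1 14 (by simp)]; simp
  have a7 : s1.A 7 = s.A 7 := F1.2 7 (by simp)
  have G1 : s.Frame s1 [8, 10, 11, 12, 13, 14, 15, 16, 17, 18, 19, 20, 21, 22, 23]
    [8, 9, 10, 11, 12, 13, 14] := St.Frame.trans (by simp) F1 (by simp) (by simp)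
  refine WP.seq ((wp_clear ω s1.tick (j := 12) (by simp) (by simpa [q14] using hm)).mono ?_)
  rintro s2 ⟨F2, z2, d2, t2⟩
  simp [q14] at z2 d2 t2
  have G2 := St.Frame.trans (s' := s1) G1 F2 (by simp) (by simp)
  refine WP.seq (vc.sound ?_)
  simp
  refine WP.seq ((wp_clear ω _ (j := 13) (by simp) ?_).mono ?_)
  · simp [G2.1 7]; omega
  rintro s3 ⟨F3, z3, d3, t3⟩
  simp [G2.1 7] at z3 d3 t3
  have G3 := St.Frame.trans (R := [8, 10, 11, 12, 13, 14, 15, 16, 17, 18, 19, 20, 21, 22, 23])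
    (J := [8, 9, 10, 11, 12, 13, 14]) (by simpa using G2) F3 (by simp) (by simp)
  have b8 : s3.A 8 = s1.A 8 := (F3.2 8 (by simp)).trans (F2.2 8 (by simp))
  have b9 : s3.A 9 = s1.A 9 := (F3.2 9 (by simp)).trans (F2.2 9 (by simp))
  have b10 : s3.A 10 = s1.A 10 := (F3.2 10 (by simp)).trans (F2.2 10 (by simp))
  have b11 : s3.A 11 = s1.A 11 := (F3.2 11 (by simp)).trans (F2.2 11 (by simp))
  have b12 : s3.A 12 = s2.A 12 := F3.2 12 (by simp)
  refine WP.seq (vc.sound ?_)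
  simp
  refine WP.seq (vc.sound ?_)
  simp
  refine WP.seq (vc.sound ?_)
  simp
  have e1 : s3.r 1 = s.r 1 := G3.1 1 (by simp)
  have e7 : s3.A 7 = s.A 7 := G3.2 7 (by simp)
  refine WP.seq ((wp_levels (N := 3 * s.r 7) ω _ (by simp) (by simpa [e1] using hm)
    (by simpa [e1] using hm1) hN (by simpa [e1, e7] using hed) ?_ (by simpa [e1, b12] using z2)
    (by simpa using z3) (by simp) (by simp) (by simp)).mono ?_)
  · simp only [St.tick_r, St.tick_A, St.setR_r, St.setR_A, e1, e7]
    simp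
    exact ⟨by simpa [b8] using S1.num, by simpa [b9] using S1.start, by simpa [b10] using S1.finish,
      by simpa [b11] using S1.perm⟩
  rintro s4 ⟨F4, ⟨k, hk, hcore, t4⟩, d4⟩
  simp [e1, e7] at hcore t4 d4
  refine vc.sound ?_
  simp only [vc_set]
  refine ⟨by simp, ?_, by simpa [hk] using hcore, ?_, by simp; omega⟩
  · have := St.Frame.trans (R := [8, 10, 11, 12, 13, 14, 15, 16, 17, 18, 19, 20, 21, 22, 23])
      (J := [8, 9, 10, 11, 12, 13, 14]) (by simpa using G3) F4 (by simp) (by simp)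
    simpa using this
  · simp only [St.setR_r, St.setR_t, Expr.val_sub, Expr.val_reg, Expr.val_ofNat, hk, if_true]
    have e1 : 60 * (s.r 1 + 1) * (k + 1) = 40 * (s.r 1 + 1) * (k + 1) + 20 * ((s.r 1 + 1) * (k + 1)) := by
      ring
    have e2 : s.r 1 + 1 ≤ (s.r 1 + 1) * (k + 1) := Nat.le_mul_of_pos_right _ (by simp)
    simp only [Nat.add_sub_cancel]
    omega

end Truss

namespace Truss

/-! ### Sampling triangles -/

/-- The other dart of an edge. -/
def fl (q : ℕ) : ℕ := q + 1 - 2 * (q % 2)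

theorem fl_lt {q m : ℕ} (h : q < 2 * m) : fl q < 2 * m := by unfold fl; omega

theorem fl_div (q : ℕ) : fl q / 2 = q / 2 := by unfold fl; omega

theorem fl_fl (q : ℕ) : fl (fl q) = q := by unfold fl; omega

/-- A graph given by its `2 m` darts; dart `q` starts at `c q` and belongs to edge `q / 2`. The
darts sorted by their start are `π 0, π 1, …`. -/
structure Net where
  /-- the number of vertices -/
  n : ℕ
  /-- the number of edges -/
  m : ℕ
  /-- the start of a dart -/
  c : ℕ → ℕ
  /-- the dart at a position -/
  π : ℕ → ℕ
  c_lt : ∀ q < 2 * m, c q < n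
  simple : ∀ q < 2 * m, ∀ q' < 2 * m, c q = c q' → c (fl q) = c (fl q') → q = q'
  perm : ∀ q < 2 * m, π (rho c (2 * m) q) = q

namespace Net

variable (G : Net)

/-- The degree of a vertex. -/
def deg (v : ℕ) : ℕ := cEq G.c (2 * G.m) v

/-- The first position of the darts that start at a vertex. -/
def start (v : ℕ) : ℕ := cLt G.c (2 * G.m) v

/-- The vertices are ordered by degree. -/
def key (v : ℕ) : ℕ := G.deg v * G.n + v

/-- The dart at position `h` starts at the greater end of its edge. -/
def Low (h : ℕ) : Prop := G.key (G.c (fl (G.π h))) < G.key (G.c (G.π h))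

open Classical in
/-- The number of candidates at position `h`. -/
noncomputable def len (h : ℕ) : ℕ := if G.Low h then G.deg (G.c (fl (G.π h))) else 0

/-- The number of candidates before position `h`. -/
noncomputable def pos (h : ℕ) : ℕ := ∑ i ∈ Finset.range h, G.len i

/-- The number of candidates. -/
noncomputable def W : ℕ := G.pos (2 * G.m)

/-- The position to which candidate `x` belongs. -/
noncomputable def hOf (x : ℕ) : ℕ := by
  classical exact Nat.findGreatest (fun h => G.pos h ≤ x) (2 * G.m)

/-- The third vertex of the candidate `j` at position `h`. -/
def third (h j : ℕ) : ℕ := G.c (fl (G.π (G.start (G.c (fl (G.π h))) + j)))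

/-- `q` is a dart from `v` to `x`. -/
def IsDart (v x q : ℕ) : Prop := q < 2 * G.m ∧ G.c q = v ∧ G.c (fl q) = x

/-- The candidate `j` at position `h` is a triangle, with increasing keys. -/
def Good (h j : ℕ) : Prop :=
  G.key (G.c (fl (G.π h))) < G.key (G.third h j) ∧ G.key (G.third h j) < G.key (G.c (G.π h)) ∧
    ∃ q, G.IsDart (G.c (G.π h)) (G.third h j) q

open Classical in
/-- The edges of the triangle at candidate `j` at position `h`. -/
noncomputable def triAt (h j : ℕ) : Option (ℕ × ℕ × ℕ) :=
  if H : G.Good h j then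
    some (G.π h / 2, G.π (G.start (G.c (fl (G.π h))) + j) / 2, H.2.2.choose / 2) else none

open Classical in
/-- The triangle at candidate `x`. -/
noncomputable def tri (x : ℕ) : Option (ℕ × ℕ × ℕ) :=
  if x < G.W then G.triAt (G.hOf x) (x - G.pos (G.hOf x)) else none

open Classical in
/-- The triangle at candidate `x` if it is sampled by the words from number `D` on; one candidate
is chosen from each block of length `B`. -/
noncomputable def samp {w : ℕ} (ω : Tape w) (B D x : ℕ) : Option (ℕ × ℕ × ℕ) :=
  if x % B = ω (D + x / B) % B then G.tri x else none

/-- The triangles sampled among the first `X` candidates. -/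
noncomputable def sampled {w : ℕ} (ω : Tape w) (B D X : ℕ) : List (ℕ × ℕ × ℕ) :=
  (List.range X).filterMap (G.samp ω B D)

variable {G}

theorem pos_succ (h : ℕ) : G.pos (h + 1) = G.pos h + G.len h := Finset.sum_range_succ _ _

theorem pos_mono {a b : ℕ} (h : a ≤ b) : G.pos a ≤ G.pos b :=
  Finset.sum_le_sum_of_subset (Finset.range_mono h)

theorem hOf_eq {h x : ℕ} (hh : h < 2 * G.m) (h1 : G.pos h ≤ x) (h2 : x < G.pos (h + 1)) :
    G.hOf x = h := by
  classical
  rw [hOf, Nat.findGreatest_eq_iff]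
  refine ⟨hh.le, fun _ => h1, fun k hk _ hle => ?_⟩
  have := G.pos_mono (show h + 1 ≤ k from hk)
  omega

theorem tri_eq {h j : ℕ} (hh : h < 2 * G.m) (hj : j < G.len h) :
    G.tri (G.pos h + j) = G.triAt h j := by
  have h1 := G.pos_succ h
  have h2 : G.pos (h + 1) ≤ G.W := G.pos_mono hh
  have h3 : G.hOf (G.pos h + j) = h := hOf_eq hh (by omega) (by omega)
  rw [tri, if_pos (by omega), h3, Nat.add_sub_cancel_left]

theorem triAt_eq {h j q : ℕ} (H : G.Good h j)
    (hq : G.IsDart (G.c (G.π h)) (G.third h j) q) :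
    G.triAt h j = some (G.π h / 2, G.π (G.start (G.c (fl (G.π h))) + j) / 2, q / 2) := by
  rw [triAt, dif_pos H]
  have hc := H.2.2.choose_spec
  have : H.2.2.choose = q := G.simple _ hc.1 _ hq.1 (hc.2.1.trans hq.2.1.symm)
    (hc.2.2.trans hq.2.2.symm)
  rw [this]

theorem triAt_none {h j : ℕ} (H : ¬ G.Good h j) : G.triAt h j = none := dif_neg H

theorem perm_spec {h : ℕ} (hh : h < 2 * G.m) : G.π h < 2 * G.m ∧
    G.start (G.c (G.π h)) ≤ h ∧ h < G.start (G.c (G.π h)) + G.deg (G.c (G.π h)) :=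
  let H := Truss.perm_spec (c := G.c) G.perm hh
  ⟨H.1, H.2.2⟩

theorem perm_key {h v : ℕ} (h1 : G.start v ≤ h) (h2 : h < G.start v + G.deg v) :
    h < 2 * G.m ∧ G.c (G.π h) = v :=
  Truss.perm_key (c := G.c) G.perm h1 h2

theorem start_add_deg_le (v : ℕ) : G.start v + G.deg v ≤ 2 * G.m := cLt_add_cEq_le _ _ _

theorem sampled_stable {w : ℕ} {ω : Tape w} {B D a b : ℕ} (h : a ≤ b)
    (hn : ∀ x, a ≤ x → x < b → G.samp ω B D x = none) : G.sampled ω B D b = G.sampled ω B D a := by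
  induction b, h using Nat.le_induction with
  | base => rfl
  | succ b hb ih =>
    rw [sampled, List.range_succ, List.filterMap_append, ← sampled,
      ih fun x h1 h2 => hn x h1 (by omega)]
    simp [hn b hb (by omega)]

theorem sampled_succ {w : ℕ} {ω : Tape w} {B D a : ℕ} :
    G.sampled ω B D (a + 1) = G.sampled ω B D a ++ (G.samp ω B D a).toList := by
  rw [sampled, List.range_succ, List.filterMap_append, ← sampled]
  congr 1

/-- Between consecutive sample points nothing is sampled. -/
theorem sampled_next {w : ℕ} {ω : Tape w} {B D j : ℕ} (hB : 0 < B) :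
    G.sampled ω B D (B * (j + 1) + ω (D + (j + 1)) % B) =
      G.sampled ω B D (B * j + ω (D + j) % B + 1) := by
  have h1 := Nat.mod_lt (ω (D + j) : ℕ) hB
  have h2 := Nat.mod_lt (ω (D + (j + 1)) : ℕ) hB
  have h3 : B * (j + 1) = B * j + B := by ring
  refine sampled_stable (by omega) fun x hx1 hx2 => ?_
  rw [samp, if_neg]
  intro hx
  have hdm := Nat.div_add_mod x B
  have hm := Nat.mod_lt x hB
  rcases Nat.lt_or_ge x (B * (j + 1)) with h4 | h4
  · have : x / B = j := by
      refine Nat.div_eq_of_lt_le ?_ ?_ <;> rw [mul_comm] <;> omega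
    rw [this] at hx hdm
    omega
  · have : x / B = j + 1 := by
      have h5 : B * (j + 1 + 1) = B * (j + 1) + B := by ring
      refine Nat.div_eq_of_lt_le ?_ ?_ <;> rw [mul_comm] <;> omega
    rw [this] at hx hdm
    omega

theorem sampled_zero {w : ℕ} {ω : Tape w} {B D : ℕ} (hB : 0 < B) :
    G.sampled ω B D (ω D % B) = [] := by
  have : G.sampled ω B D 0 = [] := rfl
  rw [← this]
  refine sampled_stable (Nat.zero_le _) fun x _ hx => ?_
  have h1 := Nat.mod_lt (ω D : ℕ) hB
  rw [samp, if_neg]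
  rw [Nat.div_eq_of_lt (by omega), Nat.mod_eq_of_lt (by omega), Nat.add_zero]
  omega

theorem sampled_W {w : ℕ} {ω : Tape w} {B D x : ℕ} (hx : G.W ≤ x) :
    G.sampled ω B D x = G.sampled ω B D G.W := by
  refine sampled_stable hx fun y h1 _ => ?_
  simp [samp, tri, not_lt.2 h1]

theorem samp_self {w : ℕ} {ω : Tape w} {B D j : ℕ} (hB : 0 < B) :
    G.samp ω B D (B * j + ω (D + j) % B) = G.tri (B * j + ω (D + j) % B) := by
  have h1 := Nat.mod_lt (ω (D + j) : ℕ) hB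
  rw [samp, if_pos]
  rw [Nat.mul_add_mod, Nat.mod_mod, Nat.mul_add_div hB, Nat.div_eq_of_lt h1, Nat.add_zero]

/-- The state holds the graph. -/
structure On (G : Net) (s : St) : Prop where
  n : s.r 0 = G.n
  m : s.r 1 = G.m
  c : s.A 0 = G.c
  deg : ∀ v < G.n, s.A 1 v = G.deg v
  start : ∀ v < G.n, s.A 2 v = G.start v
  finish : ∀ v < G.n, s.A 3 v = G.start v + G.deg v
  π : ∀ h < 2 * G.m, s.A 4 h = G.π h
  key : ∀ v < G.n, s.A 5 v = G.key v

theorem On.frame {s s' : St} {R J : List ℕ} (h : G.On s) (hF : s.Frame s' R J)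
    (hR : ∀ i ∈ R, 2 ≤ i) (hJ : ∀ j ∈ J, 6 ≤ j) : G.On s' := by
  have r : ∀ i < 2, s'.r i = s.r i := fun i hi => hF.1 i fun h => by have := hR i h; omega
  have a : ∀ j < 6, s'.A j = s.A j := fun i hi => hF.2 i fun h => by have := hJ i h; omega
  exact ⟨by rw [r 0 (by simp), h.n], by rw [r 1 (by simp), h.m], by rw [a 0 (by simp), h.c],
    by rw [a 1 (by simp)]; exact h.deg, by rw [a 2 (by simp)]; exact h.start,
    by rw [a 3 (by simp)]; exact h.finish, by rw [a 4 (by simp)]; exact h.π,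
    by rw [a 5 (by simp)]; exact h.key⟩

end Net

variable {w I : ℕ} {G : Net}

/-- The other dart, as an expression. -/
def flExpr (e : Expr) : Expr := e + 1 - 2 * (e % 2)

@[simp] theorem val_flExpr (r : ℕ → ℕ) (e : Expr) : (flExpr e).val r = fl (e.val r) := rfl

@[simp] theorem fits_flExpr (E : ℕ) (r : ℕ → ℕ) (e : Expr) : (flExpr e).fits E r ↔
    e.fits E r ∧ e.val r + 1 < E ∧ 2 * (e.val r % 2) < E := by
  simp only [flExpr, Expr.fits_sub, Expr.fits_add, Expr.fits_mul, Expr.fits_mod, Expr.fits_ofNat,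
    Expr.val_ofNat, Expr.val_mod]
  simp
  tauto

/-- All darts at the vertex in register `19` are registered at their ends, in array `6`. -/
def mark : Prog :=
  .set 24 (.reg 15) ;; ld 25 3 (.reg 19) ;; .loop ((Expr.reg 24).lt (.reg 25))
    (ld 23 4 (.reg 24) ;; ld 28 0 (flExpr (.reg 23)) ;; st 6 (.reg 28) (.reg 23) ;;
      .set 24 (.reg 24 + 1))

/-- The darts at `v` are registered. -/
def Marked (G : Net) (s : St) (v : ℕ) : Prop :=
  ∀ q < 2 * G.m, G.c q = v → s.A 6 (G.c (fl q)) = q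

/-- Array `6` holds darts. -/
def MarkOk (G : Net) (s : St) : Prop := ∀ v < G.n, s.A 6 v < 2 * G.m

/-- Entries left over from other vertices are not erased. It is enough that every entry is a dart
(`MarkOk`), because `test` checks both of its ends. This avoids clearing the array for each vertex.
-/
theorem wp_mark [Mach w I] (ω : Tape w) (s : St) (hG : G.On s) (hm : 2 * G.m ≤ I) (hn : G.n ≤ I)
    (hv : s.r 19 < G.n) (h15 : s.r 15 = G.start (s.r 19)) (hM : MarkOk G s) :
    WP ω I mark s fun s' => s.Frame s' [23, 24, 25, 28] [6] ∧ MarkOk G s' ∧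
      Marked G s' (s.r 19) ∧ s'.d = s.d ∧ s'.t ≤ s.t + (8 * G.deg (s.r 19) + 6) := by
  have hE := Mach.index_lt (w := w) (I := I)
  refine WP.seq (vc.sound ?_)
  simp
  refine WP.seq (vc.sound ?_)
  have g : s.r 19 < I := by omega
  simp [g]
  set v := s.r 19 with hv'
  refine WP.loop (fun s' => s.Frame s' [23, 24, 25, 28] [6] ∧ s'.r 25 = G.start v + G.deg v ∧
    G.start v ≤ s'.r 24 ∧ s'.r 24 ≤ G.start v + G.deg v ∧ MarkOk G s' ∧
    (∀ q < 2 * G.m, G.c q = v → rho G.c (2 * G.m) q < s'.r 24 → s'.A 6 (G.c (fl q)) = q) ∧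
    s'.d = s.d ∧ s'.t + 8 * G.start v ≤ s.t + (8 * s'.r 24 + 5))
    (fun s' => G.start v + G.deg v - s'.r 24) ?_ ?_
  · simp [hG.finish v hv, h15]
    refine ⟨hM, fun q hq hqv hr => ?_, by omega⟩
    have := le_rho (c := G.c) (N := 2 * G.m) (q := q)
    rw [hqv] at this
    exact absurd hr (not_lt.2 this)
  rintro s1 ⟨F1, e25, l1, l2, m1, z1, d1, t1⟩
  have hG1 := hG.frame F1 (by simp) (by simp)
  refine ⟨by simp, fun hlt => vc.sound ?_, fun hge => ?_⟩
  · simp [e25] at hlt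
    obtain ⟨hh, hk⟩ := G.perm_key l1 hlt
    obtain ⟨hq, -, -⟩ := Net.perm_spec hh
    have hfl := G.c_lt _ (fl_lt hq)
    have hfI := fl_lt hq
    have g1 : s1.r 24 < I := by omega
    have g2 : fl (G.π (s1.r 24)) < I := by omega
    have g3 : G.c (fl (G.π (s1.r 24))) < I := by omega
    simp [hG1.π _ hh, hG1.c, g1, g2, g3, F1, d1, e25]
    refine ⟨by omega, by omega, ⟨by omega, by omega, ?_, ?_, by omega⟩, by omega⟩
    · intro x hx
      simp [Function.update_apply]
      split_ifs
      · exact hq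
      · exact m1 x hx
    · intro q hq' hqv hr
      rw [Function.update_apply]
      split_ifs with h1
      · exact (G.simple _ hq' _ hq (hqv.trans hk.symm) h1).symm
      · refine z1 q hq' hqv ?_
        rcases Nat.lt_or_ge (rho G.c (2 * G.m) q) (s1.r 24) with h2 | h2
        · exact h2
        · exfalso
          have h3 : rho G.c (2 * G.m) q = s1.r 24 := by omega
          have h4 := G.perm q hq'
          rw [h3] at h4
          exact h1 (by rw [h4])
  · simp [e25] at hge
    refine ⟨F1, m1, ?_, d1, by simp; omega⟩
    intro q hq hqv
    refine z1 q hq hqv ?_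
    have := rho_lt_end (c := G.c) hq
    rw [hqv] at this
    exact lt_of_lt_of_le this hge

end Truss

/-! ### Testing candidates and sampling in one pass over the darts -/

namespace Truss

variable {w I : ℕ} {G : Net}

/-- Array `a` holds a list of triples. -/
def Stored (a : ℕ → ℕ) (cnt : ℕ) (S : List (ℕ × ℕ × ℕ)) : Prop :=
  S = (List.range cnt).map fun j => (a (3 * j), a (3 * j + 1), a (3 * j + 2))

theorem Stored.length {a : ℕ → ℕ} {cnt : ℕ} {S : List (ℕ × ℕ × ℕ)} (h : Stored a cnt S) :
    S.length = cnt := by rw [h]; simp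

theorem Stored.append {a a' : ℕ → ℕ} {cnt x y z : ℕ} {S : List (ℕ × ℕ × ℕ)} (h : Stored a cnt S)
    (h0 : a' (3 * cnt) = x) (h1 : a' (3 * cnt + 1) = y) (h2 : a' (3 * cnt + 2) = z)
    (ha : ∀ i < 3 * cnt, a' i = a i) : Stored a' (cnt + 1) (S ++ [(x, y, z)]) := by
  rw [Stored, List.range_succ, List.map_append, h]
  congr 1
  · refine List.map_congr_left fun j hj => ?_
    rw [List.mem_range] at hj
    rw [ha _ (by omega), ha _ (by omega), ha _ (by omega)]
  · simp [h0, h1, h2]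

theorem take_append_singleton {α : Type*} (l : List α) (x : α) (k : ℕ) :
    (l ++ [x]).take k = if (l.take k).length < k then l.take k ++ [x] else l.take k := by
  rw [List.take_append, List.length_take]
  split_ifs with h
  · rw [List.take_of_length_le (l := [x]) (by simp; omega)]
  · rw [show k - l.length = 0 by omega]; simp

/-- The candidate with dart `23` is tested, and stored if it is a triangle. -/
def test : Prog :=
  ld 24 0 (flExpr (.reg 23)) ;; ld 25 6 (.reg 24) ;; ld 28 5 (.reg 24) ;; ld 30 0 (.reg 25) ;;
    ld 31 0 (flExpr (.reg 25)) ;;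
    .ite ((Expr.reg 30).eq (.reg 19)) (.ite ((Expr.reg 31).eq (.reg 24))
      (.ite ((Expr.reg 26).lt (.reg 28)) (.ite ((Expr.reg 28).lt (.reg 27))
        (.ite ((Expr.reg 7).lt (.reg 5))
          (st 7 (3 * .reg 7) (.reg 21 / 2) ;; st 7 (3 * .reg 7 + 1) (.reg 23 / 2) ;;
            st 7 (3 * .reg 7 + 2) (.reg 25 / 2) ;; .set 7 (.reg 7 + 1))
          .skip) .skip) .skip) .skip) .skip

theorem wp_test [Mach w I] (ω : Tape w) (s : St) (hG : G.On s) (hm : 2 * G.m ≤ I) (hn : G.n ≤ I)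
    (hcap : 3 * s.r 5 ≤ I) (hM : MarkOk G s) {h j : ℕ} (hh : h < 2 * G.m)
    (hj : j < G.deg (G.c (fl (G.π h)))) (hMv : Marked G s (G.c (G.π h)))
    (h19 : s.r 19 = G.c (G.π h)) (h21 : s.r 21 = G.π h)
    (h23 : s.r 23 = G.π (G.start (G.c (fl (G.π h))) + j))
    (h26 : s.r 26 = G.key (G.c (fl (G.π h)))) (h27 : s.r 27 = G.key (G.c (G.π h)))
    {l : List (ℕ × ℕ × ℕ)} (hS : Stored (s.A 7) (s.r 7) (l.take (s.r 5))) :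
    WP ω I test s fun s' => s.Frame s' [7, 24, 25, 28, 30, 31] [7] ∧
      Stored (s'.A 7) (s'.r 7) ((l ++ (G.triAt h j).toList).take (s.r 5)) ∧
      s'.d = s.d ∧ s'.t ≤ s.t + 25 := by
  have hE := Mach.index_lt (w := w) (I := I)
  obtain ⟨hg, -⟩ := G.perm_key (Nat.le_add_right _ _) (Nat.add_lt_add_left hj _)
  obtain ⟨hgm, -, -⟩ := Net.perm_spec hg
  have hfg := fl_lt hgm
  have hx := G.c_lt _ hfg
  have hthird : G.third h j = G.c (fl (s.r 23)) := by rw [h23]; rfl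
  rw [← h23] at hgm hfg hx
  set x := G.c (fl (s.r 23)) with hxd
  have hq := hM x hx
  set q := s.A 6 x with hqd
  have hfq := fl_lt hq
  -- The dart registered at `x` decides adjacency to the top vertex: if a dart to `x` exists, then
  -- `Marked` forces the entry to be it; otherwise the check of the two ends fails.
  have hgood : G.Good h j ↔ G.c q = G.c (G.π h) ∧ G.c (fl q) = x ∧
      G.key (G.c (fl (G.π h))) < G.key x ∧ G.key x < G.key (G.c (G.π h)) := by
    rw [Net.Good, hthird]
    constructor
    · rintro ⟨h1, h2, q', h3, h4, h5⟩
      have : q = q' := by rw [hqd, ← h5]; exact hMv q' h3 h4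
      rw [this]
      exact ⟨h4, h5, h1, h2⟩
    · rintro ⟨h1, h2, h3, h4⟩
      exact ⟨h3, h4, q, hq, h1, h2⟩
  refine vc.sound ?_
  have g1 : fl (s.r 23) < I := by omega
  have g2 : x < I := by omega
  have g3 : q < I := by omega
  have g4 : fl q < I := by omega
  have hno : ¬ G.Good h j → Stored (s.A 7) (s.r 7) ((l ++ (G.triAt h j).toList).take (s.r 5)) := by
    intro hng
    rw [G.triAt_none hng]
    simpa using hS
  simp [test, hG.c, ← hxd, g1, g2, ← hqd, g3, g4, h19, h26, h27, hG.key x hx]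
  refine ⟨by omega, by omega, ?_, ?_⟩
  · intro c1
    refine ⟨?_, ?_⟩
    · intro c2
      refine ⟨?_, ?_⟩
      · intro c3
        refine ⟨?_, ?_⟩
        · intro c4
          have hgd := hgood.2 ⟨c1, c2, c3, c4⟩
          have htri := G.triAt_eq hgd (q := q) ⟨hq, c1, hthird ▸ c2⟩
          rw [htri, Option.toList_some, take_append_singleton, hS.length]
          refine ⟨?_, ?_⟩
          · intro c5
            and_intros
            all_goals try omega
            rw [if_pos c5]
            refine hS.append ?_ ?_ ?_ ?_
            · simp [Function.update_apply, h21]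
            · simp [Function.update_apply, h23]
            · simp [Function.update_apply]
            · intro i hi
              rw [Function.update_of_ne (by omega), Function.update_of_ne (by omega),
                Function.update_of_ne (by omega)]
          · intro c5
            rw [if_neg (by omega)]
            exact hS
        · intro c4
          exact hno fun hgd => by have := (hgood.1 hgd).2.2.2; omega
      · intro c3
        exact hno fun hgd => by have := (hgood.1 hgd).2.2.1; omega
    · intro c2
      exact hno fun hgd => c2 (hgood.1 hgd).2.1
  · intro c1
    exact hno fun hgd => c1 (hgood.1 hgd).1

/-- The sample points up to `r 22` are treated. -/
def draws : Prog :=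
  .loop ((Expr.reg 18).lt (.reg 22))
    (ld 23 4 (.reg 29 + (.reg 18 - .reg 16)) ;; test ;; .set 17 (.reg 17 + .reg 6) ;; .rand 18 ;;
      .set 18 (.reg 17 + .reg 18 % .reg 6))

/-- After `j` draws: `r 18` is the next sample point, and the sampled triangles before it have
been stored. -/
structure DrawInv (G : Net) (ω : Tape w) (B D cap j : ℕ) (s : St) : Prop where
  block : s.r 17 = B * j
  point : s.r 18 = B * j + ω (D + j) % B
  drawn : s.d = D + j + 1
  few : B * j < G.W + B
  stored : Stored (s.A 7) (s.r 7) ((G.sampled ω B D (s.r 18)).take cap)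

/-- Only sample points are visited, not all candidates: each draw jumps to the next block at
constant cost. The word number `D + j` serves block `j`, so the successive points agree with
`Net.sampled`, and nothing lies between them (`Net.sampled_next`). -/
theorem wp_draws [Mach w I] (ω : Tape w) (s : St) (hG : G.On s) (hm : 2 * G.m ≤ I) (hn : G.n ≤ I)
    {B D j₀ : ℕ} (hB : 0 < B) (h6 : s.r 6 = B) (hW : G.W + 3 * B < wordBound w)
    (hcap : 3 * s.r 5 ≤ I) (hM : MarkOk G s) {h : ℕ} (hh : h < 2 * G.m) (hlow : G.Low h)
    (hMv : Marked G s (G.c (G.π h)))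
    (h16 : s.r 16 = G.pos h) (h22 : s.r 22 = G.pos (h + 1))
    (h19 : s.r 19 = G.c (G.π h)) (h21 : s.r 21 = G.π h)
    (h26 : s.r 26 = G.key (G.c (fl (G.π h)))) (h27 : s.r 27 = G.key (G.c (G.π h)))
    (h29 : s.r 29 = G.start (G.c (fl (G.π h)))) (h18 : G.pos h ≤ s.r 18)
    (hD : DrawInv G ω B D (s.r 5) j₀ s) :
    WP ω I draws s fun s' => s.Frame s' [7, 17, 18, 23, 24, 25, 28, 30, 31] [7] ∧
      G.pos (h + 1) ≤ s'.r 18 ∧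
      ∃ j, DrawInv G ω B D (s.r 5) j s' ∧ s'.t + 50 * j₀ ≤ s.t + 50 * j + 1 := by
  have hE := Mach.index_lt (w := w) (I := I)
  have hWp : G.pos (h + 1) ≤ G.W := G.pos_mono hh
  have hlen : G.pos (h + 1) = G.pos h + G.deg (G.c (fl (G.π h))) := by
    rw [G.pos_succ, Net.len, if_pos hlow]
  refine WP.loop (fun s' => s.Frame s' [7, 17, 18, 23, 24, 25, 28, 30, 31] [7] ∧
      G.pos h ≤ s'.r 18 ∧
      ∃ j, DrawInv G ω B D (s.r 5) j s' ∧ s'.t + 50 * j₀ ≤ s.t + 50 * j)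
    (fun s' => G.W - s'.r 18) ⟨by simp, h18, j₀, hD, le_rfl⟩ ?_
  rintro s1 ⟨F1, l1, j, ⟨b1, p1, d1, few1, S1⟩, t1⟩
  have e5 : s1.r 5 = s.r 5 := F1.1 5 (by simp)
  have e6 : s1.r 6 = B := (F1.1 6 (by simp)).trans h6
  have e16 : s1.r 16 = G.pos h := (F1.1 16 (by simp)).trans h16
  have e19 : s1.r 19 = G.c (G.π h) := (F1.1 19 (by simp)).trans h19
  have e21 : s1.r 21 = G.π h := (F1.1 21 (by simp)).trans h21
  have e22 : s1.r 22 = G.pos (h + 1) := (F1.1 22 (by simp)).trans h22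
  have e26 : s1.r 26 = _ := (F1.1 26 (by simp)).trans h26
  have e27 : s1.r 27 = _ := (F1.1 27 (by simp)).trans h27
  have e29 : s1.r 29 = _ := (F1.1 29 (by simp)).trans h29
  have a6 : s1.A 6 = s.A 6 := F1.2 6 (by simp)
  have hG1 := hG.frame F1 (by simp) (by simp [List.forall_mem_cons])
  refine ⟨by simp, fun hlt => ?_, fun hge => ?_⟩
  · rw [Expr.val_lt_ne_zero] at hlt
    simp only [Expr.val_reg, e22] at hlt
    set x := s1.r 18 with hx
    obtain ⟨i, hi⟩ := Nat.exists_eq_add_of_le l1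
    have hideg : i < G.deg (G.c (fl (G.π h))) := by omega
    obtain ⟨hg, -⟩ := G.perm_key (Nat.le_add_right _ _) (Nat.add_lt_add_left hideg (G.start _))
    have g1 : G.start (G.c (fl (G.π h))) + i < I := by omega
    refine WP.seq (vc.sound ?_)
    have hsub : x - G.pos h = i := by omega
    have hEE : G.start (G.c (fl (G.π h))) + i < wordBound w := by omega
    simp [e29, e16, ← hx, hsub, g1, hEE, hG1.π _ hg]
    refine WP.seq ((wp_test ω _ (hG1.frame (s' := _) (R := [23]) (J := []) (by simp) (by simp) (by simp)) hm hn
      (by simpa [e5] using hcap) (by simpa [MarkOk, a6] using hM) hh hideg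
      (by simpa [Marked, a6] using hMv) (by simpa using e19) (by simpa using e21) (by simp)
      (by simpa using e26) (by simpa using e27) (l := G.sampled ω B D x)
      (by simpa [e5] using S1)).mono ?_)
    rintro s2 ⟨F2, S2, d2, t2⟩
    simp at d2 t2
    simp [e5] at S2
    have f6 : s2.r 6 = B := by rw [F2.1 6 (by simp)]; simpa using e6
    have f17 : s2.r 17 = B * j := by rw [F2.1 17 (by simp)]; simpa using b1
    have hmul : B * (j + 1) = B * j + B := by ring
    have hmod := Nat.mod_lt (ω s2.d : ℕ) hB
    have hmod0 := Nat.mod_lt (ω (D + j) : ℕ) hB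
    have hd2 : s2.d = D + (j + 1) := by omega
    have hlist : G.sampled ω B D (B * (j + 1) + ω (D + (j + 1)) % B) =
        G.sampled ω B D x ++ (G.triAt h i).toList := by
      rw [Net.sampled_next hB, Net.sampled_succ, ← p1]
      congr 2
      have := Net.samp_self (G := G) (ω := ω) (D := D) (j := j) hB
      rw [← p1] at this
      rw [this, hi, Net.tri_eq hh]
      rw [Net.len, if_pos hlow]
      exact hideg
    refine vc.sound ?_
    simp [f6, f17]
    refine ⟨by omega, by omega, ⟨?_, by omega, j + 1, ⟨?_, ?_, ?_, by omega, ?_⟩, by omega⟩, ?_⟩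
    · exact St.Frame.trans (by simpa using F1) F2 (by simp) (by simp)
    · simp [hmul]
    · simp [hmul, hd2]
    · simp; omega
    · simp only [St.setR_A, St.draw_A, St.tick_A, St.setR_r, St.draw_r, St.tick_r]
      simp
      rw [hd2, ← hmul, hlist]
      exact S2
    · omega
  · rw [Expr.val_lt_eq_zero] at hge
    simp only [Expr.val_reg, e22] at hge
    exact ⟨F1, hge, j, ⟨b1, p1, d1, few1, S1⟩, by simp; omega⟩

/-- The sampling at position `r 15`. -/
def sampleStep : Prog :=
  ld 21 4 (.reg 15) ;; ld 19 0 (.reg 21) ;; ld 20 0 (flExpr (.reg 21)) ;; ld 29 2 (.reg 19) ;;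
    .ite ((Expr.reg 29).eq (.reg 15)) mark .skip ;;
    ld 26 5 (.reg 20) ;; ld 27 5 (.reg 19) ;;
    .ite ((Expr.reg 26).lt (.reg 27))
      (ld 29 1 (.reg 20) ;; .set 22 (.reg 16 + .reg 29) ;; ld 29 2 (.reg 20) ;; draws ;;
        .set 16 (.reg 22)) .skip ;;
    .set 15 (.reg 15 + 1)

/-- The total degree of the vertices whose darts have been registered before position `h`. -/
def markCost (G : Net) (h : ℕ) : ℕ :=
  if h = 0 then 0 else G.start (G.c (G.π (h - 1))) + G.deg (G.c (G.π (h - 1)))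

theorem markCost_succ (h : ℕ) :
    markCost G (h + 1) = G.start (G.c (G.π h)) + G.deg (G.c (G.π h)) := rfl

theorem markCost_le (h : ℕ) : markCost G h ≤ 2 * G.m := by
  unfold markCost
  split_ifs
  · exact Nat.zero_le _
  · exact Net.start_add_deg_le _

/-- At a position that is not the first of its vertex, the vertex is that of the position before. -/
theorem same_vertex {h : ℕ} (hh : h < 2 * G.m) (hs : G.start (G.c (G.π h)) ≠ h) :
    0 < h ∧ G.c (G.π (h - 1)) = G.c (G.π h) := by
  obtain ⟨-, h1, h2⟩ := Net.perm_spec hh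
  exact ⟨by omega, (G.perm_key (h := h - 1) (by omega) (by omega)).2⟩

/-- At the first position of a vertex the intervals registered so far end at or before `h`. The
growth of `markCost` therefore pays for registering the new vertex, and the total is at most `2 m`.
-/
theorem markCost_first {h : ℕ} (hh : h < 2 * G.m) (hs : G.start (G.c (G.π h)) = h) :
    markCost G h ≤ h := by
  unfold markCost
  split_ifs with h0
  · exact Nat.zero_le _
  · by_contra hlt
    obtain ⟨-, h1, -⟩ := Net.perm_spec (G := G) (h := h - 1) (by omega)
    have h2 := (G.perm_key (h := h) (v := G.c (G.π (h - 1))) (by omega) (by omega)).2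
    rw [h2] at hs
    omega

/-- The invariant of sampling at position `h`, after `j` draws. -/
structure SampInv (G : Net) (ω : Tape w) (B D cap h j : ℕ) (s : St) : Prop where
  draw : DrawInv G ω B D cap j s
  pos : s.r 16 = G.pos h
  le : G.pos h ≤ s.r 18
  ok : MarkOk G s
  marked : 0 < h → Marked G s (G.c (G.π (h - 1)))

theorem wp_sampleStep [Mach w I] (ω : Tape w) (s : St) (hG : G.On s) (hm : 2 * G.m ≤ I)
    (hn : G.n ≤ I) {B D j₀ h : ℕ} (hB : 0 < B) (h6 : s.r 6 = B)
    (hW : G.W + 3 * B < wordBound w) (hcap : 3 * s.r 5 ≤ I) (hh : h < 2 * G.m) (h15 : s.r 15 = h)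
    (hS : SampInv G ω B D (s.r 5) h j₀ s) :
    WP ω I sampleStep s fun s' =>
      s.Frame s' [7, 15, 16, 17, 18, 19, 20, 21, 22, 23, 24, 25, 26, 27, 28, 29, 30, 31] [6, 7] ∧
      s'.r 15 = h + 1 ∧
      ∃ j, SampInv G ω B D (s.r 5) (h + 1) j s' ∧
        s'.t + 50 * j₀ + 8 * markCost G h ≤ s.t + 50 * j + 8 * markCost G (h + 1) + 45 := by
  have hE := Mach.index_lt (w := w) (I := I)
  obtain ⟨hq, hs1, hs2⟩ := Net.perm_spec hh
  have hfq := fl_lt hq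
  have hv := G.c_lt _ hq
  have hu := G.c_lt _ hfq
  have hWp : G.pos (h + 1) ≤ G.W := G.pos_mono hh
  have g1 : h < I := by omega
  have g2 : G.π h < I := by omega
  have g3 : fl (G.π h) < I := by omega
  have g4 : G.c (G.π h) < I := by omega
  have g5 : G.c (fl (G.π h)) < I := by omega
  refine WP.seq (vc.sound ?_)
  simp [h15, g1, hG.π _ hh]
  refine WP.seq (vc.sound ?_)
  simp [g2, hG.c]
  refine WP.seq (vc.sound ?_)
  simp [g3, hG.c]
  refine ⟨by omega, WP.seq (vc.sound ?_)⟩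
  simp [g4, hG.start _ hv]
  refine WP.seq (WP.mono (Q := fun s' => s.Frame s' [19, 20, 21, 23, 24, 25, 28, 29] [6] ∧
    MarkOk G s' ∧ Marked G s' (G.c (G.π h)) ∧ s'.r 19 = G.c (G.π h) ∧
    s'.r 20 = G.c (fl (G.π h)) ∧ s'.r 21 = G.π h ∧ s'.d = s.d ∧
    s'.t + 8 * markCost G h ≤ s.t + 8 * markCost G (h + 1) + 17) ?_ ?_)
  · refine WP.ite (by simp) (fun h0 => ?_) fun h0 => vc.sound ?_
    · rw [Expr.val_eq_ne_zero] at h0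
      simp [h15] at h0
      refine (wp_mark ω _ (hG.frame (R := [19, 20, 21, 29]) (J := []) (by simp) (by simp) (by simp))
        hm hn (by simpa using hv) (by simp [h15, h0]) (by simpa [MarkOk] using hS.ok)).mono ?_
      rintro s1 ⟨F1, m1, M1, d1, t1⟩
      simp at M1 d1 t1
      have hmc := markCost_first hh h0
      refine ⟨St.Frame.trans (by simp) F1 (by simp) (by simp), m1, M1, ?_, ?_, ?_, d1, ?_⟩
      · rw [F1.1 19 (by simp)]; simp
      · rw [F1.1 20 (by simp)]; simp
      · rw [F1.1 21 (by simp)]; simp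
      · rw [markCost_succ, h0]; omega
    · rw [Expr.val_eq_eq_zero] at h0
      simp [h15] at h0
      obtain ⟨hpos, hprev⟩ := same_vertex hh h0
      have hmk := hS.marked hpos
      rw [hprev] at hmk
      have hmc : markCost G h = markCost G (h + 1) := by
        rw [markCost_succ, markCost, if_neg (by omega), hprev]
      simp [MarkOk, Marked]
      exact ⟨hS.ok, hmk, by omega⟩
  rintro s1 ⟨F1, m1, M1, e19, e20, e21, d1, t1⟩
  have hG1 := hG.frame F1 (by simp) (by simp)
  have i5 : s1.r 5 = s.r 5 := F1.1 5 (by simp)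
  have i6 : s1.r 6 = B := (F1.1 6 (by simp)).trans h6
  have i7 : s1.r 7 = s.r 7 := F1.1 7 (by simp)
  have i15 : s1.r 15 = h := (F1.1 15 (by simp)).trans h15
  have i16 : s1.r 16 = G.pos h := (F1.1 16 (by simp)).trans hS.pos
  have i17 : s1.r 17 = s.r 17 := F1.1 17 (by simp)
  have i18 : s1.r 18 = s.r 18 := F1.1 18 (by simp)
  have a7 : s1.A 7 = s.A 7 := F1.2 7 (by simp)
  have D1 : DrawInv G ω B D (s.r 5) j₀ s1 :=
    ⟨i17.trans hS.draw.block, i18.trans hS.draw.point, d1.trans hS.draw.drawn, hS.draw.few,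
      by rw [a7, i7, i18]; exact hS.draw.stored⟩
  have hle1 : G.pos h ≤ s1.r 18 := i18 ▸ hS.le
  refine WP.seq (vc.sound ?_)
  simp [e20, g5, hG1.key _ hu]
  refine WP.seq (vc.sound ?_)
  simp [e19, g4, hG1.key _ hv]
  refine WP.seq (WP.mono (Q := fun s' => s.Frame s'
      [7, 16, 17, 18, 19, 20, 21, 22, 23, 24, 25, 26, 27, 28, 29, 30, 31] [6, 7] ∧
      s'.r 15 = h ∧ ∃ j, SampInv G ω B D (s.r 5) (h + 1) j s' ∧
        s'.t + 50 * j₀ + 8 * markCost G h ≤ s.t + 50 * j + 8 * markCost G (h + 1) + 43) ?_ ?_)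
  · refine WP.ite (by simp) (fun h0 => ?_) fun h0 => vc.sound ?_
    · rw [Expr.val_lt_ne_zero] at h0
      simp at h0
      have hlen : G.pos (h + 1) = G.pos h + G.deg (G.c (fl (G.π h))) := by
        rw [G.pos_succ, Net.len, if_pos (show G.Low h from h0)]
      refine WP.seq (vc.sound ?_)
      simp [e20, g5, hG1.deg _ hu]
      refine WP.seq (vc.sound ?_)
      simp [i16, ← hlen]
      refine ⟨by omega, WP.seq (vc.sound ?_)⟩
      simp [e20, g5, hG1.start _ hu]
      refine WP.seq ((wp_draws (B := B) (D := D) (j₀ := j₀) (h := h) ω _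
        (hG1.frame (R := [22, 26, 27, 29]) (J := []) (by simp) (by simp) (by simp)) hm hn hB
        (by simpa using i6) hW (by simpa [i5] using hcap) (by simpa [MarkOk] using m1) hh h0
        (by simpa [Marked] using M1) (by simpa using i16) (by simp) (by simpa using e19)
        (by simpa using e21) (by simp) (by simp) (by simp) (by simpa using hle1) ?_).mono ?_)
      · exact ⟨by simpa using D1.block, by simpa using D1.point, by simpa using D1.drawn, D1.few,
          by simpa [i5] using D1.stored⟩
      rintro s2 ⟨F2, l2, j, D2, t2⟩
      simp at t2
      simp [i5] at D2
      have k22 : s2.r 22 = G.pos (h + 1) := by rw [F2.1 22 (by simp)]; simp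
      have k15 : s2.r 15 = h := by rw [F2.1 15 (by simp)]; simpa using i15
      have k6 : s2.A 6 = s1.A 6 := by rw [F2.2 6 (by simp)]; simp
      refine vc.sound ?_
      simp only [vc_set]
      refine ⟨by simp, ?_, by simpa using k15, j, ⟨⟨by simpa using D2.block,
        by simpa using D2.point, by simpa using D2.drawn, D2.few, by simpa using D2.stored⟩, ?_, ?_, ?_, ?_⟩,
        by simp; omega⟩
      · have F3 := St.Frame.trans (s := s1)
          (R := [7, 16, 17, 18, 19, 20, 21, 22, 23, 24, 25, 26, 27, 28, 29, 30, 31]) (J := [6, 7])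
          (by simp) F2 (by simp) (by simp)
        have F4 := St.Frame.trans
          (R := [7, 16, 17, 18, 19, 20, 21, 22, 23, 24, 25, 26, 27, 28, 29, 30, 31]) (J := [6, 7])
          (F1.mono (by simp) (by simp)) F3 (by simp) (by simp)
        simpa using F4
      · simpa using k22
      · simpa using l2
      · intro x hx
        simp [k6]
        exact m1 x hx
      · intro _ q hq1 hq2
        simp [k6]
        exact M1 q hq1 (by simpa using hq2)
    · rw [Expr.val_lt_eq_zero] at h0
      simp at h0
      have hlen : G.pos (h + 1) = G.pos h := by
        rw [G.pos_succ, Net.len, if_neg (show ¬ G.Low h from not_lt.2 h0), Nat.add_zero]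
      simp only [vc_skip]
      refine ⟨?_, by simpa using i15, j₀, ⟨⟨by simpa using D1.block,
        by simpa using D1.point, by simpa using D1.drawn, D1.few, by simpa using D1.stored⟩,
        by simpa [hlen] using i16, by simpa [hlen] using hle1, by simpa [MarkOk] using m1,
        fun _ => by simpa [Marked] using M1⟩, by simp; omega⟩
      have := F1.mono (R := [7, 16, 17, 18, 19, 20, 21, 22, 23, 24, 25, 26, 27, 28, 29, 30, 31])
        (J := [6, 7]) (by simp) (by simp)
      simpa using this
  rintro s2 ⟨F2, k15, j, S2, t2⟩
  refine vc.sound ?_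
  simp only [vc_set]
  refine ⟨by simp; omega, ?_, by simp [k15], j, ⟨⟨by simpa using S2.draw.block,
    by simpa using S2.draw.point, by simpa using S2.draw.drawn, S2.draw.few, by simpa using S2.draw.stored⟩,
    by simpa using S2.pos, by simpa using S2.le, by simpa [MarkOk] using S2.ok,
    fun h => by simpa [Marked] using S2.marked h⟩, by simp; omega⟩
  have := F2.mono (R := [7, 15, 16, 17, 18, 19, 20, 21, 22, 23, 24, 25, 26, 27, 28, 29, 30, 31])
    (J := [6, 7]) (by simp) (by simp)
  simpa using this

/-- One uniformly random candidate is drawn from each block of length `r 6`, and the triangles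
among them are stored. -/
def sample : Prog :=
  .set 7 0 ;; .set 15 0 ;; .set 16 0 ;; .set 17 0 ;; .rand 18 ;; .set 18 (.reg 18 % .reg 6) ;;
    .loop ((Expr.reg 15).lt (2 * .reg 1)) sampleStep

theorem wp_sample [Mach w I] (ω : Tape w) (s : St) (hG : G.On s) (hm : 2 * G.m ≤ I)
    (hn : G.n ≤ I) {B : ℕ} (hB : 0 < B) (h6 : s.r 6 = B) (hW : G.W + 3 * B < wordBound w)
    (hcap : 3 * s.r 5 ≤ I) (hM : MarkOk G s) :
    WP ω I sample s fun s' =>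
      s.Frame s' [7, 15, 16, 17, 18, 19, 20, 21, 22, 23, 24, 25, 26, 27, 28, 29, 30, 31] [6, 7] ∧
      MarkOk G s' ∧ Stored (s'.A 7) (s'.r 7) ((G.sampled ω B s.d G.W).take (s.r 5)) ∧
      -- Each of the `2 m` positions costs `47`, and registering costs `8` per dart: `47 * 2 m + 8 *
      -- 2 m = 110 m`.
      ∃ j, B * j < G.W + B ∧ s'.d = s.d + j + 1 ∧ s'.t ≤ s.t + 50 * j + 110 * G.m + 20 := by
  have hE := Mach.index_lt (w := w) (I := I)
  refine WP.seq (vc.sound ?_)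
  simp
  refine WP.seq (vc.sound ?_)
  simp
  refine WP.seq (vc.sound ?_)
  simp
  refine WP.seq (vc.sound ?_)
  simp
  refine WP.seq (vc.sound ?_)
  simp
  refine WP.seq (vc.sound ?_)
  simp [h6]
  refine WP.loop (fun s' => s.Frame s'
      [7, 15, 16, 17, 18, 19, 20, 21, 22, 23, 24, 25, 26, 27, 28, 29, 30, 31] [6, 7] ∧
      s'.r 15 ≤ 2 * G.m ∧ ∃ j, SampInv G ω B s.d (s.r 5) (s'.r 15) j s' ∧
      s'.t ≤ s.t + 50 * j + 8 * markCost G (s'.r 15) + 47 * s'.r 15 + 12)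
    (fun s' => 2 * G.m - s'.r 15) ?_ ?_
  · have hs0 := Net.sampled_zero (G := G) (ω := ω) (D := s.d) hB
    refine ⟨by simp, by simp, 0, ⟨⟨by simp, by simp, by simp, by simp; omega, ?_⟩, ?_, ?_, ?_, ?_⟩, ?_⟩
    · simp [hs0, Stored]
    · simp [Net.pos]
    · simp [Net.pos]
    · simpa [MarkOk] using hM
    · simp
    · simp
  rintro s1 ⟨F1, l1, j, S1, t1⟩
  have hG1 := hG.frame F1 (by simp) (by simp)
  have e5 : s1.r 5 = s.r 5 := F1.1 5 (by simp)
  have e6 : s1.r 6 = B := (F1.1 6 (by simp)).trans h6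
  refine ⟨by simp [hG1.m]; omega, fun hlt => ?_, fun hge => ?_⟩
  · rw [Expr.val_lt_ne_zero] at hlt
    simp [hG1.m] at hlt
    refine (wp_sampleStep (D := s.d) (j₀ := j) (h := s1.r 15) ω _
      (hG1.frame (R := []) (J := []) (by simp) (by simp) (by simp)) hm hn hB
      (by simpa using e6) hW (by simpa [e5] using hcap) hlt (by simp) ?_).mono ?_
    · rw [St.tick_r, e5]
      exact ⟨⟨S1.draw.block, S1.draw.point, S1.draw.drawn, S1.draw.few, S1.draw.stored⟩,
        S1.pos, S1.le, S1.ok, S1.marked⟩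
    rintro s2 ⟨F2, e15, j', S2, t2⟩
    simp [e5] at S2 t2
    refine ⟨⟨St.Frame.trans F1 F2 (by simp) (by simp), by omega, j', by rw [e15]; exact S2, ?_⟩, ?_⟩
    · rw [e15]; omega
    · omega
  · rw [Expr.val_lt_eq_zero] at hge
    simp [hG1.m] at hge
    have h15 : s1.r 15 = 2 * G.m := by omega
    have hc := markCost_le (G := G) (2 * G.m)
    rw [h15] at S1 t1
    refine ⟨F1, S1.ok, ?_, j, S1.draw.few, S1.draw.drawn, by simp; omega⟩
    rw [← Net.sampled_W (x := s1.r 18) S1.le]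
    exact S1.draw.stored

end Truss

/-! ### Preparations: input, degree order, number of candidates, first block length -/

namespace Truss

variable {w I : ℕ} {G : Net}

@[simp] theorem vc_load (ω : Tape w) (s : St) (Q : St → Prop) (i : ℕ) (e : Expr) :
    vc ω I (.load i e) s Q = (e.fits (wordBound w) s.r ∧ e.val s.r / 16 < I ∧
      Q (s.setR i (memOf s.A (e.val s.r)))) := rfl

/-- The input is copied to array `0`. -/
def copyInput : Prog :=
  .set 15 (2 * .reg 1) ;; .loop (.reg 15)
    (.set 15 (.reg 15 - 1) ;; .load 16 (.reg 15) ;; st 0 (.reg 15) (.reg 16))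

/-- Entry `i` of array `0` is cell `16 i ≥ i`. Copying downwards therefore never overwrites a cell
that is still to be read. Cells beyond the input are zero, which makes the two functions agree
everywhere. -/
theorem wp_copyInput [Mach w I] (ω : Tape w) (s : St) (hm : 2 * s.r 1 ≤ I)
    (h0 : ∀ x, 2 * s.r 1 ≤ x → memOf s.A x = 0) :
    WP ω I copyInput s fun s' => s.Frame s' [15, 16] [0] ∧ s'.A 0 = memOf s.A ∧ s'.d = s.d ∧
      s'.t ≤ s.t + (12 * s.r 1 + 3) := by
  have hE := Mach.index_lt (w := w) (I := I)
  refine WP.seq (vc.sound ?_)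
  simp
  refine ⟨by omega, WP.loop (fun s' => s.Frame s' [15, 16] [0] ∧ s'.r 15 ≤ 2 * s.r 1 ∧
    (∀ x < s'.r 15, memOf s'.A x = memOf s.A x) ∧
    (∀ q, s'.r 15 ≤ q → s'.A 0 q = memOf s.A q) ∧ s'.d = s.d ∧
    s'.t + 6 * s'.r 15 ≤ s.t + (12 * s.r 1 + 2)) (fun s' => s'.r 15) ?_ ?_⟩
  · simp
    refine ⟨fun q hq => ?_, by omega⟩
    have := h0 (16 * q) (by omega)
    rw [h0 q hq]
    simpa [memOf] using this
  rintro s1 ⟨F1, l1, m1, z1, d1, t1⟩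
  refine ⟨by simp, fun hlt => vc.sound ?_, fun hge => ?_⟩
  · simp at hlt
    have g1 : s1.r 15 - 1 < I := by omega
    have g2 : (s1.r 15 - 1) / 16 < I := by omega
    simp [g1, g2, F1, d1]
    refine ⟨⟨by omega, fun x hx => ?_, fun q hq => ?_, by omega⟩, by omega⟩
    · rw [← m1 x (by omega)]
      by_cases hx0 : x % 16 = 0
      · have hne : x / 16 ≠ s1.r 15 - 1 := by omega
        simp [memOf, hx0, Function.update_of_ne hne]
      · simp [memOf, hx0]
    · rw [Function.update_apply]
      split_ifs with h
      · rw [h]; exact m1 _ (by omega)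
      · exact z1 q (by omega)
  · simp at hge
    refine ⟨F1, funext fun q => z1 q (by omega), d1, by simp; omega⟩

/-- Array `5` gets the keys of the vertices. -/
def putKeys : Prog :=
  .set 15 0 ;; .loop ((Expr.reg 15).lt (.reg 0))
    (ld 16 1 (.reg 15) ;; st 5 (.reg 15) (.reg 16 * .reg 0 + .reg 15) ;; .set 15 (.reg 15 + 1))

theorem wp_putKeys [Mach w I] (ω : Tape w) (s : St) (h0 : s.r 0 = G.n) (hn : G.n ≤ I)
    (hdeg : ∀ v < G.n, s.A 1 v = G.deg v) (hE2 : (2 * G.m + 1) * G.n < wordBound w) :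
    WP ω I putKeys s fun s' => s.Frame s' [15, 16] [5] ∧ (∀ v < G.n, s'.A 5 v = G.key v) ∧
      s'.d = s.d ∧ s'.t ≤ s.t + (6 * G.n + 3) := by
  have hE := Mach.index_lt (w := w) (I := I)
  refine WP.seq (vc.sound ?_)
  simp
  refine WP.loop (fun s' => s.Frame s' [15, 16] [5] ∧ s'.r 15 ≤ G.n ∧
    (∀ v < s'.r 15, s'.A 5 v = G.key v) ∧ s'.d = s.d ∧ s'.t ≤ s.t + (6 * s'.r 15 + 2))
    (fun s' => G.n - s'.r 15) (by simp) ?_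
  rintro s1 ⟨F1, l1, z1, d1, t1⟩
  have e0 : s1.r 0 = G.n := (F1.1 0 (by simp)).trans h0
  have a1 : s1.A 1 = s.A 1 := F1.2 1 (by simp)
  refine ⟨by simp, fun hlt => vc.sound ?_, fun hge => ?_⟩
  · rw [Expr.val_lt_ne_zero] at hlt
    simp [e0] at hlt
    have g1 : s1.r 15 < I := by omega
    have hk : G.key (s1.r 15) = G.deg (s1.r 15) * G.n + s1.r 15 := rfl
    have hd : G.deg (s1.r 15) ≤ 2 * G.m := cEq_le _ _ _
    have hdm : G.deg (s1.r 15) * G.n ≤ 2 * G.m * G.n := Nat.mul_le_mul_right _ hd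
    have h3 : (2 * G.m + 1) * G.n = 2 * G.m * G.n + G.n := by ring
    simp [g1, F1, d1, a1, hdeg _ hlt, e0]
    refine ⟨⟨by omega, by omega⟩, by omega, ⟨by omega, fun v hv => ?_, by omega⟩, by omega⟩
    rw [Function.update_apply]
    simp
    split_ifs with h
    · rw [h, hk]
    · exact z1 v (by omega)
  · rw [Expr.val_lt_eq_zero] at hge
    simp [e0] at hge
    exact ⟨F1, fun v hv => z1 v (by omega), d1, by simp; omega⟩

/-- The number of candidates is computed. -/
def total : Prog :=
  .set 3 0 ;; .set 15 0 ;; .loop ((Expr.reg 15).lt (2 * .reg 1))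
    (ld 16 4 (.reg 15) ;; ld 17 0 (.reg 16) ;; ld 18 0 (flExpr (.reg 16)) ;; ld 19 5 (.reg 17) ;;
      ld 20 5 (.reg 18) ;; .ite ((Expr.reg 20).lt (.reg 19))
        (ld 21 1 (.reg 18) ;; .set 3 (.reg 3 + .reg 21)) .skip ;; .set 15 (.reg 15 + 1))

theorem wp_total [Mach w I] (ω : Tape w) (s : St) (hG : G.On s) (hm : 2 * G.m ≤ I)
    (hn : G.n ≤ I) (hW : G.W < wordBound w) :
    WP ω I total s fun s' => s.Frame s' [3, 15, 16, 17, 18, 19, 20, 21] [] ∧ s'.r 3 = G.W ∧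
      s'.d = s.d ∧ s'.t ≤ s.t + (40 * G.m + 5) := by
  have hE := Mach.index_lt (w := w) (I := I)
  refine WP.seq (vc.sound ?_)
  simp
  refine WP.seq (vc.sound ?_)
  simp
  refine WP.loop (fun s' => s.Frame s' [3, 15, 16, 17, 18, 19, 20, 21] [] ∧ s'.r 15 ≤ 2 * G.m ∧
    s'.r 3 = G.pos (s'.r 15) ∧ s'.d = s.d ∧ s'.t ≤ s.t + (20 * s'.r 15 + 4))
    (fun s' => 2 * G.m - s'.r 15) (by simp [Net.pos]) ?_
  rintro s1 ⟨F1, l1, z1, d1, t1⟩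
  have hG1 := hG.frame F1 (by simp) (by simp)
  refine ⟨by simp [hG1.m]; omega, fun hlt => ?_, fun hge => ?_⟩
  · rw [Expr.val_lt_ne_zero] at hlt
    simp [hG1.m] at hlt
    set h := s1.r 15 with hh
    obtain ⟨hq, -, -⟩ := Net.perm_spec hlt
    have hfq := fl_lt hq
    have hv := G.c_lt _ hq
    have hu := G.c_lt _ hfq
    have hWp : G.pos (h + 1) ≤ G.W := G.pos_mono hlt
    have g1 : h < I := by omega
    have g2 : G.π h < I := by omega
    have g3 : fl (G.π h) < I := by omega
    have g4 : G.c (G.π h) < I := by omega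
    have g5 : G.c (fl (G.π h)) < I := by omega
    refine vc.sound ?_
    simp [← hh, g1, g2, g3, g4, g5, hG1.π _ hlt, hG1.c, hG1.key _ hu, hG1.key _ hv,
      hG1.deg _ hu, z1, d1, F1]
    refine ⟨by omega, fun h0 => ?_, fun h0 => ?_⟩
    · have hlen : G.pos (h + 1) = G.pos h + G.deg (G.c (fl (G.π h))) := by
        rw [G.pos_succ, Net.len, if_pos (show G.Low h from h0)]
      refine ⟨by omega, by omega, ⟨by omega, hlen.symm, by omega⟩, by omega⟩
    · have hlen : G.pos (h + 1) = G.pos h := by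
        rw [G.pos_succ, Net.len, if_neg (show ¬ G.Low h from not_lt.2 h0), Nat.add_zero]
      refine ⟨by omega, ⟨by omega, hlen.symm, by omega⟩, by omega⟩
  · rw [Expr.val_lt_eq_zero] at hge
    simp [hG1.m] at hge
    have h15 : s1.r 15 = 2 * G.m := by omega
    rw [h15] at z1 t1
    exact ⟨F1, z1, d1, by simp; omega⟩

/-- Register `17` gets the length of the binary expansion of register `1`. -/
def binLength : Prog :=
  .set 16 1 ;; .set 17 0 ;; .loop ((Expr.reg 16).lt (.reg 1 + 1))
    (.set 16 (.reg 16 * 2) ;; .set 17 (.reg 17 + 1))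

theorem wp_binLength [Mach w I] (ω : Tape w) (s : St) (hm : 2 * s.r 1 ≤ I) :
    WP ω I binLength s fun s' => s.Frame s' [16, 17] [] ∧ s'.r 17 = Nat.size (s.r 1) ∧
      s'.d = s.d ∧ s'.t ≤ s.t + (4 * s.r 1 + 5) := by
  have hE := Mach.index_lt (w := w) (I := I)
  have h16 : 16 < wordBound w := Mach.const_lt I
  have hsz : Nat.size (s.r 1) ≤ s.r 1 := Nat.size_le.2 Nat.lt_two_pow_self
  refine WP.seq (vc.sound ?_)
  simp
  refine WP.seq (vc.sound ?_)
  simp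
  refine WP.loop (fun s' => s.Frame s' [16, 17] [] ∧ s'.r 17 ≤ Nat.size (s.r 1) ∧
    s'.r 16 = 2 ^ s'.r 17 ∧ s'.d = s.d ∧ s'.t ≤ s.t + (4 * s'.r 17 + 4))
    (fun s' => Nat.size (s.r 1) - s'.r 17) (by simp) ?_
  rintro s1 ⟨F1, l1, z1, d1, t1⟩
  have e1 : s1.r 1 = s.r 1 := F1.1 1 (by simp)
  refine ⟨by simp [e1]; omega, fun hlt => vc.sound ?_, fun hge => ?_⟩
  · rw [Expr.val_lt_ne_zero] at hlt
    simp [e1] at hlt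
    have h1 : s1.r 17 < Nat.size (s.r 1) := Nat.lt_size.2 (by omega)
    simp [F1, d1]
    refine ⟨by omega, by omega, ⟨by omega, by rw [z1, pow_succ], by omega⟩, by omega⟩
  · rw [Expr.val_lt_eq_zero] at hge
    simp [e1] at hge
    have h1 : Nat.size (s.r 1) ≤ s1.r 17 := Nat.size_le.2 (by omega)
    exact ⟨F1, by simp; omega, d1, by simp; omega⟩

/-- The first block length is computed, from the number of edges, the threshold and the number of
candidates in registers `1`, `4`, `3`. -/
def blockLength : Prog :=
  .set 6 1 ;; .loop ((Expr.reg 6 * 2 * .reg 1 * .reg 4).lt (.reg 3 + 1)) (.set 6 (.reg 6 * 2))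

/-- Doubling stops at the largest power of two with `B m L ≤ W`, or at `1`. The lower bound on `W`
keeps the cost of a round under control, and the upper bound keeps the first sample below the cap.
-/
theorem wp_blockLength [Mach w I] (ω : Tape w) (s : St) (hpos : 0 < s.r 1 * s.r 4)
    (hE : 2 * (s.r 3 + s.r 1 * s.r 4) + 1 < wordBound w) :
    WP ω I blockLength s fun s' => s.Frame s' [6] [] ∧
      (∃ b, s'.r 6 = 2 ^ b ∧ s'.t ≤ s.t + (2 * b + 3)) ∧
      (s'.r 6 = 1 ∨ s'.r 6 * (s.r 1 * s.r 4) ≤ s.r 3) ∧ s.r 3 < 2 * (s'.r 6 * (s.r 1 * s.r 4)) ∧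
      s'.d = s.d := by
  have h16 : 16 < wordBound w := Mach.const_lt I
  refine WP.seq (vc.sound ?_)
  simp
  refine WP.loop (fun s' => s.Frame s' [6] [] ∧ (∃ b, s'.r 6 = 2 ^ b ∧ s'.t ≤ s.t + (2 * b + 2)) ∧
      (s'.r 6 = 1 ∨ s'.r 6 * (s.r 1 * s.r 4) ≤ s.r 3) ∧ s'.d = s.d)
    (fun s' => s.r 3 + 1 - s'.r 6) ⟨by simp, ⟨0, by simp⟩, by simp⟩ ?_
  rintro s1 ⟨F1, ⟨b, hb, t1⟩, z1, d1⟩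
  have e1 : s1.r 1 = s.r 1 := F1.1 1 (by simp)
  have e3 : s1.r 3 = s.r 3 := F1.1 3 (by simp)
  have e4 : s1.r 4 = s.r 4 := F1.1 4 (by simp)
  have hB : 0 < s1.r 6 := by rw [hb]; positivity
  set B := s1.r 6 with hBd
  set M := s.r 1 * s.r 4 with hM
  have hx : B * 2 * s.r 1 * s.r 4 = 2 * (B * M) := by rw [hM]; ring
  have hBM : B ≤ B * M := Nat.le_mul_of_pos_right _ hpos
  have h4 : 0 < s.r 4 := Nat.pos_of_mul_pos_left hpos
  have hx' : B * 2 * s.r 1 ≤ B * 2 * s.r 1 * s.r 4 := Nat.le_mul_of_pos_right _ h4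
  have hBMle : B * M ≤ s.r 3 + M := by
    rcases z1 with h | h
    · rw [h]; omega
    · omega
  refine ⟨?_, fun hlt => vc.sound ?_, fun hge => ?_⟩
  · simp [e1, e3, e4, ← hBd]; omega
  · rw [Expr.val_lt_ne_zero] at hlt
    simp [e1, e3, e4, ← hBd, hx] at hlt
    have h5 : B * 2 * M = 2 * (B * M) := by ring
    simp [F1, d1, ← hBd, h5]
    refine ⟨by omega, ⟨⟨b + 1, by rw [hb, pow_succ], by omega⟩, by omega⟩, by omega⟩
  · rw [Expr.val_lt_eq_zero] at hge
    simp [e1, e3, e4, ← hBd, hx] at hge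
    exact ⟨F1, ⟨b, hb, by simp; omega⟩, z1, by simp [← hBd]; omega, d1⟩

/-- The number of sampled triangles at an edge that suffices for accuracy `1 / k`. -/
def threshold (A m k : ℕ) : ℕ := 8 * A * Nat.size m * k * k

/-- The preparations. -/
def setup (A : ℕ) : Prog :=
  copyInput ;; .set 13 (2 * .reg 1) ;; .set 14 (.reg 0) ;; csort 0 ;; putKeys ;; clear 6 ;; total ;;
    binLength ;; .set 4 (.const (8 * A) * .reg 17 * .reg 2 * .reg 2) ;;
    .set 5 (8 * .reg 1 * .reg 4) ;; blockLength

theorem wp_setup [Mach w I] (ω : Tape w) (s : St) {A k : ℕ} (h0 : s.r 0 = G.n) (h1 : s.r 1 = G.m)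
    (h2 : s.r 2 = k) (hc : memOf s.A = G.c) (hc0 : ∀ x, 2 * G.m ≤ x → G.c x = 0)
    (hm : 2 * G.m ≤ I) (hn : G.n ≤ I) (hm1 : 1 ≤ G.m) (hA : 1 ≤ A) (hk : 1 ≤ k)
    (hE1 : (2 * G.m + 1) * G.n < wordBound w)
    (hE2 : 2 * (G.W + 8 * G.m * threshold A G.m k) + 1 < wordBound w) :
    WP ω I (setup A) s fun s' => G.On s' ∧ MarkOk G s' ∧ s'.r 4 = threshold A G.m k ∧
      s'.r 5 = 8 * G.m * threshold A G.m k ∧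
      (∃ b, s'.r 6 = 2 ^ b ∧ (2 ^ b = 1 ∨ 2 ^ b * (G.m * threshold A G.m k) ≤ G.W) ∧
        G.W < 2 * (2 ^ b * (G.m * threshold A G.m k)) ∧
        s'.t ≤ s.t + 100 * (G.n + G.m) + 2 * b + 100) ∧ s'.d = s.d := by
  have hE := Mach.index_lt (w := w) (I := I)
  have hsz : 1 ≤ Nat.size G.m := Nat.size_pos.2 hm1
  have hL0 : 8 * A * Nat.size G.m * k * k = threshold A G.m k := rfl
  have hL1 : 8 * A ≤ 8 * A * Nat.size G.m := Nat.le_mul_of_pos_right _ hsz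
  have hL2 : 8 * A * Nat.size G.m ≤ 8 * A * Nat.size G.m * k := Nat.le_mul_of_pos_right _ hk
  have hL3 : 8 * A * Nat.size G.m * k ≤ 8 * A * Nat.size G.m * k * k :=
    Nat.le_mul_of_pos_right _ hk
  set L := threshold A G.m k with hL
  have hmL : L ≤ G.m * L := Nat.le_mul_of_pos_left _ hm1
  have hmm : G.m ≤ G.m * L := Nat.le_mul_of_pos_right _ (by omega)
  have h8 : 8 * G.m * L = 8 * (G.m * L) := by ring
  refine WP.seq ((wp_copyInput ω _ (by simpa [h1] using hm) (by simpa [h1, hc] using hc0)).mono ?_)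
  rintro s1 ⟨F1, a1, d1, t1⟩
  simp [hc] at a1 d1 t1
  have p0 : s1.r 0 = G.n := (F1.1 0 (by simp)).trans h0
  have p1 : s1.r 1 = G.m := (F1.1 1 (by simp)).trans h1
  have p2 : s1.r 2 = k := (F1.1 2 (by simp)).trans h2
  refine WP.seq (vc.sound ?_)
  simp [p1]
  refine ⟨by omega, WP.seq (vc.sound ?_)⟩
  simp [p0]
  refine WP.seq ((wp_csort ω _ (o := 0) (by simp) (by simpa using hn) (by simpa using hm)
    (by simpa [a1] using G.c_lt)).mono ?_)
  rintro s2 ⟨F2, S2, d2, t2⟩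
  simp [a1] at S2 d2 t2
  have q0 : s2.r 0 = G.n := by rw [F2.1 0 (by simp)]; simpa using p0
  have q1 : s2.r 1 = G.m := by rw [F2.1 1 (by simp)]; simpa using p1
  have q2 : s2.r 2 = k := by rw [F2.1 2 (by simp)]; simpa using p2
  have q14 : s2.r 14 = G.n := by rw [F2.1 14 (by simp)]; simp
  have b0 : s2.A 0 = G.c := by rw [F2.2 0 (by simp)]; simpa using a1
  refine WP.seq ((wp_putKeys (G := G) ω _ (by simpa using q0) hn (by exact S2.num) hE1).mono ?_)
  rintro s3 ⟨F3, K3, d3, t3⟩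
  simp at d3 t3
  have hG3 : G.On s3 := by
    refine ⟨(F3.1 0 (by simp)).trans q0, (F3.1 1 (by simp)).trans q1, (F3.2 0 (by simp)).trans b0,
      ?_, ?_, ?_, ?_, K3⟩
    · rw [F3.2 1 (by simp)]; exact S2.num
    · rw [F3.2 2 (by simp)]; exact S2.start
    · rw [F3.2 3 (by simp)]; exact S2.finish
    · rw [F3.2 4 (by simp)]
      intro h hh
      obtain ⟨q, hq, rfl⟩ := exists_rho_eq (c := G.c) hh
      rw [G.perm q hq]
      exact S2.perm q hq
  have r14 : s3.r 14 = G.n := (F3.1 14 (by simp)).trans q14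
  have r2 : s3.r 2 = k := (F3.1 2 (by simp)).trans q2
  refine WP.seq ((wp_clear ω _ (j := 6) (by simp) (by simpa [r14] using hn)).mono ?_)
  rintro s4 ⟨F4, z4, d4, t4⟩
  simp [r14] at z4 d4 t4
  have hG4 := hG3.frame (s' := s4) (R := [10]) (J := [6]) F4 (by simp) (by simp)
  refine WP.seq ((wp_total ω _ (hG4.frame (R := []) (J := []) (by simp) (by simp) (by simp)) hm hn
    (by omega)).mono ?_)
  rintro s5 ⟨F5, w5, d5, t5⟩
  simp at d5 t5
  have hG5 := hG4.frame (s' := s5) (R := _) (J := []) F5 (by simp) (by simp)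
  refine WP.seq ((wp_binLength ω _ (by simpa [hG5.m] using hm)).mono ?_)
  rintro s6 ⟨F6, l6, d6, t6⟩
  simp [hG5.m] at l6 d6 t6
  have hG6 := hG5.frame (s' := s6) (R := _) (J := []) F6 (by simp) (by simp)
  have r2' : s6.r 2 = k := by
    rw [F6.1 2 (by simp)]; simp only [St.tick_r]
    rw [F5.1 2 (by simp)]; simp only [St.tick_r]
    rw [F4.1 2 (by simp)]; exact r2
  have w6 : s6.r 3 = G.W := (F6.1 3 (by simp)).trans w5
  refine WP.seq (vc.sound ?_)
  simp [l6, r2', hL0]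
  refine ⟨by omega, WP.seq (vc.sound ?_)⟩
  simp [hG6.m]
  refine ⟨by omega, (wp_blockLength ω _ ?_ ?_).mono ?_⟩
  · simp [hG6.m]; omega
  · simp [hG6.m, w6]; omega
  rintro s7 ⟨F7, ⟨b, hb, t7⟩, z7, u7, d7⟩
  simp [hG6.m, w6] at z7 u7 t7 d7
  rw [hb] at z7 u7
  have hF : s6.Frame s7 [4, 5, 6] [] := St.Frame.trans (by simp) F7 (by simp) (by simp)
  have hF' : s4.Frame s7 [3, 4, 5, 6, 15, 16, 17, 18, 19, 20, 21] [] :=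
    St.Frame.trans (St.Frame.trans (s' := s5) (F5.mono (by simp) (by simp)) F6 (by simp) (by simp))
      hF (by simp) (by simp)
  refine ⟨hG6.frame hF (by simp) (by simp), ?_, ?_, ?_, ⟨b, hb, by simpa using z7, u7, by omega⟩, by omega⟩
  · intro v hv
    rw [hF'.2 6 (by simp), z4 v hv]; omega
  · rw [F7.1 4 (by simp)]; simp
  · rw [F7.1 5 (by simp)]; simp

end Truss

namespace Truss

/-! ### The hypergraph of the triangles, and samples of it -/

/-- The edges of a triple. -/
def edgesOf (tr : ℕ × ℕ × ℕ) : Finset ℕ := {tr.1, tr.2.1, tr.2.2}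

/-- The components of a triple are distinct. -/
def Distinct (tr : ℕ × ℕ × ℕ) : Prop := tr.1 ≠ tr.2.1 ∧ tr.1 ≠ tr.2.2 ∧ tr.2.1 ≠ tr.2.2

-- The three edges of a triangle are distinct, so a triple has at most one node at `e`; counting
-- nodes is counting triangles.
open Classical in
theorem card_nodes {a : ℕ → ℕ} {cnt : ℕ} {S : List (ℕ × ℕ × ℕ)} (h : Stored a cnt S)
    (hS : ∀ tr ∈ S, Distinct tr) (A : Finset ℕ) (e : ℕ) :
    ((Finset.range (3 * cnt)).filter fun y : ℕ =>
      a y = e ∧ ∀ i < 3, a (3 * (y / 3) + i) ∈ A).card =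
      S.countP fun tr => e ∈ edgesOf tr ∧ edgesOf tr ⊆ A := by
  induction cnt generalizing S with
  | zero =>
    have : S = [] := by rw [h]; rfl
    simp [this]
  | succ c ih =>
    have hS' : S = (List.range c).map (fun j => (a (3 * j), a (3 * j + 1), a (3 * j + 2))) ++
        [(a (3 * c), a (3 * c + 1), a (3 * c + 2))] := by
      rw [h, List.range_succ, List.map_append]; rfl
    have ih' := ih (S := (List.range c).map (fun j => (a (3 * j), a (3 * j + 1), a (3 * j + 2)))) rfl
      fun tr htr => hS tr (by rw [hS']; exact List.mem_append_left _ htr)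
    have hd : Distinct (a (3 * c), a (3 * c + 1), a (3 * c + 2)) := hS _ (by rw [hS']; simp)
    rw [hS', List.countP_append, ← ih', ← Nat.count_eq_card_filter_range,
      ← Nat.count_eq_card_filter_range, show 3 * (c + 1) = 3 * c + 1 + 1 + 1 by ring,
      Nat.count_succ, Nat.count_succ, Nat.count_succ, List.countP_singleton]
    have e0 : (3 * c) / 3 = c := by omega
    have e1 : (3 * c + 1) / 3 = c := by omega
    have e2 : (3 * c + 1 + 1) / 3 = c := by omega
    have hsub : (∀ i < 3, a (3 * c + i) ∈ A) ↔
        edgesOf (a (3 * c), a (3 * c + 1), a (3 * c + 2)) ⊆ A := by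
      simp only [edgesOf, Finset.insert_subset_iff, Finset.singleton_subset_iff]
      constructor
      · intro h; exact ⟨h 0 (by simp), h 1 (by simp), h 2 (by simp)⟩
      · rintro ⟨h0, h1, h2⟩ i hi
        interval_cases i
        · exact h0
        · exact h1
        · exact h2
    simp only [e0, e1, e2, hsub]
    obtain ⟨d1, d2, d3⟩ := hd
    simp only at d1 d2 d3
    by_cases hA : edgesOf (a (3 * c), a (3 * c + 1), a (3 * c + 2)) ⊆ A
    · simp only [hA, and_true, edgesOf, Finset.mem_insert, Finset.mem_singleton]
      by_cases h0 : a (3 * c) = e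
      · subst h0; simp [d1.symm, d2.symm]
      · by_cases h1 : a (3 * c + 1) = e
        · subst h1; simp [d1, d3.symm]
        · by_cases h2 : a (3 * c + 2) = e
          · subst h2; simp [d2, d3]
          · simp [h0, h1, h2, Ne.symm h0, Ne.symm h1, Ne.symm h2]
    · simp [hA]

namespace Net

variable (G : Net)

open Classical in
/-- The candidates whose triangle contains the edge `e` and has all its edges in `A`. -/
noncomputable def inc (A : Finset ℕ) (e : ℕ) : Finset ℕ :=
  (Finset.range G.W).filter fun x => ∃ tr, G.tri x = some tr ∧ e ∈ edgesOf tr ∧ edgesOf tr ⊆ A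

/-- Each candidate is charged to an edge, in the order of peeling; no edge gets more than `t`. -/
structure Charge (t : ℕ) (ch : ℕ → Finset ℕ) : Prop where
  card_le : ∀ e, (ch e).card ≤ t
  spec : ∀ A : Finset ℕ, A.Nonempty → (∀ e ∈ A, e < G.m) → ∃ e ∈ A, G.inc A e ⊆ ch e

variable {G}

/-- Delete an edge that lies in at most `t` of the remaining triangles, charge these to it, and
recurse. In a set `A`, the edge deleted first has all its triangles within `A` among its charges,
because `A` was then still present. -/
theorem exists_charge {t : ℕ} (h : ∀ A : Finset ℕ, A.Nonempty → (∀ e ∈ A, e < G.m) →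
    ∃ e ∈ A, (G.inc A e).card ≤ t) : ∃ ch, G.Charge t ch := by
  suffices H : ∀ n, ∀ A : Finset ℕ, A.card = n → (∀ e ∈ A, e < G.m) → ∃ ch : ℕ → Finset ℕ,
      (∀ e, (ch e).card ≤ t) ∧ ∀ A' ⊆ A, A'.Nonempty → ∃ e ∈ A', G.inc A' e ⊆ ch e by
    obtain ⟨ch, h1, h2⟩ := H _ (Finset.range G.m) rfl (by simp)
    exact ⟨ch, h1, fun A hA hlt => h2 A (fun e he => Finset.mem_range.2 (hlt e he)) hA⟩
  intro n
  induction n with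
  | zero =>
    intro A hA _
    refine ⟨fun _ => ∅, by simp, fun A' hA' hne => ?_⟩
    rw [Finset.card_eq_zero] at hA
    rw [hA, Finset.subset_empty] at hA'
    simp [hA'] at hne
  | succ n ih =>
    intro A hA hlt
    obtain ⟨e, he, hcard⟩ := h A (Finset.card_pos.1 (by omega)) hlt
    obtain ⟨ch, h1, h2⟩ := ih (A.erase e) (by rw [Finset.card_erase_of_mem he, hA]; rfl)
      fun x hx => hlt x (Finset.mem_of_mem_erase hx)
    refine ⟨Function.update ch e (G.inc A e), fun x => ?_, fun A' hA' hne => ?_⟩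
    · rw [Function.update_apply]; split_ifs
      · exact hcard
      · exact h1 x
    · by_cases heA : e ∈ A'
      · refine ⟨e, heA, ?_⟩
        rw [Function.update_self]
        intro x hx
        simp only [inc, Finset.mem_filter] at hx ⊢
        obtain ⟨hx1, tr, hx2, hx3, hx4⟩ := hx
        exact ⟨hx1, tr, hx2, hx3, hx4.trans hA'⟩
      · obtain ⟨e', he', hsub⟩ := h2 A' (fun x hx => Finset.mem_erase.2
          ⟨fun hxe => heA (hxe ▸ hx), hA' hx⟩) hne
        refine ⟨e', he', ?_⟩
        rwa [Function.update_of_ne (show e' ≠ e from fun h => heA (h ▸ he'))]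

theorem Good.distinct {h j q : ℕ} (hh : h < 2 * G.m) (hj : j < G.deg (G.c (fl (G.π h))))
    (H : G.Good h j) (hq : G.IsDart (G.c (G.π h)) (G.third h j) q) :
    Distinct (G.π h / 2, G.π (G.start (G.c (fl (G.π h))) + j) / 2, q / 2) := by
  obtain ⟨hg, hgk⟩ := G.perm_key (Nat.le_add_right _ _) (Nat.add_lt_add_left hj _)
  have hthird : G.third h j = G.c (fl (G.π (G.start (G.c (fl (G.π h))) + j))) := rfl
  set g := G.π (G.start (G.c (fl (G.π h))) + j)
  obtain ⟨h1, h2, -⟩ := H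
  rw [hthird] at h1 h2 hq
  obtain ⟨-, q1, q2⟩ := hq
  have same : ∀ a b : ℕ, a / 2 = b / 2 → a = b ∨ a = fl b := by
    intro a b hab; unfold fl; omega
  refine ⟨fun hE => ?_, fun hE => ?_, fun hE => ?_⟩
  · rcases same _ _ hE with h3 | h3
    · rw [h3] at h1 h2 hgk
      rw [← hgk] at h1
      omega
    · rw [h3] at h2
      omega
  · rcases same _ _ hE with h3 | h3
    · rw [h3, q2] at h1; omega
    · rw [h3, q2] at h2; omega
  · rcases same _ _ hE with h3 | h3
    · rw [h3, q2] at h2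
      rw [h3] at hgk
      rw [← hgk, q1] at h1
      omega
    · rw [h3, q2] at hgk
      rw [hgk] at h1
      omega

theorem exists_pos {x : ℕ} (hx : x < G.W) : ∃ h < 2 * G.m, ∃ j < G.len h, x = G.pos h + j := by
  have H : ∀ b, x < G.pos b → ∃ h < b, G.pos h ≤ x ∧ x < G.pos (h + 1) := by
    intro b
    induction b with
    | zero => intro h; simp [pos] at h
    | succ b ih =>
      intro h
      rcases Nat.lt_or_ge x (G.pos b) with h1 | h1
      · obtain ⟨h', h2, h3⟩ := ih h1
        exact ⟨h', by omega, h3⟩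
      · exact ⟨b, by omega, h1, h⟩
  obtain ⟨h, h1, h2, h3⟩ := H _ hx
  rw [pos_succ] at h3
  exact ⟨h, h1, x - G.pos h, by omega, by omega⟩

theorem low_of_lt_len {h j : ℕ} (hj : j < G.len h) :
    G.Low h ∧ j < G.deg (G.c (fl (G.π h))) := by
  unfold len at hj
  split_ifs at hj with h1
  · exact ⟨h1, hj⟩
  · simp at hj

/-- The description of the triangle at a candidate. -/
theorem tri_some {x : ℕ} {tr : ℕ × ℕ × ℕ} (h : G.tri x = some tr) :
    ∃ h < 2 * G.m, ∃ j < G.len h, x = G.pos h + j ∧ G.Good h j ∧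
      ∃ q, G.IsDart (G.c (G.π h)) (G.third h j) q ∧
        tr = (G.π h / 2, G.π (G.start (G.c (fl (G.π h))) + j) / 2, q / 2) := by
  have hx : x < G.W := by
    by_contra hx
    simp [tri, hx] at h
  obtain ⟨h', hh, j, hj, rfl⟩ := exists_pos hx
  rw [tri_eq hh hj] at h
  by_cases H : G.Good h' j
  · obtain ⟨q, hq⟩ := H.2.2
    rw [triAt_eq H hq] at h
    exact ⟨h', hh, j, hj, rfl, H, q, hq, (Option.some_inj.1 h).symm⟩
  · rw [triAt_none H] at h; simp at h

theorem tri_distinct {x : ℕ} {tr : ℕ × ℕ × ℕ} (h : G.tri x = some tr) : Distinct tr := by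
  obtain ⟨h', hh, j, hj, -, H, q, hq, rfl⟩ := tri_some h
  exact Good.distinct hh (low_of_lt_len hj).2 H hq

theorem tri_lt {x e : ℕ} {tr : ℕ × ℕ × ℕ} (h : G.tri x = some tr) (he : e ∈ edgesOf tr) :
    e < G.m := by
  obtain ⟨h', hh, j, hj, -, H, q, hq, rfl⟩ := tri_some h
  obtain ⟨hg, -⟩ := G.perm_key (Nat.le_add_right _ _)
    (Nat.add_lt_add_left (low_of_lt_len hj).2 (G.start _))
  have h1 := (perm_spec hh).1
  have h2 := (perm_spec hg).1
  have h3 := hq.1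
  simp only [edgesOf, Finset.mem_insert, Finset.mem_singleton] at he
  omega

open Classical in
/-- The number of candidates in `S` that are selected. -/
noncomputable def sel {w : ℕ} (ω : Tape w) (B D : ℕ) (S : Finset ℕ) : ℕ :=
  (S.filter fun x => x % B = ω (D + x / B) % B).card

theorem sel_mono {w : ℕ} {ω : Tape w} {B D : ℕ} {S S' : Finset ℕ} (h : S ⊆ S') :
    sel ω B D S ≤ sel ω B D S' :=
  Finset.card_le_card (Finset.filter_subset_filter _ h)

theorem sel_one {w : ℕ} {ω : Tape w} {D : ℕ} {S : Finset ℕ} : sel ω 1 D S = S.card := by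
  rw [sel, Finset.filter_true_of_mem]
  intro x _
  rw [Nat.mod_one, Nat.mod_one]

theorem mem_sampled {w : ℕ} {ω : Tape w} {B D X : ℕ} {tr : ℕ × ℕ × ℕ}
    (h : tr ∈ G.sampled ω B D X) : ∃ x, G.tri x = some tr := by
  rw [sampled, List.mem_filterMap] at h
  obtain ⟨x, -, hx⟩ := h
  rw [samp] at hx
  split_ifs at hx
  exact ⟨x, hx⟩

open Classical in
theorem countP_sampled {w : ℕ} {ω : Tape w} {B D : ℕ} (p : ℕ × ℕ × ℕ → Bool) :
    (G.sampled ω B D G.W).countP p =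
      sel ω B D ((Finset.range G.W).filter fun x => ∃ tr, G.tri x = some tr ∧ p tr = true) := by
  rw [sampled, List.countP_filterMap, sel, Finset.filter_filter, ← Nat.count_eq_card_filter_range,
    Nat.count_eq_card_filter_range, ← Nat.count_eq_card_filter_range, Nat.count]
  refine List.countP_congr fun x _ => ?_
  simp only [decide_eq_true_eq, samp]
  by_cases hs : x % B = ω (D + x / B) % B
  · simp only [hs, if_true, and_true]
    cases G.tri x <;> simp
  · simp [hs]

variable {w : ℕ} {ω : Tape w} {B D t τ K cnt : ℕ} {ch : ℕ → Finset ℕ} {a : ℕ → ℕ}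

open Classical in
theorem card_nodes_sampled (h : Stored a cnt (G.sampled ω B D G.W)) (A : Finset ℕ) (e : ℕ) :
    ((Finset.range (3 * cnt)).filter fun y : ℕ =>
      a y = e ∧ ∀ i < 3, a (3 * (y / 3) + i) ∈ A).card = sel ω B D (G.inc A e) := by
  rw [card_nodes h (fun tr htr => (mem_sampled htr).elim fun x hx => tri_distinct hx),
    countP_sampled, inc]
  simp only [decide_eq_true_eq]

/-- A feasible set of the sample contains an edge whose triangles in that set are all charged to it.
Its sampled degree is thus bounded by the sample of one fixed set `ch e`, whatever the feasible set
is. -/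
theorem core_le (h : Stored a cnt (G.sampled ω B D G.W)) (hch : G.Charge t ch)
    (hτ : IsCore a (3 * cnt) G.m τ) (hK : ∀ e < G.m, sel ω B D (ch e) ≤ K) : τ ≤ K := by
  classical
  obtain ⟨⟨A, hA, hlt, hf⟩, -⟩ := hτ
  obtain ⟨e, he, hsub⟩ := hch.spec A hA hlt
  have := hf e he
  rw [card_nodes_sampled h] at this
  exact this.trans ((sel_mono hsub).trans (hK e (hlt e he)))

/-- The fixed set `R` is itself feasible in the sample. -/
theorem le_core (h : Stored a cnt (G.sampled ω B D G.W)) (hτ : IsCore a (3 * cnt) G.m τ)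
    {R : Finset ℕ} (hR : R.Nonempty) (hlt : ∀ e ∈ R, e < G.m)
    (hK : ∀ e ∈ R, K ≤ sel ω B D (G.inc R e)) : K ≤ τ := by
  classical
  by_contra hn
  refine hR.ne_empty (hτ.2 R hlt fun e he => ?_)
  rw [card_nodes_sampled h]
  exact le_trans (by omega) (hK e he)

/-- Each triangle is charged to one of its own edges: apply `Charge.spec` to the three edges of the
triangle. -/
theorem length_sampled_le_sum (hch : G.Charge t ch) :
    (G.sampled ω B D G.W).length ≤ ∑ e ∈ Finset.range G.m, sel ω B D (ch e) := by
  classical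
  have := countP_sampled (G := G) (ω := ω) (B := B) (D := D) fun _ => true
  rw [List.countP_true] at this
  rw [this, sel]
  refine (Finset.card_le_card ?_).trans (Finset.card_biUnion_le (s := Finset.range G.m)
    (t := fun e => (ch e).filter fun x => x % B = ω (D + x / B) % B))
  intro x hx
  simp only [Finset.mem_filter, Finset.mem_range, and_true] at hx
  obtain ⟨⟨hxW, tr, htr⟩, hs⟩ := hx
  obtain ⟨e, he, hsub⟩ := hch.spec (edgesOf tr) ⟨tr.1, by simp [edgesOf]⟩ fun e he => tri_lt htr he
  refine Finset.mem_biUnion.2 ⟨e, Finset.mem_range.2 (tri_lt htr he), Finset.mem_filter.2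
    ⟨hsub ?_, hs⟩⟩
  exact Finset.mem_filter.2 ⟨Finset.mem_range.2 hxW, tr, htr, he, subset_rfl⟩

/-- At most one triangle is sampled from each block. -/
theorem length_sampled_le (hB : 0 < B) : B * (G.sampled ω B D G.W).length ≤ G.W + B := by
  have H : ∀ j, (G.sampled ω B D (B * j + ω (D + j) % B)).length ≤ j := by
    intro j
    induction j with
    | zero => simp [sampled_zero hB]
    | succ j ih =>
      rw [sampled_next hB, sampled_succ, List.length_append]
      have : ∀ o : Option (ℕ × ℕ × ℕ), o.toList.length ≤ 1 := by intro o; cases o <;> simp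
      have := this (G.samp ω B D (B * j + ω (D + j) % B))
      omega
  have h1 := H (G.W / B + 1)
  rw [sampled_W] at h1
  · calc B * _ ≤ B * (G.W / B + 1) := Nat.mul_le_mul_left _ h1
      _ = B * (G.W / B) + B := by ring
      _ ≤ _ := Nat.add_le_add_right (Nat.mul_div_le _ _) _
  · have := Nat.lt_mul_div_succ G.W hB
    omega

end Net

end Truss

/-! ### Rounds, their accuracy and cost, and the main program -/

namespace Truss

variable {w I : ℕ} {G : Net}

/-- One round: sampling, peeling, and the decision whether to go on with shorter blocks. -/
def round : Prog :=
  sample ;; peel ;; .ite ((Expr.reg 8).lt (.reg 4))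
    (.ite ((1 : Expr).lt (.reg 6)) (.set 6 (.reg 6 / 2)) (.set 9 0)) (.set 9 0)

theorem stored_lt {a : ℕ → ℕ} {cnt : ℕ} {S : List (ℕ × ℕ × ℕ)} (h : Stored a cnt S) {m : ℕ}
    (hS : ∀ tr ∈ S, ∀ e ∈ edgesOf tr, e < m) : ∀ y < 3 * cnt, a y < m := by
  intro y hy
  have h1 : (a (3 * (y / 3)), a (3 * (y / 3) + 1), a (3 * (y / 3) + 2)) ∈ S := by
    rw [h]
    exact List.mem_map.2 ⟨y / 3, List.mem_range.2 (by omega), rfl⟩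
  refine hS _ h1 _ ?_
  simp only [edgesOf, Finset.mem_insert, Finset.mem_singleton]
  have : y = 3 * (y / 3) ∨ y = 3 * (y / 3) + 1 ∨ y = 3 * (y / 3) + 2 := by omega
  rcases this with h | h | h
  · exact Or.inl (congrArg a h)
  · exact Or.inr (Or.inl (congrArg a h))
  · exact Or.inr (Or.inr (congrArg a h))

theorem wp_round [Mach w I] (ω : Tape w) (s : St) (hG : G.On s) (hm : 2 * G.m ≤ I)
    (hn : G.n ≤ I) (hm1 : 1 ≤ G.m) {B cap : ℕ} (hB : 0 < B) (h6 : s.r 6 = B) (h5 : s.r 5 = cap)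
    (hW : G.W + 3 * B < wordBound w) (hcap : 3 * cap ≤ I) (hM : MarkOk G s) :
    WP ω I round s fun s' => G.On s' ∧ MarkOk G s' ∧ s'.r 4 = s.r 4 ∧ s'.r 5 = cap ∧
      ∃ a cnt j, Stored a cnt ((G.sampled ω B s.d G.W).take cap) ∧
        IsCore a (3 * cnt) G.m (s'.r 8) ∧ B * j < G.W + B ∧ s'.d = s.d + j + 1 ∧
        s'.t ≤ s.t + 50 * j + 110 * G.m + 60 * (G.m + 1) * (s'.r 8 + 1) + 300 * cnt + 140 ∧
        ((s'.r 8 < s.r 4 ∧ 1 < B ∧ s'.r 6 = B / 2 ∧ s'.r 9 = s.r 9) ∨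
          (¬ (s'.r 8 < s.r 4 ∧ 1 < B) ∧ s'.r 6 = B ∧ s'.r 9 = 0)) := by
  refine WP.seq ((wp_sample ω _ (hG.frame (R := []) (J := []) (by simp) (by simp) (by simp)) hm hn
    hB (by simpa using h6) hW (by simpa [h5] using hcap) (by simpa [MarkOk] using hM)).mono ?_)
  rintro s1 ⟨F1, M1, S1, j, hj, d1, t1⟩
  simp [h5] at S1 d1 t1
  have F1' : s.Frame s1 [7, 15, 16, 17, 18, 19, 20, 21, 22, 23, 24, 25, 26, 27, 28, 29, 30, 31]
    [6, 7] := St.Frame.trans (by simp) F1 (by simp) (by simp)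
  have hG1 := hG.frame F1' (by simp) (by simp)
  have p4 : s1.r 4 = s.r 4 := F1'.1 4 (by simp)
  have p5 : s1.r 5 = cap := (F1'.1 5 (by simp)).trans h5
  have p6 : s1.r 6 = B := (F1'.1 6 (by simp)).trans h6
  have p9 : s1.r 9 = s.r 9 := F1'.1 9 (by simp)
  have hcnt : s1.r 7 ≤ cap := by
    have h1 := S1.length
    rw [List.length_take] at h1
    omega
  refine WP.seq ((wp_peel ω _ (by simp [hG1.m]; omega) (by simpa [hG1.m] using hm1)
    (by simp; omega) ?_).mono ?_)
  · simp only [St.tick_r, St.tick_A, hG1.m]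
    refine stored_lt S1 fun tr htr e he => ?_
    obtain ⟨x, hx⟩ := Net.mem_sampled (List.mem_of_mem_take htr)
    exact Net.tri_lt hx he
  rintro s2 ⟨F2, C2, t2, d2⟩
  simp [hG1.m] at C2 d2 t2
  have F2' : s1.Frame s2 [8, 10, 11, 12, 13, 14, 15, 16, 17, 18, 19, 20, 21, 22, 23]
    [8, 9, 10, 11, 12, 13, 14] := St.Frame.trans (by simp) F2 (by simp) (by simp)
  have hG2 := hG1.frame F2' (by simp) (by simp)
  have q4 : s2.r 4 = s.r 4 := (F2'.1 4 (by simp)).trans p4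
  have q5 : s2.r 5 = cap := (F2'.1 5 (by simp)).trans p5
  have q6 : s2.r 6 = B := (F2'.1 6 (by simp)).trans p6
  have q9 : s2.r 9 = s.r 9 := (F2'.1 9 (by simp)).trans p9
  have M2 : MarkOk G s2 := by
    intro v hv
    rw [F2'.2 6 (by simp)]; exact M1 v hv
  refine WP.mono (Q := fun s' => s2.Frame s' [6, 9] [] ∧ s'.d = s2.d ∧ s'.t ≤ s2.t + 4 ∧
    ((s2.r 8 < s.r 4 ∧ 1 < B ∧ s'.r 6 = B / 2 ∧ s'.r 9 = s.r 9) ∨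
      (¬ (s2.r 8 < s.r 4 ∧ 1 < B) ∧ s'.r 6 = B ∧ s'.r 9 = 0))) (vc.sound ?_) ?_
  · simp [q4, q6, q9]
    exact ⟨fun h1 => ⟨fun h2 => Or.inl ⟨h1, h2⟩, fun h2 _ => Or.inr h2⟩,
      fun h1 h2 => absurd h1 (not_le.2 h2)⟩
  rintro s3 ⟨F3, d3, t3, z3⟩
  have r8 : s3.r 8 = s2.r 8 := F3.1 8 (by simp)
  rw [r8]
  refine ⟨hG2.frame F3 (by simp) (by simp), ?_, (F3.1 4 (by simp)).trans q4,
    (F3.1 5 (by simp)).trans q5, s1.A 7, s1.r 7, j, S1, C2, hj, by omega, by omega, z3⟩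
  intro v hv
  rw [F3.2 6 (by simp)]; exact M2 v hv

/-- The value `t` is the core number of the hypergraph of the triangles: `ch` charges at most `t`
triangles to each edge, and each edge in `R` is in at least `t` triangles in `R`. -/
structure Net.Truss (G : Net) (t : ℕ) (ch : ℕ → Finset ℕ) (R : Finset ℕ) : Prop where
  charge : G.Charge t ch
  ne : R.Nonempty
  lt : ∀ e ∈ R, e < G.m
  le_card : ∀ e ∈ R, t ≤ (G.inc R e).card

/-- The numbers of sampled triangles deviate little from their expectations. -/
def Balanced (G : Net) (k L t : ℕ) (ch : ℕ → Finset ℕ) (R : Finset ℕ) (ω : Tape w) (B D : ℕ) :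
    Prop :=
  -- Divided by `2 k B`, these are the one-sided bounds `sel < t / B + max (t / B) (L / 2) / k` for
  -- charges and `sel > t / B - max (t / B) (L / 2) / k` for the truss.
  (∀ e < G.m, 2 * k * B * Net.sel ω B D (ch e) < 2 * k * t + max (2 * t) (L * B)) ∧
    ∀ e ∈ R, 2 * k * t < 2 * k * B * Net.sel ω B D (G.inc R e) + max (2 * t) (L * B)

section
variable {k L t B D τ cnt : ℕ} {ch : ℕ → Finset ℕ} {R : Finset ℕ} {ω : Tape w} {a : ℕ → ℕ}

theorem Balanced.core_lt (hb : Balanced G k L t ch R ω B D) (hT : G.Truss t ch R)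
    (hLB : 0 < L * B) (hS : Stored a cnt (G.sampled ω B D G.W)) (hτ : IsCore a (3 * cnt) G.m τ) :
    2 * k * B * τ < 2 * k * t + max (2 * t) (L * B) := by
  have hmax : 0 < max (2 * t) (L * B) := lt_max_of_lt_right hLB
  rcases Nat.eq_zero_or_pos τ with h0 | h0
  · rw [h0, mul_zero]; omega
  by_contra hn
  have := Net.core_le (K := τ - 1) hS hT.charge hτ fun e he => by
    by_contra h1
    have h2 := hb.1 e he
    have h3 := Nat.mul_le_mul_left (2 * k * B) (show τ ≤ Net.sel ω B D (ch e) by omega)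
    omega
  omega

theorem Balanced.lt_core (hb : Balanced G k L t ch R ω B D) (hT : G.Truss t ch R)
    (hS : Stored a cnt (G.sampled ω B D G.W)) (hτ : IsCore a (3 * cnt) G.m τ) :
    2 * k * t < 2 * k * B * τ + max (2 * t) (L * B) := by
  by_contra hn
  have := Net.le_core (K := τ + 1) hS hτ hT.ne hT.lt fun e he => by
    by_contra h1
    have h2 := hb.2 e he
    have h3 := Nat.mul_le_mul_left (2 * k * B) (show Net.sel ω B D (G.inc R e) ≤ τ by omega)
    omega
  omega

/-- With blocks of length `1` every candidate is selected, so the last possible round is exact. -/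
theorem core_eq (hT : G.Truss t ch R) (hS : Stored a cnt (G.sampled ω 1 D G.W))
    (hτ : IsCore a (3 * cnt) G.m τ) : τ = t :=
  le_antisymm
    (Net.core_le hS hT.charge hτ fun e _ => by rw [Net.sel_one]; exact hT.charge.card_le e)
    (Net.le_core hS hτ hT.ne hT.lt fun e he => by rw [Net.sel_one]; exact hT.le_card e he)

/-- If `t < 4 L B`, the upper deviation bound leaves fewer than `8 L` sampled triangles charged to
each edge. -/
theorem Balanced.length_le (hb : Balanced G k L t ch R ω B D) (hT : G.Truss t ch R) (hk : 1 ≤ k)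
    (hB : 0 < B) (ht : t < 4 * (L * B)) :
    (G.sampled ω B D G.W).length ≤ 8 * G.m * L := by
  refine (Net.length_sampled_le_sum hT.charge).trans ?_
  calc _ ≤ ∑ _e ∈ Finset.range G.m, 8 * L := Finset.sum_le_sum fun e he => ?_
    _ = 8 * G.m * L := by simp; ring
  have h1 := hb.1 e (Finset.mem_range.1 he)
  have h2 : max (2 * t) (L * B) ≤ 8 * (L * B) := max_le (by omega) (by omega)
  have h3 : 2 * k * t ≤ 2 * k * (4 * (L * B)) := Nat.mul_le_mul_left _ ht.le
  have h4 : 8 * (L * B) ≤ k * (8 * (L * B)) := Nat.le_mul_of_pos_left _ hk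
  by_contra hn
  have h5 := Nat.mul_le_mul_left (2 * k * B) (show 8 * L ≤ Net.sel ω B D (ch e) by omega)
  have h6 : 2 * k * B * (8 * L) = 2 * (k * (8 * (L * B))) := by ring
  have h7 : 2 * k * (4 * (L * B)) = k * (8 * (L * B)) := by ring
  omega

/-- For the first round the choice of the block length suffices, without any assumption on the tape:
the sample has at most `W / B + 1` triangles. -/
theorem length_le_of_W_lt (hB : 0 < B) (hL : 0 < G.m * L) (hW : G.W < 2 * (B * (G.m * L))) :
    (G.sampled ω B D G.W).length ≤ 8 * G.m * L := by
  have h1 := Net.length_sampled_le (G := G) (ω := ω) (D := D) hB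
  have h2 : B ≤ B * (G.m * L) := Nat.le_mul_of_pos_right _ hL
  refine le_of_mul_le_mul_left (a := B) ?_ hB
  have h3 : B * (8 * G.m * L) = 8 * (B * (G.m * L)) := by ring
  omega

/-- When the rounds end, the estimate is accurate. -/
theorem Balanced.accurate (hb : Balanced G k L t ch R ω B D) (hT : G.Truss t ch R) (hk : 1 ≤ k)
    (hB : 0 < B) (hS : Stored a cnt (G.sampled ω B D G.W)) (hτ : IsCore a (3 * cnt) G.m τ)
    (hL : 0 < L) (hend : ¬ (τ < L ∧ 1 < B)) :
    k * t ≤ k * (τ * B) + t ∧ k * (τ * B) ≤ k * t + t := by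
  rcases Nat.lt_or_ge 1 B with h1 | h1
  · have hLτ : L ≤ τ := by
      by_contra h2; exact hend ⟨by omega, h1⟩
    have h3 := hb.core_lt hT (Nat.mul_pos hL hB) hS hτ
    have h4 := hb.lt_core hT hS hτ
    have e1 : 2 * k * B * τ = 2 * (k * (τ * B)) := by ring
    have e2 : 2 * k * t = 2 * (k * t) := by ring
    rw [e1, e2] at h3 h4
    -- If `L B > 2 t`, the maximum is `L B`. Then `τ ≥ L` gives `2 k L B < 2 k t + L B`, while `2 k
    -- t < k L B` and `L B ≤ k L B`: a contradiction. So both maxima equal `2 t`, and the deviation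
    -- bounds become the claim.
    have h5 : L * B ≤ 2 * t := by
      by_contra h6
      have h7 : k * (L * B) ≤ k * (τ * B) :=
        Nat.mul_le_mul_left _ (Nat.mul_le_mul_right _ hLτ)
      have h8 : k * (2 * t + 1) ≤ k * (L * B) := Nat.mul_le_mul_left _ (by omega)
      have h9 : k * (2 * t + 1) = 2 * (k * t) + k := by ring
      have h10 : L * B ≤ k * (L * B) := Nat.le_mul_of_pos_left _ hk
      rw [max_eq_right (by omega)] at h3
      omega
    rw [max_eq_left h5] at h3 h4
    omega
  · obtain rfl : B = 1 := by omega
    rw [core_eq hT hS hτ, mul_one]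
    omega

/-- When the rounds go on, `t` is not too large. -/
theorem Balanced.lt_of_core_lt (hb : Balanced G k L t ch R ω B D) (hT : G.Truss t ch R)
    (hk : 2 ≤ k) (hS : Stored a cnt (G.sampled ω B D G.W)) (hτ : IsCore a (3 * cnt) G.m τ)
    (hτL : τ < L) (hB : 0 < B) : t < 2 * (L * B) := by
  by_contra hn
  have h4 := hb.lt_core hT hS hτ
  have e1 : 2 * k * B * τ = 2 * (k * (τ * B)) := by ring
  have e2 : 2 * k * t = 2 * (k * t) := by ring
  rw [e1, e2, max_eq_left (by omega)] at h4
  have h5 : τ * B ≤ L * B := Nat.mul_le_mul_right _ hτL.le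
  have h7 : k * (2 * (τ * B)) ≤ k * t := Nat.mul_le_mul_left _ (by omega)
  -- Here `k ≥ 2` is used, which comes from `ε < 1`.
  have h8 : 2 * t ≤ k * t := Nat.mul_le_mul_right _ hk
  have h9 : k * (2 * (τ * B)) = 2 * (k * (τ * B)) := by ring
  omega

/-- The cost of peeling. -/
theorem Balanced.mul_core_le (hb : Balanced G k L t ch R ω B D) (hT : G.Truss t ch R) (hk : 1 ≤ k)
    (hB : 0 < B) (hL : 0 < L) (hS : Stored a cnt (G.sampled ω B D G.W))
    (hτ : IsCore a (3 * cnt) G.m τ) (hBW : B = 1 ∨ B * (G.m * L) ≤ G.W) :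
    G.m * (τ * B) ≤ 2 * (G.m * t) + G.W := by
  rcases hBW with rfl | h
  · rw [core_eq hT hS hτ, mul_one]; omega
  · have h3 := hb.core_lt hT (Nat.mul_pos hL hB) hS hτ
    have e1 : 2 * k * B * τ = 2 * k * (τ * B) := by ring
    have h4 : max (2 * t) (L * B) ≤ 2 * k * (t + L * B) := by
      have h5 : 2 * (t + L * B) ≤ 2 * k * (t + L * B) := Nat.mul_le_mul_right _ (by omega)
      refine le_trans (max_le ?_ ?_) h5 <;> omega
    have h6 : 2 * k * (τ * B) < 2 * k * (2 * t + L * B) := by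
      have : 2 * k * (2 * t + L * B) = 2 * k * t + 2 * k * (t + L * B) := by ring
      omega
    have h7 : τ * B ≤ 2 * t + L * B := (Nat.lt_of_mul_lt_mul_left h6).le
    calc G.m * (τ * B) ≤ G.m * (2 * t + L * B) := Nat.mul_le_mul_left _ h7
      _ = 2 * (G.m * t) + B * (G.m * L) := by ring
      _ ≤ _ := by omega

end

/-- The program. -/
def main (A : ℕ) : Prog :=
  setup A ;; .set 9 1 ;; .loop (.reg 9) round ;; .set 0 (.reg 8 * .reg 6) ;; .set 1 1

/-- A bound for the cost of a round. -/
def roundCost (W m cap : ℕ) : ℕ :=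
  50 * (W + 1) + 110 * m + 60 * (m + 1) * (3 * cap + 1) + 300 * cap + 150

/-- A bound for the cost of the program. -/
def worstCost (W n m cap : ℕ) : ℕ := 100 * (n + m) + 2 * W + 130 + W * roundCost W m cap

/-- All samples that may be taken are balanced. -/
def GoodTape (G : Net) (k L t : ℕ) (ch : ℕ → Finset ℕ) (R : Finset ℕ) (ω : Tape w) : Prop :=
  -- There are at most `W` rounds before the current one, each drawing fewer than `W + 2` words. All
  -- admissible offsets `D` are included, because the actual offset of a round depends on the tape.
  ∀ b D, 2 ^ b ≤ G.W → D ≤ G.W * (G.W + 2) → Balanced G k L t ch R ω (2 ^ b) D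

/-- The cost of a balanced round. -/
theorem mul_cost_le {W m t τ B j cnt : ℕ} (hm1 : 1 ≤ m) (hB : m * B ≤ W)
    (hτ : m * (τ * B) ≤ 2 * (m * t) + W) (hj : B * j < W + B) (hcnt : B * cnt ≤ W + B) :
    (50 * j + 110 * m + 60 * (m + 1) * (τ + 1) + 300 * cnt + 150) * B ≤ 1500 * (W + m * t) := by
  have h1 : B ≤ m * B := Nat.le_mul_of_pos_left _ hm1
  have h2 : τ * B ≤ m * (τ * B) := Nat.le_mul_of_pos_left _ hm1
  have h3 : (50 * j + 110 * m + 60 * (m + 1) * (τ + 1) + 300 * cnt + 150) * B =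
      50 * (B * j) + 170 * (m * B) + 60 * (m * (τ * B)) + 60 * (τ * B) + 300 * (B * cnt) +
        210 * B := by ring
  rw [h3]
  omega

/-- The invariant of the rounds; `s₀` is the state at the start of the program. -/
structure MainInv (G : Net) (k L t : ℕ) (ch : ℕ → Finset ℕ) (R : Finset ℕ) (ω : Tape w)
    (s₀ : St) (b₀ b : ℕ) (s : St) : Prop where
  on : G.On s
  ok : MarkOk G s
  r4 : s.r 4 = L
  r5 : s.r 5 = 8 * G.m * L
  r6 : s.r 6 = 2 ^ b
  le : b ≤ b₀
  flag : s.r 9 ≤ 1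
  core : s.r 9 = 0 → s.r 8 ≤ 24 * G.m * L
  -- The factor `b₀ - b + (1 - r 9)` is the number of completed rounds: the last one clears the flag
  -- instead of halving the blocks.
  drawn : s.d ≤ (b₀ - b + (1 - s.r 9)) * (G.W + 2)
  time : s.t ≤ s₀.t + (100 * (G.n + G.m) + 2 * b₀ + 110) +
    (b₀ - b + (1 - s.r 9)) * roundCost G.W G.m (8 * G.m * L)
  -- Either the block length is the initial one, or the preceding round was rejected, which bounds
  -- `t`. Both cases ensure that the stored sample is not truncated.
  phase : GoodTape G k L t ch R ω → b = b₀ ∨ t < 4 * (L * 2 ^ b)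
  -- The geometric sum: with `X = 1500 (W + m t)`, time multiplied by block length is at most `X`
  -- before a round and grows by at most `X` in it; halving the block brings `2 X` back to `X`. Only
  -- the last round ends with `2 X`.
  cost : GoodTape G k L t ch R ω →
    (s.t - s₀.t) * 2 ^ b ≤ (2 - s.r 9) * (1500 * (G.W + G.m * t))
  accurate : GoodTape G k L t ch R ω → s.r 9 = 0 →
    k * t ≤ k * (s.r 8 * 2 ^ b) + t ∧ k * (s.r 8 * 2 ^ b) ≤ k * t + t

/-- Bounds that hold on every tape (draws, worst-case time, size of `r 8`) are kept apart from those
that need a good tape, since termination and space must not depend on luck. -/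
theorem MainInv.round [Mach w I] {k L t : ℕ} {ch : ℕ → Finset ℕ} {R : Finset ℕ} {ω : Tape w}
    {s₀ : St} {b₀ b : ℕ} {s : St} (h : MainInv G k L t ch R ω s₀ b₀ b s) (h9 : s.r 9 = 1)
    (hT : G.Truss t ch R) (hm : 2 * G.m ≤ I) (hn : G.n ≤ I) (hm1 : 1 ≤ G.m) (hk : 2 ≤ k)
    (hL : 0 < L) (hmW : G.m ≤ G.W) (hcap : 24 * G.m * L ≤ I) (hE : 4 * G.W < wordBound w)
    (hb₀ : 2 ^ b₀ = 1 ∨ 2 ^ b₀ * (G.m * L) ≤ G.W) (hb₀' : G.W < 2 * (2 ^ b₀ * (G.m * L))) :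
    WP ω I round s.tick fun s' => ∃ b', MainInv G k L t ch R ω s₀ b₀ b' s' ∧
      b' + s'.r 9 < b + s.r 9 := by
  have hB : 0 < 2 ^ b := by positivity
  have hmL : 0 < G.m * L := Nat.mul_pos hm1 hL
  have hbb : 2 ^ b ≤ 2 ^ b₀ := Nat.pow_le_pow_right (by simp) h.le
  have hBW : 2 ^ b = 1 ∨ 2 ^ b * (G.m * L) ≤ G.W := by
    rcases hb₀ with h1 | h1
    · left; omega
    · right; exact (Nat.mul_le_mul_right _ hbb).trans h1
  have hmB : G.m * 2 ^ b ≤ G.W := by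
    rcases hBW with h1 | h1
    · rw [h1]; omega
    · refine le_trans ?_ h1
      rw [mul_comm]
      exact Nat.mul_le_mul_left _ (Nat.le_mul_of_pos_right _ hL)
  have hBW' : 2 ^ b ≤ G.W := le_trans (Nat.le_mul_of_pos_left _ hm1) hmB
  have hb₀W : b₀ < G.W := by
    have h1 : b₀ < 2 ^ b₀ := Nat.lt_two_pow_self
    rcases hb₀ with h2 | h2
    · omega
    · have := Nat.le_mul_of_pos_right (2 ^ b₀) hmL
      omega
  have hcap' : 3 * (8 * G.m * L) = 24 * G.m * L := by ring
  refine (wp_round ω s.tick (h.on.frame (R := []) (J := []) (by simp) (by simp) (by simp)) hm hn hm1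
    hB (by simpa using h.r6) (by simpa using h.r5) (by omega) (by omega)
    (by simpa [MarkOk] using h.ok)).mono ?_
  rintro s' ⟨hG', hM', e4, e5, a, cnt, j, hS, hC, hj, hd, ht, hz⟩
  simp only [St.tick_r, St.tick_d, St.tick_t, h.r4, h9] at e4 hS hd ht hz
  have hdr := h.drawn
  have htm := h.time
  simp only [h9, Nat.sub_self, add_zero] at hdr htm
  have hjW : j ≤ G.W := by
    by_contra hn
    have h1 : 2 ^ b * (G.W + 1) ≤ 2 ^ b * j := Nat.mul_le_mul_left _ (by omega)
    have h2 : 2 ^ b * (G.W + 1) = 2 ^ b * G.W + 2 ^ b := by ring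
    have h3 : G.W ≤ 2 ^ b * G.W := Nat.le_mul_of_pos_left _ hB
    omega
  have hcnt : cnt ≤ 8 * G.m * L := by
    have h1 := hS.length
    rw [List.length_take] at h1
    omega
  have hτcap : s'.r 8 ≤ 24 * G.m * L := by
    obtain ⟨⟨A, hA, -, hf⟩, -⟩ := hC
    have := hf.le hA
    omega
  have hdrawn : ∀ i, s'.d ≤ (i + 1) * (G.W + 2) ∨ ¬ s.d ≤ i * (G.W + 2) := by
    intro i
    have : (i + 1) * (G.W + 2) = i * (G.W + 2) + G.W + 2 := by ring
    omega
  have hround : s'.t ≤ s.t + roundCost G.W G.m (8 * G.m * L) := by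
    have h1 : 60 * (G.m + 1) * (s'.r 8 + 1) ≤ 60 * (G.m + 1) * (3 * (8 * G.m * L) + 1) :=
      Nat.mul_le_mul_left _ (by omega)
    unfold roundCost
    omega
  -- On a good tape the cap is never reached, so the stored list is the full sample and balance
  -- applies to it.
  have hgood : GoodTape G k L t ch R ω → Balanced G k L t ch R ω (2 ^ b) s.d ∧
      Stored a cnt (G.sampled ω (2 ^ b) s.d G.W) ∧ 2 ^ b * cnt ≤ G.W + 2 ^ b := by
    intro hg
    have hbal := hg b s.d hBW' (hdr.trans (Nat.mul_le_mul_right _ (by omega)))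
    have hlen : (G.sampled ω (2 ^ b) s.d G.W).length ≤ 8 * G.m * L := by
      rcases h.phase hg with h1 | h1
      · exact length_le_of_W_lt hB hmL (h1 ▸ hb₀')
      · exact hbal.length_le hT (by omega) hB h1
    rw [List.take_of_length_le hlen] at hS
    refine ⟨hbal, hS, ?_⟩
    rw [← hS.length]
    exact Net.length_sampled_le hB
  have hcost : GoodTape G k L t ch R ω →
      (s'.t - s₀.t) * 2 ^ b ≤ 2 * (1500 * (G.W + G.m * t)) := by
    intro hg
    obtain ⟨hbal, hS', hc⟩ := hgood hg
    have h1 := mul_cost_le hm1 hmB (hbal.mul_core_le hT (by omega) hB hL hS' hC hBW) hj hc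
    have h2 := h.cost hg
    rw [h9] at h2
    have h3 : s'.t - s₀.t ≤ (s.t - s₀.t) + (50 * j + 110 * G.m + 60 * (G.m + 1) * (s'.r 8 + 1) +
      300 * cnt + 150) := by omega
    have h4 := Nat.mul_le_mul_right (2 ^ b) h3
    rw [Nat.add_mul] at h4
    omega
  rcases hz with ⟨z1, z2, z3, z4⟩ | ⟨z1, z2, z3⟩
  · obtain ⟨b', rfl⟩ : ∃ b', b = b' + 1 := by
      refine Nat.exists_eq_succ_of_ne_zero ?_
      rintro rfl
      simp at z2
    have hpow : 2 ^ (b' + 1) = 2 * 2 ^ b' := by ring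
    have hle := h.le
    have hsub : b₀ - b' = b₀ - (b' + 1) + 1 := by omega
    refine ⟨b', ⟨hG', hM', e4, e5, by rw [z3, hpow]; simp, by omega, by omega,
      by omega, ?_, ?_, ?_, ?_, by omega⟩, by omega⟩
    · rw [z4, Nat.sub_self, add_zero, hsub]
      exact (hdrawn _).resolve_right (not_not.2 hdr)
    · rw [z4, Nat.sub_self, add_zero, hsub, Nat.add_mul]
      omega
    · intro hg
      obtain ⟨hbal, hS', hc⟩ := hgood hg
      have h1 := hbal.lt_of_core_lt hT hk hS' hC z1 hB
      have h2 : L * 2 ^ (b' + 1) = 2 * (L * 2 ^ b') := by ring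
      right; omega
    · intro hg
      have h1 := hcost hg
      have h2 : (s'.t - s₀.t) * 2 ^ (b' + 1) = 2 * ((s'.t - s₀.t) * 2 ^ b') := by ring
      rw [z4]
      omega
  · refine ⟨b, ⟨hG', hM', e4, e5, z2, h.le, by omega, fun _ => hτcap, ?_, ?_, h.phase, ?_, ?_⟩,
      by omega⟩
    · rw [z3]
      exact (hdrawn _).resolve_right (not_not.2 hdr)
    · rw [z3, Nat.sub_zero, Nat.add_mul]
      omega
    · intro hg
      rw [z3]
      exact hcost hg
    · intro hg _
      obtain ⟨hbal, hS', hc⟩ := hgood hg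
      exact hbal.accurate hT (by omega) hB hS' hC hL z1

/-- The correctness of the program. -/
theorem wp_main [Mach w I] (ω : Tape w) (s : St) {A k t : ℕ} {ch : ℕ → Finset ℕ} {R : Finset ℕ}
    (hT : G.Truss t ch R) (h0 : s.r 0 = G.n) (h1 : s.r 1 = G.m) (h2 : s.r 2 = k)
    (hc : memOf s.A = G.c) (hc0 : ∀ x, 2 * G.m ≤ x → G.c x = 0) (hd : s.d = 0)
    (hm : 2 * G.m ≤ I) (hn : G.n ≤ I) (hn2 : G.n ≤ 2 * G.m) (hm1 : 1 ≤ G.m) (hA : 1 ≤ A)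
    (hk : 2 ≤ k) (hmW : G.m ≤ G.W) (hWm : G.W ≤ 4 * G.m * G.m)
    (hcap : 24 * G.m * threshold A G.m k ≤ I)
    (hE1 : (2 * G.m + 1) * G.n < wordBound w)
    (hE2 : 24 * G.m * threshold A G.m k * G.W < wordBound w) :
    WP ω I (main A) s fun s' =>
      s'.t ≤ s.t + worstCost G.W G.n G.m (8 * G.m * threshold A G.m k) ∧ s'.r 1 = 1 ∧
      (GoodTape G k (threshold A G.m k) t ch R ω →
        k * t ≤ k * s'.r 0 + t ∧ k * s'.r 0 ≤ k * t + t ∧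
        ∃ b, (s'.t - s.t) * 2 ^ b ≤ 4000 * (G.W + G.m * t) ∧
          (G.W < 2 * (2 ^ b * (G.m * threshold A G.m k)) ∨
            t < 4 * (threshold A G.m k * 2 ^ b))) := by
  have hE := Mach.index_lt (w := w) (I := I)
  have h16 : 16 < wordBound w := Mach.const_lt I
  set L := threshold A G.m k with hLd
  have hL : 0 < L := by
    have : 0 < Nat.size G.m := Nat.size_pos.2 hm1
    rw [hLd]; unfold threshold; positivity
  have hmL : 0 < G.m * L := Nat.mul_pos hm1 hL
  have hW1 : 1 ≤ G.W := hm1.trans hmW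
  have e24 : 24 * G.m * L * G.W = 24 * (G.m * L * G.W) := by ring
  have e24' : 24 * G.m * L = 24 * (G.m * L) := by ring
  have e8 : 8 * G.m * L = 8 * (G.m * L) := by ring
  have hl1 : G.m * L ≤ G.m * L * G.W := Nat.le_mul_of_pos_right _ hW1
  have hl2 : G.W ≤ G.m * L * G.W := Nat.le_mul_of_pos_left _ hmL
  refine WP.seq ((wp_setup (A := A) (k := k) ω s.tick h0 h1 h2 hc hc0 hm hn hm1 hA (by omega) hE1
    (by rw [← hLd]; omega)).mono ?_)
  rw [← hLd]
  rintro s1 ⟨hG1, hM1, p4, p5, ⟨b₀, p6, hb₀, hb₀', t1⟩, d1⟩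
  simp only [St.tick_t, St.tick_d] at t1 d1
  have hb₀W : b₀ < 2 ^ b₀ := Nat.lt_two_pow_self
  have hpW : 2 ^ b₀ ≤ G.W := by
    rcases hb₀ with h3 | h3
    · omega
    · exact (Nat.le_mul_of_pos_right _ hmL).trans h3
  have hmB : G.m * 2 ^ b₀ ≤ G.W := by
    rcases hb₀ with h3 | h3
    · rw [h3]; omega
    · refine le_trans ?_ h3
      rw [mul_comm]
      exact Nat.mul_le_mul_left _ (Nat.le_mul_of_pos_right _ hL)
  -- From `m 2 ^ b₀ ≤ W ≤ 4 m²`. Together with `n ≤ 2 m` this bounds the preparations by `308 m` up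
  -- to a constant.
  have hb₀m : b₀ ≤ 4 * G.m := by
    by_contra h3
    have h4 : G.m * (4 * G.m + 1) ≤ G.m * 2 ^ b₀ := Nat.mul_le_mul_left _ (by omega)
    have h5 : G.m * (4 * G.m + 1) = 4 * G.m * G.m + G.m := by ring
    omega
  refine WP.seq (vc.sound ?_)
  simp
  refine WP.seq (WP.mono (Q := fun s' => ∃ s₂ : St, s' = s₂.tick ∧ s₂.r 9 = 0 ∧
      ∃ b, MainInv G k L t ch R ω s b₀ b s₂)
    (WP.loop (fun s' => ∃ b, MainInv G k L t ch R ω s b₀ b s')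
      (fun s' => Nat.log 2 (s'.r 6) + s'.r 9) ?_ ?_) ?_)
  · refine ⟨b₀, ⟨hG1.frame (R := [9]) (J := []) (by simp) (by simp) (by simp),
      by simpa [MarkOk] using hM1, by simpa using p4, by simpa using p5, by simpa using p6, le_rfl,
      by simp, by simp, by simp; omega, by simp; omega, fun _ => Or.inl rfl, fun _ => ?_, by simp⟩⟩
    have h3 : 2 ^ b₀ ≤ G.m * 2 ^ b₀ := Nat.le_mul_of_pos_left _ hm1
    have h4 := Nat.mul_le_mul_right (2 ^ b₀)
      (show s1.t + 1 + 1 + 1 - s.t ≤ 308 * G.m + 110 by omega)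
    have h5 : (308 * G.m + 110) * 2 ^ b₀ = 308 * (G.m * 2 ^ b₀) + 110 * 2 ^ b₀ := by ring
    simp
    omega
  · rintro s2 ⟨b, h⟩
    refine ⟨by simp, fun h9 => ?_, fun h9 => ⟨s2, rfl, h9, b, h⟩⟩
    simp only [Expr.val_reg] at h9
    have h9' : s2.r 9 = 1 := by have := h.flag; omega
    refine (h.round h9' hT hm hn hm1 hk hL hmW (by omega) (by omega) hb₀ hb₀').mono ?_
    rintro s3 ⟨b', h', hlt⟩
    refine ⟨⟨b', h'⟩, ?_⟩
    rw [h'.r6, h.r6, Nat.log_pow (by simp), Nat.log_pow (by simp)]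
    exact hlt
  · rintro _ ⟨s2, rfl, h9, b, h⟩
    have hpow : 2 ^ b ≤ 2 ^ b₀ := Nat.pow_le_pow_right (by simp) h.le
    have h8 := Nat.mul_le_mul (h.core h9) (hpow.trans hpW)
    refine vc.sound ?_
    have htm := h.time
    have hle : (b₀ - b + (1 - s2.r 9)) * roundCost G.W G.m (8 * G.m * L) ≤
        G.W * roundCost G.W G.m (8 * G.m * L) := Nat.mul_le_mul_right _ (by omega)
    simp [h.r6]
    refine ⟨by omega, by unfold worstCost; omega, fun hg => ?_⟩
    obtain ⟨a1, a2⟩ := h.accurate hg h9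
    refine ⟨a1, a2, b, ?_, ?_⟩
    · have h3 := h.cost hg
      rw [h9] at h3
      have h4 := Nat.mul_le_mul_right (2 ^ b)
        (show s2.t + 1 + 1 + 1 + 1 - s.t ≤ (s2.t - s.t) + 4 by omega)
      rw [Nat.add_mul] at h4
      omega
    · rcases h.phase hg with rfl | h3
      · exact Or.inl hb₀'
      · exact Or.inr h3

end Truss

/-! ### From specifications to runs of the machine -/

namespace Truss

variable {w I : ℕ}

theorem space_le_step (ω : Tape w) (c : Config) : c.space ≤ (step ω c).space := by
  unfold step
  split <;> simp

theorem space_le_run_add (ω : Tape w) (c : Config) (a b : ℕ) :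
    (run ω c a).space ≤ (run ω c (a + b)).space := by
  induction b with
  | zero => exact le_rfl
  | succ b ih =>
    refine ih.trans ?_
    rw [← add_assoc, run_add ω c (a + b) 1]
    exact space_le_step ω _

theorem step_halted (ω : Tape w) {c : Config} (h : Halted c) : step ω c = c := by
  unfold step
  rw [show c.todo = [] from h]

theorem run_halted (ω : Tape w) {c : Config} (h : Halted c) (b : ℕ) : run ω c b = c := by
  induction b with
  | zero => rfl
  | succ b ih =>
    rw [run_add, ih]
    exact step_halted ω h

theorem space_le_of_halted (ω : Tape w) (c : Config) {T : ℕ} (h : Halted (run ω c T)) (τ : ℕ) :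
    (run ω c τ).space ≤ (run ω c T).space := by
  rcases le_total τ T with h1 | h1
  · obtain ⟨b, rfl⟩ := Nat.exists_eq_add_of_le h1
    exact space_le_run_add ω c τ b
  · obtain ⟨b, rfl⟩ := Nat.exists_eq_add_of_le h1
    rw [run_add, run_halted ω h]

/-- The state of a configuration. -/
def St.ofConfig (c : Config) : St := ⟨c.reg, fun j i => c.mem (16 * i + j), c.drawn, 0⟩

theorem memOf_ofConfig (c : Config) : memOf (St.ofConfig c).A = c.mem := by
  funext x
  simp only [memOf, St.ofConfig]
  rw [Nat.div_add_mod]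

theorem runTime_le {ω : Tape w} {c : Config} {T : ℕ} (h : Halted (run ω c T)) :
    runTime ω c ≤ (T : ENNReal) :=
  iInf₂_le T h

/-- What a specification says about the runs. -/
theorem WP.run {ω : Tape w} {P : Prog} {c : Config} {Q : St → Prop}
    (h : WP ω I P (St.ofConfig c) Q) (hP : c.todo = [P]) (hs : c.space ≤ 16 * I)
    (hr : ∀ i, c.reg i < wordBound w) (hm : ∀ x, c.mem x < wordBound w) :
    ∃ s : St, Q s ∧ Halted (run ω c s.t) ∧ (Truss.run ω c s.t).reg = s.r ∧
      ∀ τ, (Truss.run ω c τ).space ≤ 16 * I := by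
  obtain ⟨s, hQ, -, hsim⟩ := h
  have := hsim [] c ⟨hP, rfl, (memOf_ofConfig c).symm, rfl, hs, hr, fun _ _ => hm _⟩
  have e : s.t - (St.ofConfig c).t = s.t := rfl
  rw [e] at this
  exact ⟨s, hQ, this.todo, this.reg, fun τ => (space_le_of_halted ω c this.todo τ).trans this.space⟩

end Truss

namespace Truss

/-! ### Arboricity -/

/-- A forest is given by the parents of its vertices. -/
theorem exists_parent {V : Type*} {F : SimpleGraph V} (hF : F.IsAcyclic) :
    ∃ o : V → V, ∀ u v, F.Adj u v → o u = v ∨ o v = u := by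
  classical
  -- Each tree is rooted at a chosen representative of its component; the parent of `v` is the
  -- vertex before `v` on the path from the root.
  have hr : ∀ v, F.Reachable (F.connectedComponentMk v).out v := fun v =>
    SimpleGraph.ConnectedComponent.exact (Quot.out_eq (F.connectedComponentMk v))
  choose p hp using fun v => (hr v).exists_isPath
  refine ⟨fun v => (p v).penultimate, fun u v huv => ?_⟩
  have hc : F.connectedComponentMk u = F.connectedComponentMk v :=
    SimpleGraph.ConnectedComponent.sound huv.reachable
  -- The roots are kept as variables so that the equality of the components of `u` and `v` can be
  -- substituted.
  have key : ∀ (a b : V) (P : F.Walk a u) (Q : F.Walk b v), a = b → P.IsPath → Q.IsPath →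
      P.penultimate = v ∨ Q.penultimate = u := by
    rintro a _ P Q rfl hP hQ
    by_cases hv : v ∈ P.support
    · exact Or.inl (hF.eq_penultimate_of_adj_end hP huv hv).symm
    · exact Or.inr (hF.eq_penultimate_of_adj_end hQ huv.symm
        (hF.mem_support_of_ne_mem_support_of_adj_of_isPath hQ hP huv.symm hv)).symm
  exact key _ _ (p u) (p v) (by rw [hc]) (hp u) (hp v)

theorem isAcyclic_edge {V : Type*} (u v : V) : (SimpleGraph.edge u v).IsAcyclic := by
  classical
  by_cases h : u = v
  · subst h
    rw [SimpleGraph.edge_self_eq_bot]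
    exact SimpleGraph.isAcyclic_bot
  · have : (⊥ ⊔ SimpleGraph.edge u v).IsAcyclic :=
      SimpleGraph.IsAcyclic.sup_edge_of_not_reachable (by simpa using h) SimpleGraph.isAcyclic_bot
    rwa [bot_sup_eq] at this

variable {V : Type*} [Finite V] (G : SimpleGraph V)

/-- The infimum is attained because the set is nonempty: every edge may form a forest of its own. -/
theorem arboricity_spec : ∃ F : Fin (arboricity G) → SimpleGraph V,
    (∀ i, (F i).IsAcyclic) ∧ (∀ i j, i ≠ j → Disjoint (F i) (F j)) ∧ ⨆ i, F i = G := by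
  classical
  refine Nat.sInf_mem (s := {k | ∃ F : Fin k → SimpleGraph V,
    (∀ i, (F i).IsAcyclic) ∧ (∀ i j, i ≠ j → Disjoint (F i) (F j)) ∧ ⨆ i, F i = G}) ?_
  have := Fintype.ofFinite G.edgeSet
  refine ⟨Fintype.card G.edgeSet, fun i => SimpleGraph.fromEdgeSet
    {((Fintype.equivFin G.edgeSet).symm i : Sym2 V)}, fun i => ?_, fun i j hij => ?_, ?_⟩
  · show (SimpleGraph.fromEdgeSet {((Fintype.equivFin G.edgeSet).symm i : Sym2 V)}).IsAcyclic
    generalize ((Fintype.equivFin G.edgeSet).symm i : Sym2 V) = e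
    induction e with | _ u v => exact isAcyclic_edge u v
  · rw [SimpleGraph.fromEdgeSet_disjoint, Set.disjoint_singleton_left,
      SimpleGraph.edgeSet_fromEdgeSet]
    intro h
    exact hij ((Fintype.equivFin G.edgeSet).symm.injective (Subtype.ext h.1))
  · ext u v
    simp only [SimpleGraph.iSup_adj, SimpleGraph.fromEdgeSet_adj, Set.mem_singleton_iff]
    constructor
    · rintro ⟨i, h, -⟩
      have := ((Fintype.equivFin G.edgeSet).symm i).2
      rwa [← h, SimpleGraph.mem_edgeSet] at this
    · intro h
      exact ⟨Fintype.equivFin G.edgeSet ⟨s(u, v), h⟩, by simp, h.ne⟩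

theorem exists_parents : ∃ o : Fin (arboricity G) → V → V,
    ∀ u v, G.Adj u v → ∃ i, o i u = v ∨ o i v = u := by
  obtain ⟨F, h1, -, h3⟩ := arboricity_spec G
  choose o ho using fun i => exists_parent (h1 i)
  refine ⟨o, fun u v huv => ?_⟩
  rw [← h3, SimpleGraph.iSup_adj] at huv
  obtain ⟨i, hi⟩ := huv
  exact ⟨i, ho i u v hi⟩

theorem kTruss_bddAbove : BddAbove {k | kTruss G k ≠ ⊥} := by
  refine ⟨Nat.card V, fun k hk => ?_⟩
  obtain ⟨u, v, huv⟩ := SimpleGraph.ne_bot_iff_exists_adj.1 hk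
  exact ((kTruss_isGreatest G k).1.2 u v huv).trans
    ((Set.ncard_le_ncard (Set.subset_univ _)).trans (Set.ncard_univ V).le)

theorem trussness_mem (hG : G ≠ ⊥) : kTruss G (trussness G) ≠ ⊥ := by
  refine Nat.sSup_mem (s := {k | kTruss G k ≠ ⊥}) ⟨0, ?_⟩ (kTruss_bddAbove G)
  have : G ≤ kTruss G 0 := (kTruss_isGreatest G 0).2 ⟨le_rfl, fun _ _ _ => Nat.zero_le _⟩
  intro h
  rw [h, le_bot_iff] at this
  exact hG this

theorem le_trussness {H : SimpleGraph V} {k : ℕ} (hH : H ≤ G) (hk : MinSupportGE k H)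
    (hne : H ≠ ⊥) : k ≤ trussness G := by
  refine le_csSup (kTruss_bddAbove G) fun h => hne ?_
  have : H ≤ kTruss G k := (kTruss_isGreatest G k).2 ⟨hH, hk⟩
  rwa [h, le_bot_iff] at this

/-- In the `t`-truss a non-isolated vertex has degree at least `t + 1`: one neighbour `u` and the
`t` common neighbours with `u`. On the other hand, with `S` its non-isolated vertices, a directed
edge is determined by a forest, a direction and its child in `S`, so there are at most `2 α |S|` of
them. -/
theorem trussness_lt_two_mul_arboricity (hG : G ≠ ⊥) : trussness G + 1 ≤ 2 * arboricity G := by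
  classical
  have := Fintype.ofFinite V
  obtain ⟨o, ho⟩ := exists_parents G
  set t := trussness G
  set H := kTruss G t with hH
  have hHG : H ≤ G := (kTruss_isGreatest G t).1.1
  obtain ⟨a, b, hab⟩ := SimpleGraph.ne_bot_iff_exists_adj.1 (trussness_mem G hG)
  set S : Finset V := Finset.univ.filter fun v => ∃ u, H.Adj v u with hS
  set N : V → Finset V := fun v => Finset.univ.filter fun u => H.Adj v u with hN
  have hdeg : ∀ v ∈ S, t + 1 ≤ (N v).card := by
    intro v hv
    obtain ⟨u, hvu⟩ := (Finset.mem_filter.1 hv).2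
    have h1 := (kTruss_isGreatest G t).1.2 v u hvu
    rw [Set.ncard_eq_toFinset_card'] at h1
    have h2 : insert u (H.commonNeighbors v u).toFinset ⊆ N v := by
      intro x hx
      rw [Finset.mem_insert, Set.mem_toFinset] at hx
      refine Finset.mem_filter.2 ⟨Finset.mem_univ _, ?_⟩
      rcases hx with rfl | hx
      · exact hvu
      · exact hx.1
    refine le_trans ?_ (Finset.card_le_card h2)
    rw [Finset.card_insert_of_notMem]
    · exact Nat.add_le_add_right h1 1
    · rw [Set.mem_toFinset]
      exact fun h => H.irrefl h.2
  have h1 : S.card * (t + 1) ≤ (S.sigma N).card := by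
    rw [Finset.card_sigma, ← smul_eq_mul]
    exact Finset.card_nsmul_le_sum _ _ _ hdeg
  have h2 : (S.sigma N).card ≤ S.card * (2 * arboricity G) := by
    have h3 : S.sigma N ⊆ ((Finset.univ : Finset (Fin (arboricity G) × Bool)) ×ˢ S).image
        fun y => if y.1.2 then ⟨y.2, o y.1.1 y.2⟩ else ⟨o y.1.1 y.2, y.2⟩ := by
      rintro ⟨u, v⟩ huv
      rw [Finset.mem_sigma] at huv
      have hadj : H.Adj u v := (Finset.mem_filter.1 huv.2).2
      obtain ⟨i, hi⟩ := ho u v (hHG hadj)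
      rw [Finset.mem_image]
      rcases hi with hi | hi
      · exact ⟨((i, true), u), Finset.mem_product.2 ⟨Finset.mem_univ _, huv.1⟩, by simp [hi]⟩
      · exact ⟨((i, false), v), Finset.mem_product.2 ⟨Finset.mem_univ _,
          Finset.mem_filter.2 ⟨Finset.mem_univ _, u, hadj.symm⟩⟩, by simp [hi]⟩
    refine (Finset.card_le_card h3).trans (Finset.card_image_le.trans ?_)
    rw [Finset.card_product, Finset.card_univ, Fintype.card_prod, Fintype.card_fin,
      Fintype.card_bool]
    exact le_of_eq (by ring)
  have hpos : 0 < S.card :=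
    Finset.card_pos.2 ⟨a, Finset.mem_filter.2 ⟨Finset.mem_univ _, b, hab⟩⟩
  exact Nat.le_of_mul_le_mul_left (h1.trans h2) hpos

end Truss

/-! ### Candidates and the triangles of the graph -/

namespace Truss

namespace Net

variable {G : Net}

theorem IsDart.flip {u v q : ℕ} (h : G.IsDart u v q) : G.IsDart v u (fl q) :=
  ⟨fl_lt h.1, h.2.2, by rw [fl_fl]; exact h.2.1⟩

theorem IsDart.unique {u v q q' : ℕ} (h : G.IsDart u v q) (h' : G.IsDart u v q') : q = q' :=
  G.simple _ h.1 _ h'.1 (h.2.1.trans h'.2.1.symm) (h.2.2.trans h'.2.2.symm)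

theorem IsDart.ne {u v q : ℕ} (h : G.IsDart u v q) : u ≠ v := by
  rintro rfl
  have := h.unique h.flip
  unfold fl at this
  omega

theorem IsDart.left_lt {u v q : ℕ} (h : G.IsDart u v q) : u < G.n := h.2.1 ▸ G.c_lt q h.1

theorem IsDart.right_lt {u v q : ℕ} (h : G.IsDart u v q) : v < G.n := h.flip.left_lt

theorem same_edge {q q' : ℕ} (h : q / 2 = q' / 2) : q = q' ∨ q = fl q' := by
  unfold fl; omega

theorem key_inj {u v : ℕ} (hu : u < G.n) (hv : v < G.n) (h : G.key u = G.key v) : u = v := by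
  unfold key at h
  have h1 := congrArg (· % G.n) h
  simpa [Nat.mod_eq_of_lt hu, Nat.mod_eq_of_lt hv] using h1

theorem deg_le_of_key_lt {u v : ℕ} (hv : v < G.n) (h : G.key u < G.key v) :
    G.deg u ≤ G.deg v := by
  unfold key at h
  by_contra hn
  have : (G.deg v + 1) * G.n ≤ G.deg u * G.n := Nat.mul_le_mul_right _ (by omega)
  rw [Nat.add_mul] at this
  omega

variable (G) in
/-- The lowest vertex of a candidate. -/
noncomputable def lowV (x : ℕ) : ℕ := G.c (fl (G.π (G.hOf x)))

variable (G) in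
/-- The highest vertex of a candidate. -/
noncomputable def topV (x : ℕ) : ℕ := G.c (G.π (G.hOf x))

variable (G) in
/-- The third vertex of a candidate. -/
noncomputable def midV (x : ℕ) : ℕ := G.third (G.hOf x) (x - G.pos (G.hOf x))

variable (G) in
/-- The vertices of a candidate. -/
noncomputable def verts (x : ℕ) : Finset ℕ := {G.lowV x, G.midV x, G.topV x}

theorem hOf_pos_add {h j : ℕ} (hh : h < 2 * G.m) (hj : j < G.len h) :
    G.hOf (G.pos h + j) = h := by
  have := G.pos_succ h
  exact hOf_eq hh (by omega) (by omega)

theorem pos_add_lt {h j : ℕ} (hh : h < 2 * G.m) (hj : j < G.len h) : G.pos h + j < G.W := by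
  have h1 := G.pos_succ h
  have h2 : G.pos (h + 1) ≤ G.W := G.pos_mono hh
  omega

/-- The top and the low vertex determine the dart and hence its position; then the third vertex
determines the dart at the low vertex and hence the offset. -/
theorem cand_inj {x x' : ℕ} (hx : x < G.W) (hx' : x' < G.W) (hu : G.lowV x = G.lowV x')
    (hz : G.midV x = G.midV x') (hv : G.topV x = G.topV x') : x = x' := by
  obtain ⟨h, hh, j, hj, rfl⟩ := exists_pos hx
  obtain ⟨h', hh', j', hj', rfl⟩ := exists_pos hx'
  simp only [lowV, topV, midV, hOf_pos_add hh hj, hOf_pos_add hh' hj', Nat.add_sub_cancel_left]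
    at hu hz hv
  have hp := Truss.perm_spec (c := G.c) G.perm hh
  have hp' := Truss.perm_spec (c := G.c) G.perm hh'
  have hπ : G.π h = G.π h' := G.simple _ hp.1 _ hp'.1 hv hu
  have hhh : h = h' := by rw [← hp.2.1, ← hp'.2.1, hπ]
  subst hhh
  have hd := (low_of_lt_len hj).2
  have hd' := (low_of_lt_len hj').2
  obtain ⟨k1, k2⟩ := G.perm_key (Nat.le_add_right _ _) (Nat.add_lt_add_left hd (G.start _))
  obtain ⟨k1', k2'⟩ := G.perm_key (Nat.le_add_right _ _) (Nat.add_lt_add_left hd' (G.start _))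
  have hg := Truss.perm_spec (c := G.c) G.perm k1
  have hg' := Truss.perm_spec (c := G.c) G.perm k1'
  have hgg := G.simple _ hg.1 _ hg'.1 (k2.trans k2'.symm) hz
  have := hg.2.1
  rw [hgg, hg'.2.1] at this
  omega

theorem tri_spec {x : ℕ} {tr : ℕ × ℕ × ℕ} (h : G.tri x = some tr) :
    x < G.W ∧ G.key (G.lowV x) < G.key (G.midV x) ∧ G.key (G.midV x) < G.key (G.topV x) ∧
      ∃ q₁ q₂ q₃, G.IsDart (G.topV x) (G.lowV x) q₁ ∧ G.IsDart (G.lowV x) (G.midV x) q₂ ∧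
        G.IsDart (G.topV x) (G.midV x) q₃ ∧ tr = (q₁ / 2, q₂ / 2, q₃ / 2) := by
  obtain ⟨h', hh, j, hj, rfl, H, q, hq, htr⟩ := tri_some h
  refine ⟨pos_add_lt hh hj, ?_⟩
  simp only [lowV, topV, midV, hOf_pos_add hh hj, Nat.add_sub_cancel_left]
  obtain ⟨k1, k2⟩ := G.perm_key (Nat.le_add_right _ _)
    (Nat.add_lt_add_left (low_of_lt_len hj).2 (G.start _))
  exact ⟨H.1, H.2.1, G.π h', _, q, ⟨(perm_spec hh).1, rfl, rfl⟩, ⟨(perm_spec k1).1, k2, rfl⟩, hq, htr⟩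

theorem exists_tri {u z v q₁ q₂ q₃ : ℕ} (h1 : G.IsDart v u q₁) (h2 : G.IsDart u z q₂)
    (h3 : G.IsDart v z q₃) (k1 : G.key u < G.key z) (k2 : G.key z < G.key v) :
    ∃ x, G.lowV x = u ∧ G.midV x = z ∧ G.topV x = v ∧ G.tri x = some (q₁ / 2, q₂ / 2, q₃ / 2) := by
  have hh := rho_lt (c := G.c) h1.1
  have hπ := G.perm q₁ h1.1
  set h := rho G.c (2 * G.m) q₁
  have hl := le_rho (c := G.c) (N := 2 * G.m) (q := q₂)
  have hr := rho_lt_end (c := G.c) h2.1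
  rw [h2.2.1] at hl hr
  obtain ⟨j, hj⟩ := Nat.exists_eq_add_of_le hl
  have hπ2 := G.perm q₂ h2.1
  rw [hj] at hπ2 hr
  have hd : j < G.deg u := Nat.lt_of_add_lt_add_left hr
  have hlow : G.Low h := by
    unfold Low
    rw [hπ, h1.2.1, h1.2.2]
    omega
  have hlen : j < G.len h := by
    rw [len, if_pos hlow, hπ, h1.2.2]; exact hd
  have hthird : G.third h j = z := by
    unfold third
    rw [hπ, h1.2.2]
    refine Eq.trans ?_ h2.2.2
    exact congrArg (fun q => G.c (fl q)) hπ2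
  have hgood : G.Good h j := by
    unfold Good
    rw [hthird, hπ, h1.2.1, h1.2.2]
    exact ⟨k1, k2, q₃, h3⟩
  refine ⟨G.pos h + j, ?_, ?_, ?_, ?_⟩
  · rw [lowV, hOf_pos_add hh hlen, hπ, h1.2.2]
  · rw [midV, hOf_pos_add hh hlen, Nat.add_sub_cancel_left, hthird]
  · rw [topV, hOf_pos_add hh hlen, hπ, h1.2.1]
  · rw [tri_eq hh hlen, triAt_eq hgood (q := q₃) (by rw [hthird, hπ, h1.2.1]; exact h3), hπ, h1.2.2]
    congr 4

/-- A set of three vertices has only one increasing order. Together with `cand_inj`, this shows that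
no triangle is counted at two candidates. -/
theorem eq_of_triple_eq (f : ℕ → ℕ) {u z v u' z' v' : ℕ}
    (h : ({u, z, v} : Finset ℕ) = {u', z', v'}) (k1 : f u < f z) (k2 : f z < f v)
    (k1' : f u' < f z') (k2' : f z' < f v') : u = u' ∧ z = z' ∧ v = v' := by
  have a1 : u ∈ ({u', z', v'} : Finset ℕ) := by rw [← h]; simp
  have a2 : z ∈ ({u', z', v'} : Finset ℕ) := by rw [← h]; simp
  have a3 : v ∈ ({u', z', v'} : Finset ℕ) := by rw [← h]; simp
  simp only [Finset.mem_insert, Finset.mem_singleton] at a1 a2 a3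
  rcases a1 with rfl | rfl | rfl <;> rcases a2 with rfl | rfl | rfl <;>
    rcases a3 with rfl | rfl | rfl <;> first | exact ⟨rfl, rfl, rfl⟩ | omega

theorem verts_inj {x x' : ℕ} {tr tr' : ℕ × ℕ × ℕ} (h : G.tri x = some tr) (h' : G.tri x' = some tr')
    (hv : G.verts x = G.verts x') : x = x' := by
  obtain ⟨hx, k1, k2, -⟩ := tri_spec h
  obtain ⟨hx', k1', k2', -⟩ := tri_spec h'
  obtain ⟨e1, e2, e3⟩ := eq_of_triple_eq G.key hv k1 k2 k1' k2'
  exact cand_inj hx hx' e1 e2 e3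

variable (G) in
/-- The graph formed by the edges in `A`. -/
def sub (A : Finset ℕ) : SimpleGraph (Fin G.n) where
  Adj u v := ∃ q, G.IsDart u v q ∧ q / 2 ∈ A
  symm := ⟨fun u v ⟨q, h, hq⟩ => ⟨fl q, h.flip, by rwa [fl_div]⟩⟩
  loopless := ⟨fun v ⟨_, h, _⟩ => h.ne rfl⟩

theorem edge_mem {x a b q : ℕ} {tr : ℕ × ℕ × ℕ} (h : G.tri x = some tr) (ha : a ∈ G.verts x)
    (hb : b ∈ G.verts x) (hq : G.IsDart a b q) : q / 2 ∈ edgesOf tr := by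
  obtain ⟨-, -, -, q₁, q₂, q₃, h1, h2, h3, rfl⟩ := tri_spec h
  simp only [verts, Finset.mem_insert, Finset.mem_singleton] at ha hb
  simp only [edgesOf, Finset.mem_insert, Finset.mem_singleton]
  rcases ha with rfl | rfl | rfl <;> rcases hb with rfl | rfl | rfl
  · exact absurd rfl hq.ne
  · rw [hq.unique h2]; simp
  · rw [← fl_div q, hq.flip.unique h1]; simp
  · rw [← fl_div q, hq.flip.unique h2]; simp
  · exact absurd rfl hq.ne
  · rw [← fl_div q, hq.flip.unique h3]; simp
  · rw [hq.unique h1]; simp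
  · rw [hq.unique h3]; simp
  · exact absurd rfl hq.ne

theorem exists_dart {x a b : ℕ} {tr : ℕ × ℕ × ℕ} (h : G.tri x = some tr) (ha : a ∈ G.verts x)
    (hb : b ∈ G.verts x) (hab : a ≠ b) : ∃ q, G.IsDart a b q := by
  obtain ⟨-, -, -, q₁, q₂, q₃, h1, h2, h3, rfl⟩ := tri_spec h
  simp only [verts, Finset.mem_insert, Finset.mem_singleton] at ha hb
  rcases ha with rfl | rfl | rfl <;> rcases hb with rfl | rfl | rfl
  · exact absurd rfl hab
  · exact ⟨_, h2⟩
  · exact ⟨_, h1.flip⟩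
  · exact ⟨_, h2.flip⟩
  · exact absurd rfl hab
  · exact ⟨_, h3.flip⟩
  · exact ⟨_, h1⟩
  · exact ⟨_, h3⟩
  · exact absurd rfl hab

theorem card_verts {x : ℕ} {tr : ℕ × ℕ × ℕ} (h : G.tri x = some tr) : (G.verts x).card = 3 := by
  obtain ⟨-, k1, k2, -⟩ := tri_spec h
  rw [verts, Finset.card_eq_three]
  refine ⟨_, _, _, ?_, ?_, ?_, rfl⟩ <;>
    exact fun h => by have := congrArg G.key h; omega

/-- Three mutually adjacent vertices form a triangle. -/
theorem exists_verts {a b c q₁ q₂ q₃ : ℕ} (h1 : G.IsDart a b q₁) (h2 : G.IsDart b c q₂)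
    (h3 : G.IsDart a c q₃) :
    ∃ x tr, G.tri x = some tr ∧ G.verts x = {a, b, c} ∧
      edgesOf tr = {q₁ / 2, q₂ / 2, q₃ / 2} := by
  have sorted : ∀ {u z v p₁ p₂ p₃ : ℕ}, G.IsDart v u p₁ → G.IsDart u z p₂ → G.IsDart v z p₃ →
      G.key u < G.key z → G.key z < G.key v → ∃ x tr, G.tri x = some tr ∧ G.verts x = {u, z, v} ∧
        edgesOf tr = {p₁ / 2, p₂ / 2, p₃ / 2} := by
    intro u z v p₁ p₂ p₃ d1 d2 d3 k1 k2
    obtain ⟨x, e1, e2, e3, e4⟩ := exists_tri d1 d2 d3 k1 k2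
    exact ⟨x, _, e4, by rw [verts, e1, e2, e3], rfl⟩
  have n1 : G.key a ≠ G.key b := fun h => h1.ne (key_inj h1.left_lt h1.right_lt h)
  have n2 : G.key b ≠ G.key c := fun h => h2.ne (key_inj h2.left_lt h2.right_lt h)
  have n3 : G.key a ≠ G.key c := fun h => h3.ne (key_inj h3.left_lt h3.right_lt h)
  rcases Nat.lt_or_gt_of_ne n1 with l1 | l1 <;> rcases Nat.lt_or_gt_of_ne n2 with l2 | l2 <;>
    rcases Nat.lt_or_gt_of_ne n3 with l3 | l3
  · obtain ⟨x, tr, e1, e2, e3⟩ := sorted h3.flip h1 h2.flip l1 l2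
    exact ⟨x, tr, e1, e2, by rw [e3, fl_div, fl_div]; ext; simp; tauto⟩
  · omega
  · obtain ⟨x, tr, e1, e2, e3⟩ := sorted h1.flip h3 h2 l3 l2
    exact ⟨x, tr, e1, by rw [e2]; ext; simp; tauto, by rw [e3, fl_div]; ext; simp; tauto⟩
  · obtain ⟨x, tr, e1, e2, e3⟩ := sorted h2 h3.flip h1.flip l3 l1
    exact ⟨x, tr, e1, by rw [e2]; ext; simp; tauto, by rw [e3, fl_div, fl_div]; ext; simp; tauto⟩
  · obtain ⟨x, tr, e1, e2, e3⟩ := sorted h2.flip h1.flip h3.flip l1 l3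
    exact ⟨x, tr, e1, by rw [e2]; ext; simp; tauto, by rw [e3, fl_div, fl_div, fl_div]; ext; simp; tauto⟩
  · obtain ⟨x, tr, e1, e2, e3⟩ := sorted h1 h2 h3 l2 l3
    exact ⟨x, tr, e1, by rw [e2]; ext; simp; tauto, by rw [e3]⟩
  · omega
  · obtain ⟨x, tr, e1, e2, e3⟩ := sorted h3 h2.flip h1 l2 l1
    exact ⟨x, tr, e1, by rw [e2]; ext; simp; tauto, by rw [e3, fl_div]; ext; simp; tauto⟩

/-- The triangles at an edge correspond to the common neighbours of its ends. -/
theorem card_inc (A : Finset ℕ) {u v : Fin G.n} {q : ℕ} (hq : G.IsDart u v q) (hA : q / 2 ∈ A) :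
    (G.inc A (q / 2)).card = ((G.sub A).commonNeighbors u v).ncard := by
  classical
  rw [Set.ncard_eq_toFinset_card']
  -- Both inequalities use the relation `verts x = {u, v, y}` between candidates and common
  -- neighbours: every element of either side has a partner, and each partner belongs to at most one
  -- element.
  refine le_antisymm
    (Finset.card_le_card_of_forall_subsingleton
      (fun (x : ℕ) (y : Fin G.n) => G.verts x = {(u : ℕ), (v : ℕ), (y : ℕ)}) ?_ ?_)
    (Finset.card_le_card_of_forall_subsingleton
      (fun (y : Fin G.n) (x : ℕ) => G.verts x = {(u : ℕ), (v : ℕ), (y : ℕ)}) ?_ ?_)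
  · intro x hx
    obtain ⟨-, tr, h1, h2, h3⟩ := Finset.mem_filter.1 hx
    have huv : (u : ℕ) ∈ G.verts x ∧ (v : ℕ) ∈ G.verts x := by
      obtain ⟨-, -, -, q₁, q₂, q₃, d1, d2, d3, rfl⟩ := tri_spec h1
      have key : ∀ {a b q' : ℕ}, G.IsDart a b q' → a ∈ G.verts x → b ∈ G.verts x →
          q / 2 = q' / 2 → (u : ℕ) ∈ G.verts x ∧ (v : ℕ) ∈ G.verts x := by
        intro a b q' d ha hb he
        rcases same_edge he with rfl | rfl
        · rw [← hq.2.1, ← hq.2.2, d.2.1, d.2.2]; exact ⟨ha, hb⟩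
        · rw [← hq.2.1, ← hq.2.2, d.flip.2.1, d.flip.2.2]; exact ⟨hb, ha⟩
      simp only [edgesOf, Finset.mem_insert, Finset.mem_singleton] at h2
      rcases h2 with h2 | h2 | h2
      · exact key d1 (by simp [verts]) (by simp [verts]) h2
      · exact key d2 (by simp [verts]) (by simp [verts]) h2
      · exact key d3 (by simp [verts]) (by simp [verts]) h2
    obtain ⟨y, hy⟩ : ∃ y, ((G.verts x).erase u).erase v = {y} := by
      rw [← Finset.card_eq_one, Finset.card_erase_of_mem (Finset.mem_erase.2 ⟨hq.ne.symm, huv.2⟩),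
        Finset.card_erase_of_mem huv.1, card_verts h1]
    have hyv : y ∈ ((G.verts x).erase u).erase v := by rw [hy]; simp
    rw [Finset.mem_erase, Finset.mem_erase] at hyv
    obtain ⟨hyv, hyu, hyx⟩ := hyv
    obtain ⟨q₁, d1⟩ := exists_dart h1 huv.1 hyx (Ne.symm hyu)
    obtain ⟨q₂, d2⟩ := exists_dart h1 huv.2 hyx (Ne.symm hyv)
    refine ⟨⟨y, d1.right_lt⟩, ?_, ?_⟩
    · rw [Set.mem_toFinset]
      exact ⟨⟨q₁, d1, h3 (edge_mem h1 huv.1 hyx d1)⟩, ⟨q₂, d2, h3 (edge_mem h1 huv.2 hyx d2)⟩⟩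
    · rw [← Finset.insert_erase huv.1, ← Finset.insert_erase
        (Finset.mem_erase.2 ⟨hq.ne.symm, huv.2⟩), hy]
  · rintro y - x ⟨hx, h1⟩ x' ⟨hx', h2⟩
    obtain ⟨-, tr, h3, -⟩ := Finset.mem_filter.1 hx
    obtain ⟨-, tr', h4, -⟩ := Finset.mem_filter.1 hx'
    exact verts_inj h3 h4 (h1.trans h2.symm)
  · intro y hy
    rw [Set.mem_toFinset] at hy
    obtain ⟨⟨q₁, d1, m1⟩, ⟨q₂, d2, m2⟩⟩ := hy
    obtain ⟨x, tr, e1, e2, e3⟩ := exists_verts hq d2 d1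
    refine ⟨x, Finset.mem_filter.2 ⟨Finset.mem_range.2 (tri_spec e1).1, tr, e1, ?_, ?_⟩, e2⟩
    · rw [e3]; simp
    · rw [e3]
      intro e he
      simp only [Finset.mem_insert, Finset.mem_singleton] at he
      rcases he with rfl | rfl | rfl
      · exact hA
      · exact m2
      · exact m1
  · rintro x - y ⟨hy, h1⟩ y' ⟨hy', h2⟩
    rw [Set.mem_toFinset] at hy hy'
    have h3 : (y : ℕ) ∈ ({(u : ℕ), (v : ℕ), (y' : ℕ)} : Finset ℕ) := by
      rw [← h2, h1]; simp
    simp only [Finset.mem_insert, Finset.mem_singleton] at h3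
    obtain ⟨⟨_, d1, -⟩, ⟨_, d2, -⟩⟩ := hy
    rcases h3 with h3 | h3 | h3
    · exact absurd h3.symm d1.ne
    · exact absurd h3.symm d2.ne
    · exact Fin.ext h3

end Net

end Truss

/-! ### Bounds on the candidates, trussness as core number, and the triangle count -/

namespace Truss

namespace Net

variable {G : Net}

variable (G) in
/-- The net describes the graph `H`. -/
def Of (H : SimpleGraph (Fin G.n)) : Prop :=
  ∀ u v : Fin G.n, H.Adj u v ↔ ∃ q, G.IsDart u v q

theorem isDart_self {q : ℕ} (hq : q < 2 * G.m) : G.IsDart (G.c q) (G.c (fl q)) q := ⟨hq, rfl, rfl⟩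

theorem sum_deg_le : ∑ v ∈ Finset.range G.n, G.deg v ≤ 2 * G.m := by
  have : ∀ n, ∑ v ∈ Finset.range n, G.deg v = cLt G.c (2 * G.m) n := by
    intro n
    induction n with
    | zero => rw [cLt_zero_right]; rfl
    | succ n ih => rw [Finset.sum_range_succ, ih, cLt_succ_right]; rfl
  rw [this]
  exact cLt_le _ _ _

theorem deg_pos {q : ℕ} (hq : q < 2 * G.m) : 0 < G.deg (G.c q) :=
  lt_of_le_of_lt (Nat.zero_le _) (cEq_lt (c := G.c) hq)

theorem W_le_sq : G.W ≤ 4 * G.m * G.m := by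
  have : ∀ h ∈ Finset.range (2 * G.m), G.len h ≤ 2 * G.m := by
    intro h _
    unfold len
    split_ifs
    · exact cEq_le _ _ _
    · exact Nat.zero_le _
  refine (Finset.sum_le_card_nsmul _ _ _ this).trans (le_of_eq ?_)
  rw [Finset.card_range, smul_eq_mul]; ring

theorem rho_π {h : ℕ} (hh : h < 2 * G.m) : rho G.c (2 * G.m) (G.π h) = h :=
  (Truss.perm_spec (c := G.c) G.perm hh).2.1

/-- One of the two darts of each edge starts at the greater end, and it contributes the positive
degree of the other end. -/
theorem m_le_W : G.m ≤ G.W := by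
  classical
  have H : ∀ i < G.m, ∃ q < 2 * G.m, q / 2 = i ∧ G.key (G.c (fl q)) < G.key (G.c q) := by
    intro i hi
    have hd := isDart_self (G := G) (q := 2 * i) (by omega)
    have hne : G.key (G.c (2 * i)) ≠ G.key (G.c (fl (2 * i))) :=
      fun h => hd.ne (key_inj hd.left_lt hd.right_lt h)
    rcases Nat.lt_or_gt_of_ne hne with h | h
    · exact ⟨fl (2 * i), hd.flip.1, by unfold fl; omega, by rwa [fl_fl]⟩
    · exact ⟨2 * i, hd.1, by omega, h⟩
  choose! f hf1 hf2 hf3 using H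
  have h1 : G.m ≤ ((Finset.range (2 * G.m)).filter fun h => 1 ≤ G.len h).card := by
    rw [← Finset.card_range G.m]
    refine Finset.card_le_card_of_injOn (fun i => rho G.c (2 * G.m) (f i)) ?_ ?_
    · intro i hi
      have hi' := Finset.mem_range.1 (Finset.mem_coe.1 hi)
      have hπ := G.perm _ (hf1 i hi')
      refine Finset.mem_coe.2 (Finset.mem_filter.2
        ⟨Finset.mem_range.2 (by rw [Finset.card_range]; exact rho_lt (hf1 i hi')), ?_⟩)
      simp only [Finset.card_range]
      rw [len, if_pos, hπ]
      · exact deg_pos (fl_lt (hf1 i hi'))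
      · unfold Low; rw [hπ]; exact hf3 i hi'
    · intro i hi j hj hij
      have hi' := Finset.mem_range.1 (Finset.mem_coe.1 hi)
      have hj' := Finset.mem_range.1 (Finset.mem_coe.1 hj)
      simp only [Finset.card_range] at hij
      rw [← hf2 i hi', ← hf2 j hj', rho_inj (c := G.c) (hf1 i hi') (hf1 j hj') hij]
  refine h1.trans ?_
  rw [Finset.card_filter]
  refine Finset.sum_le_sum fun h _ => ?_
  split_ifs with h2
  · exact h2
  · exact Nat.zero_le _

variable {H : SimpleGraph (Fin G.n)}

theorem n_le (hH : G.Of H) (hiso : ∀ v, ∃ u, H.Adj v u) : G.n ≤ 2 * G.m := by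
  have h1 := Finset.card_le_card_of_surjOn (s := Finset.range (2 * G.m)) (t := Finset.range G.n) G.c
    (by
      intro v hv
      have hv' := Finset.mem_range.1 (Finset.mem_coe.1 hv)
      obtain ⟨u, hu⟩ := hiso ⟨v, hv'⟩
      obtain ⟨q, hq⟩ := (hH _ _).1 hu
      exact ⟨q, by simpa using hq.1, hq.2.1⟩)
  simpa using h1

/-- An edge contributes the degree of its lower end, hence at most the degree of its child in a
forest containing it. Each pair of a forest and a child is used by one edge only, so the sum is at
most `α` times the sum of all degrees. -/
theorem W_le_arboricity (hH : G.Of H) : G.W ≤ 2 * G.m * arboricity H := by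
  classical
  obtain ⟨o, ho⟩ := exists_parents H
  set S := (Finset.range (2 * G.m)).filter fun h => G.Low h with hS
  have key : ∀ h ∈ S, ∃ p : Fin (arboricity H) × Fin G.n, G.len h ≤ G.deg p.2 ∧
      ((G.c (G.π h) = p.2 ∧ G.c (fl (G.π h)) = o p.1 p.2) ∨
        (G.c (G.π h) = o p.1 p.2 ∧ G.c (fl (G.π h)) = p.2)) := by
    intro h hh
    obtain ⟨hh, hl⟩ := Finset.mem_filter.1 hh
    have hd := isDart_self (perm_spec (Finset.mem_range.1 hh)).1
    have hlen : G.len h = G.deg (G.c (fl (G.π h))) := by rw [len, if_pos hl]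
    obtain ⟨i, hi⟩ := ho ⟨_, hd.left_lt⟩ ⟨_, hd.right_lt⟩ ((hH _ _).2 ⟨_, hd⟩)
    rcases hi with hi | hi
    · refine ⟨(i, ⟨_, hd.left_lt⟩), ?_, Or.inl ⟨rfl, by rw [hi]⟩⟩
      rw [hlen]
      exact deg_le_of_key_lt hd.left_lt hl
    · exact ⟨(i, ⟨_, hd.right_lt⟩), hlen.le, Or.inr ⟨by rw [hi], rfl⟩⟩
  have hW : G.W = ∑ h ∈ S, G.len h := by
    rw [hS, Finset.sum_filter, W, pos]
    exact Finset.sum_congr rfl fun h _ => by unfold len; split_ifs <;> rfl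
  rcases S.eq_empty_or_nonempty with h0 | ⟨h₀, hh₀⟩
  · rw [hW, h0]; exact Nat.zero_le _
  have : Nonempty (Fin (arboricity H) × Fin G.n) := ⟨(key h₀ hh₀).choose⟩
  choose! f hf1 hf2 using key
  have hinj : Set.InjOn f (S : Set ℕ) := by
    intro h hh h' hh' he
    have hm := (Finset.mem_filter.1 (Finset.mem_coe.1 hh))
    have hm' := (Finset.mem_filter.1 (Finset.mem_coe.1 hh'))
    have hl : G.key (G.c (fl (G.π h))) < G.key (G.c (G.π h)) := hm.2
    have hl' : G.key (G.c (fl (G.π h'))) < G.key (G.c (G.π h')) := hm'.2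
    have e1 := hf2 h hh
    have e2 := hf2 h' hh'
    rw [he] at e1
    have hq := (perm_spec (Finset.mem_range.1 hm.1)).1
    have hq' := (perm_spec (Finset.mem_range.1 hm'.1)).1
    have : G.c (G.π h) = G.c (G.π h') ∧ G.c (fl (G.π h)) = G.c (fl (G.π h')) := by
      rcases e1 with ⟨a1, a2⟩ | ⟨a1, a2⟩ <;> rcases e2 with ⟨b1, b2⟩ | ⟨b1, b2⟩
      · exact ⟨a1.trans b1.symm, a2.trans b2.symm⟩
      · rw [a1, a2] at hl; rw [b1, b2] at hl'; omega
      · rw [a1, a2] at hl; rw [b1, b2] at hl'; omega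
      · exact ⟨a1.trans b1.symm, a2.trans b2.symm⟩
    rw [← rho_π (Finset.mem_range.1 hm.1), ← rho_π (Finset.mem_range.1 hm'.1),
      G.simple _ hq _ hq' this.1 this.2]
  calc G.W = ∑ h ∈ S, G.len h := hW
    _ ≤ ∑ h ∈ S, G.deg (f h).2 := Finset.sum_le_sum hf1
    _ = ∑ p ∈ S.image f, G.deg p.2 := (Finset.sum_image (f := fun p => G.deg p.2) hinj).symm
    _ ≤ ∑ p : Fin (arboricity H) × Fin G.n, G.deg p.2 :=
        Finset.sum_le_sum_of_subset (Finset.subset_univ _)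
    _ = arboricity H * ∑ v ∈ Finset.range G.n, G.deg v := by
        rw [Fintype.sum_prod_type, Finset.sum_range]
        simp
    _ ≤ arboricity H * (2 * G.m) := Nat.mul_le_mul_left _ sum_deg_le
    _ = _ := mul_comm _ _

theorem sub_le (hH : G.Of H) (A : Finset ℕ) : G.sub A ≤ H :=
  fun u v ⟨q, hq, _⟩ => (hH u v).2 ⟨q, hq⟩

theorem exists_sub_adj {A : Finset ℕ} {e : ℕ} (he : e ∈ A) (hm : e < G.m) :
    ∃ u v : Fin G.n, ∃ q, G.IsDart u v q ∧ q / 2 = e := by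
  have hd := isDart_self (G := G) (q := 2 * e) (by omega)
  exact ⟨⟨_, hd.left_lt⟩, ⟨_, hd.right_lt⟩, 2 * e, hd, by omega⟩

/-- The trussness of the graph is the core number of the hypergraph of its triangles. -/
theorem exists_truss (hH : G.Of H) (hne : H ≠ ⊥) : ∃ ch R, G.Truss (trussness H) ch R := by
  classical
  -- If every edge of `A` lay in more than `t` triangles within `A`, the graph on `A` would witness
  -- trussness at least `t + 1`.
  obtain ⟨ch, hch⟩ := exists_charge (G := G) (t := trussness H) fun A hA hlt => by
    by_contra hn
    push Not at hn
    obtain ⟨e, he⟩ := hA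
    have h1 : trussness H + 1 ≤ trussness H := by
      refine le_trussness H (sub_le hH A) ?_ ?_
      · rintro u v ⟨q, hq, hA⟩
        rw [← card_inc A hq hA]
        exact hn _ hA
      · obtain ⟨u, v, q, hq, rfl⟩ := exists_sub_adj he (hlt e he)
        exact SimpleGraph.ne_bot_iff_exists_adj.2 ⟨u, v, q, hq, he⟩
    omega
  -- The set `R` is the edge set of the `t`-truss, written as edge numbers.
  set K := kTruss H (trussness H) with hK
  have hKH : K ≤ H := (kTruss_isGreatest H _).1.1
  set R := (Finset.range G.m).filter fun i => ∃ u v : Fin G.n, K.Adj u v ∧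
    ∃ q, G.IsDart u v q ∧ q / 2 = i with hR
  have hsub : G.sub R = K := by
    ext u v
    constructor
    · rintro ⟨q, hq, hm⟩
      obtain ⟨-, u', v', hadj, q', hq', he⟩ := Finset.mem_filter.1 hm
      rcases same_edge he with rfl | rfl
      · have e1 : u' = u := Fin.ext (hq'.2.1.symm.trans hq.2.1)
        have e2 : v' = v := Fin.ext (hq'.2.2.symm.trans hq.2.2)
        rwa [← e1, ← e2]
      · have e1 : u' = v := Fin.ext (hq'.2.1.symm.trans hq.flip.2.1)
        have e2 : v' = u := Fin.ext (hq'.2.2.symm.trans hq.flip.2.2)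
        rw [← e1, ← e2]
        exact hadj.symm
    · intro hadj
      obtain ⟨q, hq⟩ := (hH u v).1 (hKH hadj)
      refine ⟨q, hq, Finset.mem_filter.2 ⟨Finset.mem_range.2 ?_, u, v, hadj, q, hq, rfl⟩⟩
      have := hq.1
      omega
  refine ⟨ch, R, hch, ?_, fun e he => Finset.mem_range.1 (Finset.mem_filter.1 he).1, ?_⟩
  · obtain ⟨u, v, huv⟩ := SimpleGraph.ne_bot_iff_exists_adj.1 (trussness_mem H hne)
    rw [← hK, ← hsub] at huv
    obtain ⟨q, -, hq⟩ := huv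
    exact ⟨_, hq⟩
  · intro e he
    obtain ⟨-, u, v, hadj, q, hq, rfl⟩ := Finset.mem_filter.1 he
    rw [card_inc R hq he, hsub]
    exact (kTruss_isGreatest H _).1.2 u v hadj

open Classical in
variable (G) in
/-- The candidates that are triangles. -/
noncomputable def triangles : Finset ℕ := (Finset.range G.W).filter fun x => (G.tri x).isSome

theorem card_triangles_le_W : G.triangles.card ≤ G.W :=
  (Finset.card_filter_le _ _).trans (Finset.card_range _).le

/-- Every triangle is charged to one of its edges, and no edge receives more than `t`. -/
theorem card_triangles_le {t : ℕ} {ch : ℕ → Finset ℕ} (hch : G.Charge t ch) :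
    G.triangles.card ≤ G.m * t := by
  classical
  have h1 : G.triangles ⊆ (Finset.range G.m).biUnion ch := by
    intro x hx
    obtain ⟨hxW, hs⟩ := Finset.mem_filter.1 hx
    obtain ⟨tr, htr⟩ := Option.isSome_iff_exists.1 hs
    obtain ⟨e, he, hsub⟩ := hch.spec (edgesOf tr) ⟨tr.1, by simp [edgesOf]⟩ fun e he => tri_lt htr he
    exact Finset.mem_biUnion.2 ⟨e, Finset.mem_range.2 (tri_lt htr he),
      hsub (Finset.mem_filter.2 ⟨hxW, tr, htr, he, subset_rfl⟩)⟩
  refine (Finset.card_le_card h1).trans (Finset.card_biUnion_le.trans ?_)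
  refine (Finset.sum_le_card_nsmul _ _ _ fun e _ => hch.card_le e).trans (le_of_eq ?_)
  rw [Finset.card_range, smul_eq_mul]

theorem numTriangles_le (hH : G.Of H) : numTriangles H ≤ G.triangles.card := by
  classical
  rw [numTriangles, Set.ncard_eq_toFinset_card']
  refine Finset.card_le_card_of_forall_subsingleton
    (fun (s : Finset (Fin G.n)) (x : ℕ) => G.verts x = s.image (fun v : Fin G.n => (v : ℕ))) ?_ ?_
  · intro s hs
    rw [Set.mem_toFinset, SimpleGraph.mem_cliqueSet_iff, SimpleGraph.is3Clique_iff] at hs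
    obtain ⟨a, b, c, h1, h2, h3, rfl⟩ := hs
    obtain ⟨q₁, d1⟩ := (hH _ _).1 h1
    obtain ⟨q₂, d2⟩ := (hH _ _).1 h2
    obtain ⟨q₃, d3⟩ := (hH _ _).1 h3
    obtain ⟨x, tr, e1, e2, -⟩ := exists_verts d1 d3 d2
    refine ⟨x, Finset.mem_filter.2 ⟨Finset.mem_range.2 (tri_spec e1).1, by simp [e1]⟩, ?_⟩
    rw [e2]; simp
  · rintro x - s ⟨-, h1⟩ s' ⟨-, h2⟩
    exact Finset.image_injective Fin.val_injective (h1.symm.trans h2)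

end Net

end Truss

namespace Truss

/-! ### Large deviations -/

open ProbabilityTheory

variable {w b D : ℕ} {S : Finset ℕ}

instance : IsProbabilityMeasure (tapeMeasure w) := by
  unfold tapeMeasure; infer_instance

/-- Since `2 ^ b` divides `2 ^ w`, the residue of a uniform word is exactly uniform. This is why
block lengths are powers of two. -/
theorem card_residue (hb : b ≤ w) {r : ℕ} (hr : r < 2 ^ b) :
    (Finset.univ.filter fun y : Fin (2 ^ w) => (y : ℕ) % 2 ^ b = r).card =
      2 ^ (w - b) := by
  have hpow : 2 ^ w = 2 ^ b * 2 ^ (w - b) := by rw [← pow_add, Nat.add_sub_cancel' hb]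
  rw [← Finset.card_range (2 ^ (w - b))]
  symm
  have hlt : ∀ q < 2 ^ (w - b), 2 ^ b * q + r < 2 ^ w := by
    intro q hq
    rw [hpow]
    calc 2 ^ b * q + r < 2 ^ b * q + 2 ^ b := by omega
      _ = 2 ^ b * (q + 1) := by ring
      _ ≤ _ := Nat.mul_le_mul_left _ hq
  refine Finset.card_bij (fun q hq => ⟨2 ^ b * q + r, hlt q (Finset.mem_range.1 hq)⟩) ?_ ?_ ?_
  · intro q hq
    simp [Nat.mod_eq_of_lt hr, Nat.add_comm (2 ^ b * q) r, Nat.add_mul_mod_self_left]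
  · intro q hq q' hq' h
    have := congrArg Fin.val h
    simpa using this
  · intro y hy
    have hy' := (Finset.mem_filter.1 hy).2
    refine ⟨(y : ℕ) / 2 ^ b, Finset.mem_range.2 ?_, Fin.ext ?_⟩
    · rw [Nat.div_lt_iff_lt_mul (by positivity), mul_comm, ← hpow]
      exact y.2
    · simp only
      rw [← hy']
      exact Nat.div_add_mod _ _

variable (D b S) in
/-- The candidates in `S` that are selected by the word `y` with number `i`. -/
def hits (i : ℕ) (y : Fin (2 ^ w)) : Finset ℕ :=
  S.filter fun x => D + x / 2 ^ b = i ∧ x % 2 ^ b = y % 2 ^ b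

theorem card_hits_le (i : ℕ) (y : Fin (2 ^ w)) : (hits b D S i y).card ≤ 1 := by
  rw [Finset.card_le_one]
  intro x hx x' hx'
  obtain ⟨-, h1, h2⟩ := Finset.mem_filter.1 hx
  obtain ⟨-, h1', h2'⟩ := Finset.mem_filter.1 hx'
  rw [← Nat.div_add_mod x (2 ^ b), ← Nat.div_add_mod x' (2 ^ b), h2, h2',
    show x / 2 ^ b = x' / 2 ^ b by omega]

theorem sel_eq_sum (ω : Tape w) {N : ℕ} (hN : ∀ x ∈ S, D + x / 2 ^ b < N) :
    Net.sel ω (2 ^ b) D S = ∑ i ∈ Finset.range N, (hits b D S i (ω i)).card := by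
  classical
  rw [Net.sel, Finset.card_eq_sum_card_fiberwise (f := fun x => D + x / 2 ^ b)
    (t := Finset.range N)]
  · refine Finset.sum_congr rfl fun i _ => ?_
    congr 1
    ext x
    simp only [hits, Finset.mem_filter]
    constructor
    · rintro ⟨⟨h1, h2⟩, rfl⟩; exact ⟨h1, rfl, h2⟩
    · rintro ⟨h1, rfl, h2⟩; exact ⟨⟨h1, h2⟩, rfl⟩
  · intro x hx
    have := (Finset.mem_filter.1 (Finset.mem_coe.1 hx)).1
    exact Finset.mem_coe.2 (Finset.mem_range.2 (hN x this))

theorem sum_card_hits (hb : b ≤ w) (i : ℕ) :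
    ∑ y : Fin (2 ^ w), (hits b D S i y).card =
      (S.filter fun x => D + x / 2 ^ b = i).card * 2 ^ (w - b) := by
  classical
  simp only [hits, Finset.card_filter]
  rw [Finset.sum_comm, Finset.sum_mul]
  refine Finset.sum_congr rfl fun x _ => ?_
  by_cases h : D + x / 2 ^ b = i
  · simp only [h, true_and, if_true, one_mul]
    rw [← Finset.card_filter, ← card_residue hb (Nat.mod_lt x (show 0 < 2 ^ b by positivity))]
    simp only [eq_comm]
  · simp [h]

/-- The variable takes only the values `0` and `1`, so its exponential is affine in it; then `1 + x
≤ exp x`. -/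
theorem mgf_hits_le (hb : b ≤ w) (i : ℕ) (θ : ℝ) :
    mgf (fun ω : Tape w => ((hits b D S i (ω i)).card : ℝ)) (tapeMeasure w) θ ≤
      Real.exp ((Real.exp θ - 1) * ((S.filter fun x => D + x / 2 ^ b = i).card / 2 ^ b)) := by
  have h1 : mgf (fun ω : Tape w => ((hits b D S i (ω i)).card : ℝ)) (tapeMeasure w) θ =
      ∫ y, Real.exp (θ * (hits b D S i y).card)
        ∂(PMF.uniformOfFintype (Fin (2 ^ w))).toMeasure := by
    rw [mgf, ← Measure.infinitePi_map_eval
      (μ := fun _ : ℕ => (PMF.uniformOfFintype (Fin (2 ^ w))).toMeasure) i,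
      integral_map (measurable_pi_apply i).aemeasurable
        Measurable.of_discrete.aestronglyMeasurable]
    rfl
  rw [h1, PMF.integral_eq_sum]
  have h2 : ∀ y : Fin (2 ^ w), Real.exp (θ * (hits b D S i y).card) =
      1 + (Real.exp θ - 1) * (hits b D S i y).card := by
    intro y
    have := card_hits_le (b := b) (D := D) (S := S) i y
    interval_cases (hits b D S i y).card <;> simp
  have h3 : (2 : ℝ) ^ w = 2 ^ b * 2 ^ (w - b) := by rw [← pow_add, Nat.add_sub_cancel' hb]
  have h4 : (∑ y : Fin (2 ^ w), ((hits b D S i y).card : ℝ)) =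
      (S.filter fun x => D + x / 2 ^ b = i).card * 2 ^ (w - b) := by
    exact_mod_cast sum_card_hits (D := D) (S := S) hb i
  simp only [h2, PMF.uniformOfFintype_apply, Fintype.card_fin, smul_eq_mul]
  rw [← Finset.mul_sum, Finset.sum_add_distrib, ← Finset.mul_sum, h4]
  refine le_trans (le_of_eq ?_) (Real.add_one_le_exp _)
  simp
  rw [h3]
  field_simp
  ring

theorem measurable_hits (i : ℕ) :
    Measurable fun ω : Tape w => ((hits b D S i (ω i)).card : ℝ) :=
  (Measurable.of_discrete (f := fun y : Fin (2 ^ w) => ((hits b D S i y).card : ℝ))).comp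
    (measurable_pi_apply i)

theorem sel_eq_sum' : ∃ N : ℕ, (∀ x ∈ S, D + x / 2 ^ b < N) ∧
    (fun ω : Tape w => (Net.sel ω (2 ^ b) D S : ℝ)) =
      ∑ i ∈ Finset.range N, fun ω : Tape w => ((hits b D S i (ω i)).card : ℝ) := by
  refine ⟨D + S.sup id + 1, fun x hx => ?_, ?_⟩
  · have h1 : x ≤ S.sup id := Finset.le_sup (f := id) hx
    have h2 := Nat.div_le_self x (2 ^ b)
    omega
  · funext ω
    rw [Finset.sum_apply, sel_eq_sum (N := D + S.sup id + 1)]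
    · push_cast; rfl
    · intro x hx
      have h1 : x ≤ S.sup id := Finset.le_sup (f := id) hx
      have h2 := Nat.div_le_self x (2 ^ b)
      omega

/-- Different blocks use different words of the tape, so the count is a sum of independent
indicators and the expectations add up to `|S| / 2 ^ b`. -/
theorem mgf_sel_le (hb : b ≤ w) (θ : ℝ) :
    mgf (fun ω : Tape w => (Net.sel ω (2 ^ b) D S : ℝ)) (tapeMeasure w) θ ≤
      Real.exp ((Real.exp θ - 1) * (S.card / 2 ^ b)) := by
  classical
  obtain ⟨N, hN, h⟩ := sel_eq_sum' (w := w) (b := b) (D := D) (S := S)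
  have hind : iIndepFun (fun (i : ℕ) (ω : Tape w) => ((hits b D S i (ω i)).card : ℝ))
      (tapeMeasure w) :=
    iIndepFun_infinitePi (P := fun _ : ℕ => (PMF.uniformOfFintype (Fin (2 ^ w))).toMeasure)
      (X := fun i y => ((hits b D S i y).card : ℝ)) fun i => Measurable.of_discrete
  rw [h, hind.mgf_sum measurable_hits]
  refine (Finset.prod_le_prod (fun _ _ => mgf_nonneg) fun i _ => mgf_hits_le hb i θ).trans ?_
  rw [← Real.exp_sum, ← Finset.mul_sum, ← Finset.sum_div]
  have : S.card = ∑ i ∈ Finset.range N, (S.filter fun x => D + x / 2 ^ b = i).card :=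
    Finset.card_eq_sum_card_fiberwise fun x hx =>
      Finset.mem_coe.2 (Finset.mem_range.2 (hN x hx))
  rw [this]
  push_cast
  exact le_rfl

theorem integrable_sel (θ : ℝ) :
    Integrable (fun ω : Tape w => Real.exp (θ * (Net.sel ω (2 ^ b) D S : ℝ))) (tapeMeasure w) := by
  obtain ⟨N, -, h⟩ := sel_eq_sum' (w := w) (b := b) (D := D) (S := S)
  have hm : Measurable fun ω : Tape w => (Net.sel ω (2 ^ b) D S : ℝ) := by
    rw [h]
    have : (∑ i ∈ Finset.range N, fun ω : Tape w => ((hits b D S i (ω i)).card : ℝ)) =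
        fun ω => ∑ i ∈ Finset.range N, ((hits b D S i (ω i)).card : ℝ) := by
      funext ω; rw [Finset.sum_apply]
    rw [this]
    exact Finset.measurable_sum _ fun i _ => measurable_hits i
  refine Integrable.of_bound ((hm.const_mul θ).exp).aestronglyMeasurable
    (Real.exp (|θ| * S.card)) (Filter.Eventually.of_forall fun ω => ?_)
  rw [Real.norm_eq_abs, Real.abs_exp]
  refine Real.exp_le_exp.2 ?_
  refine mul_le_mul (le_abs_self θ) ?_ (by positivity) (abs_nonneg θ)
  exact_mod_cast Finset.card_filter_le _ _

theorem exp_sub_one_le {θ : ℝ} (h : |θ| ≤ 1) : Real.exp θ - 1 ≤ θ + θ ^ 2 := by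
  have := Real.norm_exp_sub_one_sub_id_le (x := θ) h
  rw [Real.norm_eq_abs, Real.norm_eq_abs, sq_abs] at this
  linarith [le_abs_self (Real.exp θ - 1 - θ)]

/-- The upper tail. -/
theorem upper_tail (hb : b ≤ w) {M M' δ : ℝ} (hS : (S.card : ℝ) / 2 ^ b ≤ M) (hM : M ≤ M')
    (hδ : 0 ≤ δ) (hδ1 : δ ≤ 1) :
    (tapeMeasure w).real {ω | M + δ * M' ≤ Net.sel ω (2 ^ b) D S} ≤
      Real.exp (-(δ ^ 2 / 4 * M')) := by
  have h0 : (0 : ℝ) ≤ (S.card : ℝ) / 2 ^ b := by positivity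
  have hθ : |δ / 2| ≤ 1 := by rw [abs_of_nonneg (by positivity)]; linarith
  -- With parameter `δ / 2` the exponent is at most `-(δ / 2) (M + δ M') + (δ / 2 + δ² / 4) M ≤ -δ²
  -- M' / 4`, by `exp θ - 1 ≤ θ + θ²` and `M ≤ M'`.
  refine (measure_ge_le_exp_mul_mgf (M + δ * M') (t := δ / 2) (by positivity)
    (integrable_sel _)).trans ?_
  refine (mul_le_mul_of_nonneg_left (mgf_sel_le hb _) (Real.exp_nonneg _)).trans ?_
  rw [← Real.exp_add, Real.exp_le_exp]
  have h1 := exp_sub_one_le hθ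
  have h2 : (Real.exp (δ / 2) - 1) * (S.card / 2 ^ b) ≤ (δ / 2 + (δ / 2) ^ 2) * M :=
    mul_le_mul h1 hS h0 (by positivity)
  have h3 : (δ / 2) ^ 2 * M ≤ (δ / 2) ^ 2 * M' := mul_le_mul_of_nonneg_left hM (by positivity)
  nlinarith

/-- The lower tail. -/
theorem lower_tail (hb : b ≤ w) {M M' δ : ℝ} (hS : M ≤ (S.card : ℝ) / 2 ^ b) (hM : M ≤ M')
    (hM0 : 0 ≤ M) (hδ : 0 ≤ δ) (hδ1 : δ ≤ 1) :
    (tapeMeasure w).real {ω | (Net.sel ω (2 ^ b) D S : ℝ) ≤ M - δ * M'} ≤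
      Real.exp (-(δ ^ 2 / 4 * M')) := by
  have hθ : |-(δ / 2)| ≤ 1 := by rw [abs_neg, abs_of_nonneg (by positivity)]; linarith
  refine (measure_le_le_exp_mul_mgf (M - δ * M') (t := -(δ / 2)) (by linarith)
    (integrable_sel _)).trans ?_
  refine (mul_le_mul_of_nonneg_left (mgf_sel_le hb _) (Real.exp_nonneg _)).trans ?_
  rw [← Real.exp_add, Real.exp_le_exp]
  have h1 := exp_sub_one_le hθ
  have h0 : Real.exp (-(δ / 2)) - 1 ≤ 0 := by
    have : Real.exp (-(δ / 2)) ≤ 1 := Real.exp_le_one_iff.2 (by linarith)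
    linarith
  have h2 : (Real.exp (-(δ / 2)) - 1) * (S.card / 2 ^ b) ≤ (Real.exp (-(δ / 2)) - 1) * M :=
    mul_le_mul_of_nonpos_left hS h0
  have h4 : (Real.exp (-(δ / 2)) - 1) * M ≤ (-(δ / 2) + (-(δ / 2)) ^ 2) * M :=
    mul_le_mul_of_nonneg_right h1 hM0
  have h3 : (δ / 2) ^ 2 * M ≤ (δ / 2) ^ 2 * M' := mul_le_mul_of_nonneg_left hM (by positivity)
  nlinarith

end Truss

namespace Truss

/-! ### The probability of a good tape -/

namespace Net

variable {w b D k t A : ℕ} {G : Net} {ch : ℕ → Finset ℕ} {R : Finset ℕ}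

/-- The relevant deviation has probability at most `m ^ (-A)`. -/
theorem exp_deviation_le (hk : 2 ≤ k) (hm : 1 ≤ G.m) {M : ℝ} :
    Real.exp (-((1 / (k : ℝ)) ^ 2 / 4 * max M ((threshold A G.m k : ℝ) / 2))) ≤
      1 / (G.m : ℝ) ^ A := by
  have hk0 : (0 : ℝ) < k := by exact_mod_cast (by omega : 0 < k)
  have hm0 : (0 : ℝ) < G.m := by exact_mod_cast hm
  -- The constant `8` in `threshold` is chosen for this: `(1 / k²) / 4 * (L / 2) = A * size m`. Then
  -- `exp (size m) ≥ 2 ^ size m ≥ m`.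
  have h1 : ((A * Nat.size G.m : ℕ) : ℝ) ≤
      (1 / (k : ℝ)) ^ 2 / 4 * max M ((threshold A G.m k : ℝ) / 2) := by
    refine le_trans (le_of_eq ?_) (mul_le_mul_of_nonneg_left (le_max_right _ _) (by positivity))
    unfold threshold
    push_cast
    field_simp
    ring
  refine (Real.exp_le_exp.2 (neg_le_neg h1)).trans ?_
  rw [Real.exp_neg, one_div]
  refine inv_anti₀ (by positivity) ?_
  rw [Nat.mul_comm, Nat.cast_mul, mul_comm, Real.exp_nat_mul]
  refine pow_le_pow_left₀ hm0.le ?_ A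
  have h2 : (G.m : ℝ) ≤ 2 ^ Nat.size G.m := by exact_mod_cast (Nat.lt_size_self G.m).le
  have h3 : (2 : ℝ) ≤ Real.exp 1 := by
    have := Real.add_one_le_exp (1 : ℝ); linarith
  calc (G.m : ℝ) ≤ 2 ^ Nat.size G.m := h2
    _ ≤ Real.exp 1 ^ Nat.size G.m := pow_le_pow_left₀ (by norm_num) h3 _
    _ = _ := by rw [← Real.exp_nat_mul, mul_one]

/-- This is `upper_tail` with `M = t / 2 ^ b`, `M' = max (t / 2 ^ b) (L / 2)` and `δ = 1 / k`,
rescaled to natural numbers. The enlarged `M'` keeps the failure probability small also when `t / 2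
^ b` is small. -/
theorem not_balanced_upper (hT : G.Truss t ch R) (hk : 2 ≤ k) (hm : 1 ≤ G.m) (hb : b ≤ w)
    (e : ℕ) :
    (tapeMeasure w).real {ω | 2 * k * t + max (2 * t) (threshold A G.m k * 2 ^ b) ≤
      2 * k * 2 ^ b * sel ω (2 ^ b) D (ch e)} ≤ 1 / (G.m : ℝ) ^ A := by
  have hk0 : (0 : ℝ) < k := by exact_mod_cast (by omega : 0 < k)
  have hk1 : (1 : ℝ) ≤ k := by exact_mod_cast (by omega : 1 ≤ k)
  refine le_trans (measureReal_mono ?_) ((upper_tail (D := D) (S := ch e) hb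
    (M := t / 2 ^ b) (M' := max ((t : ℝ) / 2 ^ b) ((threshold A G.m k : ℝ) / 2)) (δ := 1 / k)
    ?_ (le_max_left _ _) (by positivity) ?_).trans (exp_deviation_le hk hm))
  · intro ω hω
    have h1 : ((2 * k * t + max (2 * t) (threshold A G.m k * 2 ^ b) : ℕ) : ℝ) ≤
      (2 * k * 2 ^ b * sel ω (2 ^ b) D (ch e) : ℕ) := Nat.cast_le.2 hω
    push_cast at h1
    have h2 : max (2 * t : ℝ) (threshold A G.m k * 2 ^ b) =
        2 * 2 ^ b * max ((t : ℝ) / 2 ^ b) ((threshold A G.m k : ℝ) / 2) := by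
      rw [mul_max_of_nonneg _ _ (by positivity)]
      congr 1 <;> field_simp
    rw [h2] at h1
    show (t : ℝ) / 2 ^ b + 1 / k * _ ≤ _
    set x := max ((t : ℝ) / 2 ^ b) ((threshold A G.m k : ℝ) / 2)
    have h3 : (t : ℝ) / 2 ^ b + 1 / k * x = (2 * k * t + 2 * 2 ^ b * x) / (2 * k * 2 ^ b) := by
      field_simp
    rw [h3, div_le_iff₀ (by positivity)]
    linarith
  · exact div_le_div_of_nonneg_right (by exact_mod_cast hT.charge.card_le e) (by positivity)
  · rw [div_le_one hk0]; exact hk1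

theorem not_balanced_lower (hT : G.Truss t ch R) (hk : 2 ≤ k) (hm : 1 ≤ G.m) (hb : b ≤ w)
    {e : ℕ} (he : e ∈ R) :
    (tapeMeasure w).real {ω | 2 * k * 2 ^ b * sel ω (2 ^ b) D (G.inc R e) +
      max (2 * t) (threshold A G.m k * 2 ^ b) ≤ 2 * k * t} ≤ 1 / (G.m : ℝ) ^ A := by
  have hk0 : (0 : ℝ) < k := by exact_mod_cast (by omega : 0 < k)
  have hk1 : (1 : ℝ) ≤ k := by exact_mod_cast (by omega : 1 ≤ k)
  refine le_trans (measureReal_mono ?_) ((lower_tail (D := D) (S := G.inc R e) hb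
    (M := t / 2 ^ b) (M' := max ((t : ℝ) / 2 ^ b) ((threshold A G.m k : ℝ) / 2)) (δ := 1 / k)
    ?_ (le_max_left _ _) (by positivity) (by positivity) ?_).trans (exp_deviation_le hk hm))
  · intro ω hω
    have h1 : ((2 * k * 2 ^ b * sel ω (2 ^ b) D (G.inc R e) +
        max (2 * t) (threshold A G.m k * 2 ^ b) : ℕ) : ℝ) ≤ (2 * k * t : ℕ) := Nat.cast_le.2 hω
    push_cast at h1
    have h2 : max (2 * t : ℝ) (threshold A G.m k * 2 ^ b) =
        2 * 2 ^ b * max ((t : ℝ) / 2 ^ b) ((threshold A G.m k : ℝ) / 2) := by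
      rw [mul_max_of_nonneg _ _ (by positivity)]
      congr 1 <;> field_simp
    rw [h2] at h1
    show _ ≤ (t : ℝ) / 2 ^ b - 1 / k * _
    set x := max ((t : ℝ) / 2 ^ b) ((threshold A G.m k : ℝ) / 2)
    have h3 : (t : ℝ) / 2 ^ b - 1 / k * x = (2 * k * t - 2 * 2 ^ b * x) / (2 * k * 2 ^ b) := by
      field_simp
    rw [h3, le_div_iff₀ (by positivity)]
    linarith
  · exact div_le_div_of_nonneg_right (by exact_mod_cast hT.le_card e he) (by positivity)
  · rw [div_le_one hk0]; exact hk1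

/-- A sample is balanced with high probability. -/
theorem not_balanced_le (hT : G.Truss t ch R) (hk : 2 ≤ k) (hm : 1 ≤ G.m) (hb : b ≤ w) :
    (tapeMeasure w).real {ω | ¬ Balanced G k (threshold A G.m k) t ch R ω (2 ^ b) D} ≤
      2 * G.m * (1 / (G.m : ℝ) ^ A) := by
  classical
  have hR : R ⊆ Finset.range G.m := fun e he => Finset.mem_range.2 (hT.lt e he)
  have hsub : {ω : Tape w | ¬ Balanced G k (threshold A G.m k) t ch R ω (2 ^ b) D} ⊆
      (⋃ e ∈ Finset.range G.m, {ω | 2 * k * t + max (2 * t) (threshold A G.m k * 2 ^ b) ≤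
        2 * k * 2 ^ b * sel ω (2 ^ b) D (ch e)}) ∪
      ⋃ e ∈ R, {ω | 2 * k * 2 ^ b * sel ω (2 ^ b) D (G.inc R e) +
        max (2 * t) (threshold A G.m k * 2 ^ b) ≤ 2 * k * t} := by
    intro ω hω
    by_contra hn
    simp only [Set.mem_union, Set.mem_iUnion, not_or, not_exists, Set.mem_ofPred_eq,
      not_le, Finset.mem_range] at hn
    exact hω hn
  refine (measureReal_mono hsub).trans ((measureReal_union_le _ _).trans ?_)
  have h1 := (measureReal_biUnion_finset_le (μ := tapeMeasure w) (Finset.range G.m) fun e =>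
    {ω | 2 * k * t + max (2 * t) (threshold A G.m k * 2 ^ b) ≤
        2 * k * 2 ^ b * sel ω (2 ^ b) D (ch e)}).trans
    (Finset.sum_le_card_nsmul _ _ _ fun e _ => not_balanced_upper hT hk hm hb e)
  have h2 := (measureReal_biUnion_finset_le (μ := tapeMeasure w) R fun e =>
    {ω | 2 * k * 2 ^ b * sel ω (2 ^ b) D (G.inc R e) +
        max (2 * t) (threshold A G.m k * 2 ^ b) ≤ 2 * k * t}).trans
    (Finset.sum_le_card_nsmul _ _ _ fun e he => not_balanced_lower hT hk hm hb he)
  have h3 : (R.card : ℝ) ≤ G.m := by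
    have := Finset.card_le_card hR
    rw [Finset.card_range] at this
    exact_mod_cast this
  rw [nsmul_eq_mul] at h1 h2
  rw [Finset.card_range] at h1
  have h4 := mul_le_mul_of_nonneg_right h3 (show (0 : ℝ) ≤ 1 / (G.m : ℝ) ^ A by positivity)
  linarith

/-- A tape is good with high probability. -/
theorem not_goodTape_le {a : ℕ} (hT : G.Truss t ch R) (hk : 2 ≤ k) (hm : 2 ≤ G.m)
    (hW : G.W < 2 ^ w) :
    (tapeMeasure w).real {ω | ¬ GoodTape G k (threshold (a + 16) G.m k) t ch R ω} ≤
      1 / (G.m : ℝ) ^ a := by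
  classical
  set L := threshold (a + 16) G.m k
  have hsub : {ω : Tape w | ¬ GoodTape G k L t ch R ω} ⊆
      ⋃ p ∈ ((Finset.range G.W).filter fun b => 2 ^ b ≤ G.W) ×ˢ
          Finset.range (G.W * (G.W + 2) + 1),
        {ω | ¬ Balanced G k L t ch R ω (2 ^ p.1) p.2} := by
    intro ω hω
    simp only [Set.mem_ofPred_eq, GoodTape, not_forall] at hω
    obtain ⟨b, D, hb, hD, h⟩ := hω
    refine Set.mem_biUnion (x := (b, D)) ?_ h
    exact Finset.mem_coe.2 (Finset.mem_product.2 ⟨Finset.mem_filter.2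
      ⟨Finset.mem_range.2 (Nat.lt_two_pow_self.trans_le hb), hb⟩,
      Finset.mem_range.2 (Nat.lt_succ_of_le hD)⟩)
  refine (measureReal_mono hsub (measure_ne_top _ _)).trans
    ((measureReal_biUnion_finset_le _ _).trans ?_)
  refine (Finset.sum_le_card_nsmul _ _ (2 * G.m * (1 / (G.m : ℝ) ^ (a + 16)))
    fun p hp => ?_).trans ?_
  · have hp' := (Finset.mem_filter.1 (Finset.mem_product.1 hp).1).2
    exact not_balanced_le hT hk (by omega)
      ((Nat.pow_lt_pow_iff_right (by norm_num)).1 (hp'.trans_lt hW)).le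
  rw [nsmul_eq_mul, Finset.card_product, Finset.card_range]
  have h1 : ((Finset.range G.W).filter fun b => 2 ^ b ≤ G.W).card ≤ G.W :=
    (Finset.card_filter_le _ _).trans (Finset.card_range _).le
  -- The number of pairs `(b, D)` times the `2 m` events of each is absorbed by `m ^ 16`; this is
  -- the `16` added to the exponent in the threshold.
  have h2 : G.W * (G.W * (G.W + 2) + 1) * (2 * G.m) ≤ G.m ^ 16 := by
    have hW := G.W_le_sq
    have h5 : 4 * G.m * 2 ≤ G.m ^ 4 := by
      calc 4 * G.m * 2 = 2 * 2 * 2 * G.m := by ring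
        _ ≤ G.m * G.m * G.m * G.m := by gcongr
        _ = _ := by ring
    have h6 : G.W ≤ G.m ^ 4 := hW.trans (by
      calc 4 * G.m * G.m = 2 * 2 * (G.m * G.m) := by ring
        _ ≤ G.m * G.m * (G.m * G.m) := by gcongr
        _ = _ := by ring)
    have h7 : G.m ^ 16 = G.m ^ 4 * G.m ^ 4 * G.m ^ 4 * G.m ^ 4 := by ring
    rw [h7]
    generalize G.m ^ 4 = x at *
    have h8 : G.W * (G.W + 2) + 1 ≤ 2 * (x * x) := by nlinarith
    calc G.W * (G.W * (G.W + 2) + 1) * (2 * G.m) ≤ x * (2 * (x * x)) * (2 * G.m) := by gcongr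
      _ = x * x * x * (4 * G.m) := by ring
      _ ≤ _ := Nat.mul_le_mul_left _ (by omega)
  have h3 : ((((Finset.range G.W).filter fun b => 2 ^ b ≤ G.W).card *
      (G.W * (G.W + 2) + 1) : ℕ) : ℝ) * (2 * G.m) ≤ (G.m : ℝ) ^ 16 := by
    exact_mod_cast (Nat.mul_le_mul_right _ (Nat.mul_le_mul_right _ h1)).trans h2
  have hm0 : (0 : ℝ) < G.m := by exact_mod_cast (by omega : 0 < G.m)
  rw [← mul_assoc]
  refine (mul_le_mul_of_nonneg_right h3 (by positivity)).trans (le_of_eq ?_)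
  rw [pow_add]
  field_simp

end Net
end Truss

namespace Truss

/-! ### The darts of a list of edges -/

section EdgeList
variable {n : ℕ} (L : List (Fin n × Fin n))

/-- The endpoints of the edges of a list, as they are stored. -/
def ends (q : ℕ) : ℕ := (L.flatMap fun p => [(p.1 : ℕ), (p.2 : ℕ)]).getD q 0

theorem ends_even {i : ℕ} (hi : i < L.length) : ends L (2 * i) = L[i].1 := by
  unfold ends
  induction L generalizing i with
  | nil => simp at hi
  | cons p L ih =>
    cases i with
    | zero => simp
    | succ i =>
      rw [show 2 * (i + 1) = 2 * i + 1 + 1 by ring]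
      simpa using ih (i := i) (by simpa using hi)

theorem ends_odd {i : ℕ} (hi : i < L.length) : ends L (2 * i + 1) = L[i].2 := by
  unfold ends
  induction L generalizing i with
  | nil => simp at hi
  | cons p L ih =>
    cases i with
    | zero => simp
    | succ i =>
      rw [show 2 * (i + 1) + 1 = 2 * i + 1 + 1 + 1 by ring]
      simpa using ih (i := i) (by simpa using hi)

theorem ends_eq_zero {q : ℕ} (hq : 2 * L.length ≤ q) : ends L q = 0 := by
  unfold ends
  refine List.getD_eq_default _ _ (le_trans (le_of_eq ?_) hq)
  clear hq
  induction L with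
  | nil => simp
  | cons p L ih => simp [ih]; ring

variable {L}

theorem ends_cases {q : ℕ} (hq : q < 2 * L.length) : ∃ i, ∃ hi : i < L.length,
    (q = 2 * i ∧ ends L q = L[i].1 ∧ ends L (fl q) = L[i].2) ∨
      (q = 2 * i + 1 ∧ ends L q = L[i].2 ∧ ends L (fl q) = L[i].1) := by
  have hi : q / 2 < L.length := by omega
  refine ⟨q / 2, hi, ?_⟩
  rcases Nat.mod_two_eq_zero_or_one q with h | h
  · left
    have e : q = 2 * (q / 2) := by omega
    refine ⟨e, ?_, ?_⟩
    · rw [← ends_even L hi, ← e]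
    · rw [← ends_odd L hi, ← e, fl, h]; rfl
  · right
    have e : q = 2 * (q / 2) + 1 := by omega
    refine ⟨e, ?_, ?_⟩
    · rw [← ends_odd L hi, ← e]
    · rw [← ends_even L hi, fl, h]
      congr 1; omega

variable {H : SimpleGraph (Fin n)}

theorem IsEdgeList.adj (hL : IsEdgeList H L) {i : ℕ} (hi : i < L.length) :
    H.Adj L[i].1 L[i].2 := by
  rw [← SimpleGraph.mem_edgeSet, ← hL.2]
  exact List.mem_map.2 ⟨_, List.getElem_mem hi, rfl⟩

/-- Equal ends mean the same edge of the list, because there are no repetitions; opposite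
orientations of it would force a loop. -/
theorem IsEdgeList.ends_simple (hL : IsEdgeList H L) {q q' : ℕ} (hq : q < 2 * L.length)
    (hq' : q' < 2 * L.length) (h1 : ends L q = ends L q') (h2 : ends L (fl q) = ends L (fl q')) :
    q = q' := by
  obtain ⟨i, hi, h⟩ := ends_cases hq
  obtain ⟨j, hj, h'⟩ := ends_cases hq'
  have hs : s(L[i].1, L[i].2) = s(L[j].1, L[j].2) → i = j := by
    intro e
    refine (List.Nodup.getElem_inj_iff hL.1 (hi := by simpa using hi) (hj := by simpa using hj)).1 ?_
    simpa using e
  have hne := (hL.adj hi).ne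
  rcases h with ⟨e, a, b⟩ | ⟨e, a, b⟩ <;> rcases h' with ⟨e', a', b'⟩ | ⟨e', a', b'⟩ <;>
    rw [a, a'] at h1 <;> rw [b, b'] at h2 <;> have h1 := Fin.ext h1 <;> have h2 := Fin.ext h2
  · have := hs (by rw [h1, h2]); omega
  · have := hs (by rw [h1, h2, Sym2.eq_swap]); subst this; exact absurd h1 hne
  · have := hs (by rw [h1, h2, Sym2.eq_swap]); subst this; exact absurd h1.symm hne
  · have := hs (by rw [h1, h2]); omega

theorem IsEdgeList.length_eq (hL : IsEdgeList H L) : numEdges H = L.length := by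
  classical
  have : H.edgeSet = ((L.map fun p => s(p.1, p.2)).toFinset : Set (Sym2 (Fin n))) := by
    ext e
    rw [List.coe_toFinset, Set.mem_ofPred_eq, hL.2]
  rw [numEdges, this, Set.ncard_coe_finset, List.toFinset_card_of_nodup hL.1, List.length_map]

open Classical in
/-- The darts of a graph that is given by a list of its edges. -/
noncomputable def IsEdgeList.net (hL : IsEdgeList H L) : Net where
  n := n
  m := L.length
  c := ends L
  π h := if hh : h < 2 * L.length then (exists_rho_eq (c := ends L) hh).choose else 0
  c_lt q hq := by
    obtain ⟨i, hi, ⟨-, h, -⟩ | ⟨-, h, -⟩⟩ := ends_cases hq <;> rw [h] <;> exact Fin.is_lt _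
  simple q hq q' hq' := hL.ends_simple hq hq'
  perm q hq := by
    have hlt := rho_lt (c := ends L) hq
    rw [dif_pos hlt]
    have := (exists_rho_eq (c := ends L) hlt).choose_spec
    exact rho_inj this.1 hq this.2

theorem IsEdgeList.net_of (hL : IsEdgeList H L) : hL.net.Of H := by
  suffices ∀ u v : Fin n, H.Adj u v ↔ ∃ q, hL.net.IsDart u v q from this
  intro u v
  constructor
  · intro h
    rw [← SimpleGraph.mem_edgeSet, ← hL.2, List.mem_map] at h
    obtain ⟨p, hp, e⟩ := h
    obtain ⟨i, hi, rfl⟩ := List.getElem_of_mem hp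
    rcases Sym2.eq_iff.1 e with ⟨rfl, rfl⟩ | ⟨rfl, rfl⟩
    · refine ⟨2 * i, by change 2 * i < 2 * L.length; omega, ends_even L hi, ?_⟩
      rw [fl, Nat.mul_mod_right]
      exact ends_odd L hi
    · refine ⟨2 * i + 1, by change 2 * i + 1 < 2 * L.length; omega, ends_odd L hi, ?_⟩
      rw [show fl (2 * i + 1) = 2 * i by unfold fl; omega]
      exact ends_even L hi
  · rintro ⟨q, hq, h1, h2⟩
    obtain ⟨i, hi, ⟨-, a, b⟩ | ⟨-, a, b⟩⟩ := ends_cases (L := L) hq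
    · have e1 : u = L[i].1 := Fin.ext (h1.symm.trans a)
      have e2 : v = L[i].2 := Fin.ext (h2.symm.trans b)
      rw [e1, e2]; exact hL.adj hi
    · have e1 : u = L[i].2 := Fin.ext (h1.symm.trans a)
      have e2 : v = L[i].1 := Fin.ext (h2.symm.trans b)
      rw [e1, e2]; exact (hL.adj hi).symm

end EdgeList

end Truss

namespace Truss

/-! ### Estimates -/

/-- Here `2 ^ (size m - 1) ≤ m`, `size m ≤ 2 (size m - 1)` and `log 2 > 2 / 3`, which give the
factor `3`. -/
theorem size_le_log {m : ℕ} (hm : 2 ≤ m) : (Nat.size m : ℝ) ≤ 3 * Real.log m := by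
  have hs : 1 < Nat.size m := Nat.lt_size.2 (by simpa using hm)
  have h1 : 2 ^ (Nat.size m - 1) ≤ m := Nat.lt_size.1 (by omega)
  have h2 : (2 : ℝ) ^ (Nat.size m - 1) ≤ m := by exact_mod_cast h1
  have h3 := Real.log_le_log (by positivity) h2
  rw [Real.log_pow] at h3
  have h4 : (Nat.size m : ℝ) ≤ 2 * ((Nat.size m - 1 : ℕ) : ℝ) := by
    exact_mod_cast (by omega : Nat.size m ≤ 2 * (Nat.size m - 1))
  have h5 := Real.log_two_gt_d9
  have h6 : ((Nat.size m - 1 : ℕ) : ℝ) * (2 / 3) ≤ ((Nat.size m - 1 : ℕ) : ℝ) * Real.log 2 :=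
    mul_le_mul_of_nonneg_left (by linarith) (by positivity)
  linarith

theorem size_le_self (m : ℕ) : Nat.size m ≤ m := Nat.size_le.2 Nat.lt_two_pow_self

section
variable {ε : ℝ}

theorem one_div_le_ceil (ε : ℝ) : 1 / ε ≤ (⌈1 / ε⌉₊ : ℝ) := Nat.le_ceil _

theorem two_le_ceil (h0 : 0 < ε) (h1 : ε < 1) : 2 ≤ ⌈1 / ε⌉₊ := by
  have : 1 < ⌈1 / ε⌉₊ := Nat.lt_ceil.2 (by rw [Nat.cast_one]; exact one_lt_one_div h0 h1)
  omega

theorem ceil_le (h0 : 0 < ε) (h1 : ε < 1) : (⌈1 / ε⌉₊ : ℝ) ≤ 2 / ε := by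
  have h2 := Nat.ceil_lt_add_one (show 0 ≤ 1 / ε by positivity)
  have h3 : 1 < 1 / ε := one_lt_one_div h0 h1
  have h4 : 2 / ε = 1 / ε + 1 / ε := by ring
  linarith

theorem ceil_sq_le (h0 : 0 < ε) (h1 : ε < 1) : (⌈1 / ε⌉₊ : ℝ) ^ 2 ≤ 4 / ε ^ 2 := by
  refine (pow_le_pow_left₀ (by positivity) (ceil_le h0 h1) 2).trans (le_of_eq ?_)
  rw [div_pow]; norm_num

theorem threshold_le (h0 : 0 < ε) (h1 : ε < 1) {m : ℕ} (hm : 2 ≤ m) (A : ℕ) :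
    (threshold A m ⌈1 / ε⌉₊ : ℝ) ≤ 96 * A * Real.log m / ε ^ 2 := by
  have h2 := size_le_log hm
  have h3 := ceil_sq_le h0 h1
  have h4 : (threshold A m ⌈1 / ε⌉₊ : ℝ) = 8 * A * (Nat.size m * (⌈1 / ε⌉₊ : ℝ) ^ 2) := by
    unfold threshold; push_cast; ring
  rw [h4]
  calc 8 * A * (Nat.size m * (⌈1 / ε⌉₊ : ℝ) ^ 2)
      ≤ 8 * A * (3 * Real.log m * (4 / ε ^ 2)) :=
        mul_le_mul_of_nonneg_left (mul_le_mul h2 h3 (by positivity)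
          ((Nat.cast_nonneg _).trans h2)) (by positivity)
    _ = _ := by ring

end

theorem threshold_le_nat (A m k : ℕ) : threshold A m k ≤ 8 * (A * m * k * k) := by
  unfold threshold
  have := size_le_self m
  calc 8 * A * Nat.size m * k * k ≤ 8 * A * m * k * k := by gcongr
    _ = _ := by ring

/-- A crude polynomial bound valid on every tape; it is used only where it gets multiplied by a
small probability, and for termination. -/
theorem worstCost_le {W n m A k : ℕ} (hW : W ≤ 4 * m * m) (hn : n ≤ 2 * m) (hm : 1 ≤ m)
    (hA : 1 ≤ A) (hk : 1 ≤ k) :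
    worstCost W n m (8 * m * threshold A m k) ≤ 180000 * (A * m ^ 5 * k ^ 2) := by
  obtain ⟨y, hy⟩ : ∃ y, y = A * m * m * k * k := ⟨_, rfl⟩
  have hc : 8 * m * threshold A m k ≤ 64 * y := by
    calc 8 * m * threshold A m k ≤ 8 * m * (8 * (A * m * k * k)) :=
          Nat.mul_le_mul_left _ (threshold_le_nat A m k)
      _ = 64 * y := by rw [hy]; ring
  have hmy : m * m ≤ y := by
    calc m * m = 1 * m * m * 1 * 1 := by ring
      _ ≤ A * m * m * k * k := by gcongr
      _ = y := hy.symm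
  have hmm : m ≤ m * m := Nat.le_mul_of_pos_left _ hm
  have hy1 : y ≤ m * y := Nat.le_mul_of_pos_left _ hm
  have hr : roundCost W m (8 * m * threshold A m k) ≤ 43000 * (m * y) := by
    unfold roundCost
    have h1 : 60 * (m + 1) * (3 * (8 * m * threshold A m k) + 1) ≤ 60 * (2 * m) * (193 * y) :=
      Nat.mul_le_mul (by omega) (by omega)
    have h2 : 60 * (2 * m) * (193 * y) = 23160 * (m * y) := by ring
    have h3 : 4 * m * m = 4 * (m * m) := by ring
    omega
  have h4 : A * m ^ 5 * k ^ 2 = m * m * (m * y) := by rw [hy]; ring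
  unfold worstCost
  have h5 : W * roundCost W m (8 * m * threshold A m k) ≤ 4 * m * m * (43000 * (m * y)) :=
    Nat.mul_le_mul hW hr
  have h6 : 4 * m * m * (43000 * (m * y)) = 172000 * (m * m * (m * y)) := by ring
  have h7 : m * y ≤ m * m * (m * y) := Nat.le_mul_of_pos_left _ (by positivity)
  have h3 : 4 * m * m = 4 * (m * m) := by ring
  rw [h4]
  omega

/-! ### The word length -/

theorem pow_le_wordBound {x c w : ℕ} (hw : w = c * Nat.size x) : x ^ c ≤ wordBound w := by
  rw [hw, wordBound, mul_comm, pow_mul]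
  exact Nat.pow_le_pow_left (Nat.lt_size_self x).le c

/-- With `x ≥ 4` the constant `4096 = 4 ^ 6` is at most `x ^ 6`, and `A ≤ x ^ A`. So a word length
of `A + 20` times the size of the input leaves room for every quantity of the form `4096 A x ^ j`
with `j ≤ 12`. -/
theorem mul_lt_wordBound {x A w N j : ℕ} (hw : w = (A + 20) * Nat.size x) (hx : 4 ≤ x)
    (hj : j ≤ 12) (hN : N ≤ 4096 * A * x ^ j) : N < wordBound w := by
  refine lt_of_le_of_lt hN (lt_of_lt_of_le ?_ (pow_le_wordBound hw))
  have h1 : A ≤ x ^ A := (Nat.lt_pow_self (by omega)).le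
  have h2 : 4096 ≤ x ^ 6 := by
    calc 4096 = 4 ^ 6 := by norm_num
      _ ≤ x ^ 6 := Nat.pow_le_pow_left hx 6
  have h3 : x ^ j ≤ x ^ 12 := Nat.pow_le_pow_right (by omega) hj
  calc 4096 * A * x ^ j ≤ x ^ 6 * x ^ A * x ^ 12 := by gcongr
    _ = x ^ (A + 18) := by rw [← pow_add, ← pow_add]; congr 1; omega
    _ < x ^ (A + 20) := Nat.pow_lt_pow_right (by omega) (by omega)

end Truss

namespace Truss

/-! ### The expected time -/

section
variable {ε : ℝ} {m T t α b A L W τ : ℕ}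

theorem le_min_log (hm : 2 ≤ m) {y : ℝ} (h1 : y ≤ 1)
    (h2 : y * (T + 1) ≤ m * Real.log m) : y ≤ min (m * Real.log m / ((T : ℝ) + 1)) 1 :=
  le_min ((le_div_iff₀ (by positivity)).2 h2) h1

theorem half_le_log (hm : 2 ≤ m) : 1 / 2 ≤ Real.log m := by
  have h1 := Real.log_two_gt_d9
  have h2 := Real.log_le_log (by norm_num : (0 : ℝ) < 2) (show (2 : ℝ) ≤ m by exact_mod_cast hm)
  linarith

/-- The time is `O(m α / 2 ^ b)` with `2 ^ b ≥ (T + 1) / (4 m L)`, which turns `1 / 2 ^ b` into the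
minimum, up to `384 A / ε²`. Here `384 = 4 * 96` and `6144000 = 16000 * 384`. -/
theorem good_time_le (h0 : 0 < ε) (h1 : ε < 1) (hm : 2 ≤ m) (hA : 1 ≤ A)
    (hτ : τ * 2 ^ b ≤ 4000 * (W + m * t)) (hW : W ≤ 2 * m * α) (ht : t + 1 ≤ 2 * α)
    (hT1 : T ≤ W) (hT2 : T ≤ m * t)
    (hL : (L : ℝ) ≤ 96 * A * Real.log m / ε ^ 2) (hL0 : 0 < L)
    (hb : W < 2 * (2 ^ b * (m * L)) ∨ t < 4 * (L * 2 ^ b)) :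
    (τ : ℝ) ≤ 6144000 * A *
      (1 / ε ^ 2 * (min (m * Real.log m / ((T : ℝ) + 1)) 1 * m * α)) := by
  have hA0 : (1 : ℝ) ≤ A := by exact_mod_cast hA
  have hm0 : (2 : ℝ) ≤ m := by exact_mod_cast hm
  have h2b : (1 : ℝ) ≤ 2 ^ b := one_le_pow₀ (by norm_num)
  -- The first alternative is combined with `T ≤ W`, the second with `T ≤ m t`.
  have hTL : T + 1 ≤ 4 * m * L * 2 ^ b := by
    have e : 4 * m * L * 2 ^ b = 4 * (2 ^ b * (m * L)) := by ring
    have hpos : 0 < 2 ^ b * (m * L) := by positivity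
    rcases hb with hb | hb
    · omega
    · have := Nat.mul_le_mul_left m (Nat.succ_le_of_lt hb)
      have e' : m * (4 * (L * 2 ^ b)) = 4 * (2 ^ b * (m * L)) := by ring
      rw [Nat.mul_succ] at this
      omega
  have hTL' : (T : ℝ) + 1 ≤ 4 * m * L * 2 ^ b := by exact_mod_cast hTL
  have hy : ε ^ 2 / (384 * A * 2 ^ b) ≤ min (m * Real.log m / ((T : ℝ) + 1)) 1 := by
    refine le_min_log hm ?_ ?_
    · rw [div_le_one (by positivity)]
      have : ε ^ 2 ≤ 1 := pow_le_one₀ h0.le h1.le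
      nlinarith
    · calc ε ^ 2 / (384 * A * 2 ^ b) * (T + 1)
          ≤ ε ^ 2 / (384 * A * 2 ^ b) * (4 * m * (96 * A * Real.log m / ε ^ 2) * 2 ^ b) := by
            refine mul_le_mul_of_nonneg_left (hTL'.trans ?_) (by positivity)
            gcongr
        _ = m * Real.log m := by field_simp; ring
  have hmα : W + m * t ≤ 4 * (m * α) := by
    have := Nat.mul_le_mul_left m (show t ≤ 2 * α by omega)
    have e1 : m * (2 * α) = 2 * (m * α) := by ring
    have e2 : 2 * m * α = 2 * (m * α) := by ring
    omega
  have h3 : (τ : ℝ) * 2 ^ b ≤ 16000 * (m * α) := by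
    exact_mod_cast (show τ * 2 ^ b ≤ 16000 * (m * α) by omega)
  calc (τ : ℝ) ≤ 16000 * (m * α) / 2 ^ b := (le_div_iff₀ (by positivity)).2 h3
    _ = 6144000 * A * (1 / ε ^ 2 * (ε ^ 2 / (384 * A * 2 ^ b) * m * α)) := by field_simp; ring
    _ ≤ _ := by gcongr

/-- Five of the powers of `m` in the probability cancel the `m ^ 5` of the worst case. The minimum
is at least `1 / (10 m)`, because `T + 1 ≤ 5 m²` and `log m ≥ 1 / 2`. -/
theorem bad_time_le (h0 : 0 < ε) (h1 : ε < 1) (hm : 2 ≤ m) (ht : t + 1 ≤ 2 * α)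
    (hT : T ≤ 4 * m * m) {a : ℕ}
    (hτ : τ ≤ 180000 * (A * m ^ 5 * ⌈1 / ε⌉₊ ^ 2)) {p : ℝ} (hp0 : 0 ≤ p)
    (hp : p ≤ 1 / (m : ℝ) ^ (a + 24)) :
    τ * p ≤ 7200000 * A *
      (1 / ε ^ 2 * (min (m * Real.log m / ((T : ℝ) + 1)) 1 * m * α)) := by
  have hm0 : (2 : ℝ) ≤ m := by exact_mod_cast hm
  have hα : (1 : ℝ) ≤ α := by exact_mod_cast (by omega : 1 ≤ α)
  have hT' : (T : ℝ) ≤ 4 * m * m := by exact_mod_cast hT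
  have hlog := half_le_log hm
  have hy : 1 / (10 * (m : ℝ)) ≤ min (m * Real.log m / ((T : ℝ) + 1)) 1 := by
    refine le_min_log hm ?_ ?_
    · rw [div_le_one (by positivity)]; linarith
    · rw [div_mul_eq_mul_div, one_mul, div_le_iff₀ (by positivity)]
      nlinarith [mul_le_mul_of_nonneg_left hlog (show (0 : ℝ) ≤ m * m by positivity)]
  have hp' : p ≤ 1 / (m : ℝ) ^ 5 := hp.trans
    (one_div_le_one_div_of_le (by positivity) (pow_le_pow_right₀ (by linarith) (by omega)))
  have hτ' : (τ : ℝ) ≤ 180000 * (A * m ^ 5 * (4 / ε ^ 2)) := by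
    calc (τ : ℝ) ≤ 180000 * (A * m ^ 5 * (⌈1 / ε⌉₊ : ℝ) ^ 2) := by exact_mod_cast hτ
      _ ≤ _ := by
        have := ceil_sq_le h0 h1
        gcongr
  calc τ * p ≤ 180000 * (A * m ^ 5 * (4 / ε ^ 2)) * (1 / (m : ℝ) ^ 5) := by gcongr
    _ = 7200000 * A * (1 / ε ^ 2 * (1 / (10 * (m : ℝ)) * m * 1)) := by field_simp; ring
    _ ≤ _ := by gcongr

/-- The two contributions to the expected time. -/
theorem time_sum_le (h0 : 0 < ε) (h1 : ε < 1) {F x y : ℝ} (hF : 0 ≤ F)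
    (hx : x ≤ 6144000 * A * (1 / ε ^ 2 * F)) (hy : y ≤ 7200000 * A * (1 / ε ^ 2 * F)) :
    x + y ≤ 30000000 * A * (1 / ε ^ 3 * F * Real.log ((t : ℝ) + 2)) := by
  have h2 : 1 / 2 ≤ Real.log ((t : ℝ) + 2) := by
    have := half_le_log (m := t + 2) (by omega)
    push_cast at this
    exact this
  have h3 : 1 / ε ^ 2 ≤ 1 / ε ^ 3 := one_div_le_one_div_of_le (by positivity)
    (pow_le_pow_of_le_one h0.le h1.le (by norm_num))
  -- The factor `1 / 2` stands for the logarithm. The bound on `x + y` needs neither the logarithm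
  -- nor the third power of `1 / ε`.
  calc x + y ≤ 30000000 * A * (1 / ε ^ 2 * F * (1 / 2)) := by
        have : 0 ≤ A * (1 / ε ^ 2 * F) := by positivity
        nlinarith
    _ ≤ _ := by gcongr

end

/-- The expectation of a function that is bounded by `x`, and by `x + y` on a small set. -/
theorem lintegral_le_of_good {Ω : Type*} [MeasurableSpace Ω] {μ : Measure Ω}
    [IsProbabilityMeasure μ] {f : Ω → ENNReal} {S : Set Ω} {x y : ℝ} (hx : 0 ≤ x) (hy : 0 ≤ y)
    (h1 : ∀ ω, ω ∉ S → f ω ≤ ENNReal.ofReal x) (h2 : ∀ ω, f ω ≤ ENNReal.ofReal y) :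
    ∫⁻ ω, f ω ∂μ ≤ ENNReal.ofReal (x + y * μ.real S) := by
  calc ∫⁻ ω, f ω ∂μ ≤ ∫⁻ ω, (ENNReal.ofReal x + S.indicator (fun _ => ENNReal.ofReal y) ω) ∂μ := by
        refine lintegral_mono fun ω => ?_
        by_cases hω : ω ∈ S
        · simp only [Set.indicator_of_mem hω]
          exact (h2 ω).trans le_add_self
        · simp only [Set.indicator_of_notMem hω, add_zero]
          exact h1 ω hω
    _ = ENNReal.ofReal x + ∫⁻ ω, S.indicator (fun _ => ENNReal.ofReal y) ω ∂μ := by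
        rw [lintegral_add_left measurable_const, lintegral_const, measure_univ, mul_one]
    _ ≤ ENNReal.ofReal x + ENNReal.ofReal y * μ S := by
        gcongr
        -- This inequality holds for arbitrary sets, so the set of bad tapes need not be shown
        -- measurable; nor need the running time.
        exact lintegral_indicator_const_le _ _
    _ = _ := by
        rw [← ofReal_measureReal, ← ENNReal.ofReal_mul hy, ← ENNReal.ofReal_add hx]
        exact mul_nonneg hy measureReal_nonneg

/-- Subadditivity of the outer measure replaces complements, so no measurability of the success
event is needed. -/
theorem ofReal_le_of_good {Ω : Type*} [MeasurableSpace Ω] {μ : Measure Ω}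
    [IsProbabilityMeasure μ] {S S' : Set Ω} {p : ℝ} (h : ∀ ω, ω ∉ S → ω ∈ S')
    (hp : μ.real S ≤ p) : ENNReal.ofReal (1 - p) ≤ μ S' := by
  rw [← ofReal_measureReal (μ := μ) (s := S')]
  refine ENNReal.ofReal_le_ofReal ?_
  have h1 : μ.real Set.univ ≤ μ.real (S' ∪ S) := measureReal_mono fun ω _ => by
    by_cases hω : ω ∈ S
    · exact Or.inr hω
    · exact Or.inl (h ω hω)
  rw [probReal_univ] at h1
  linarith [measureReal_union_le (μ := μ) S' S]

theorem isApprox_of_mul_le {ε : ℝ} (h0 : 0 < ε) {t r k : ℕ} (hk : 1 / ε ≤ k)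
    (h1 : k * t ≤ k * r + t) (h2 : k * r ≤ k * t + t) : IsApprox ε t r := by
  have hk0 : (0 : ℝ) < k := lt_of_lt_of_le (by positivity) hk
  have hεk : 1 ≤ ε * k := by rw [div_le_iff₀ h0] at hk; linarith
  have h3 : (t : ℝ) ≤ k * (ε * t) := by
    have := mul_le_mul_of_nonneg_right hεk (Nat.cast_nonneg (α := ℝ) t)
    linarith
  have h1' : (k : ℝ) * t ≤ k * r + t := by exact_mod_cast h1
  have h2' : (k : ℝ) * r ≤ k * t + t := by exact_mod_cast h2
  constructor <;> refine le_of_mul_le_mul_left ?_ hk0 <;> linarith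

end Truss

namespace Truss

/-! ### The theorem -/

/-- This applies `wp_main` from the initial configuration, with arrays of `24 m L` entries: three
nodes for each of at most `8 m L` stored triangles. All numbers that occur are checked against the
word length. -/
theorem IsEdgeList.run_spec {n A k t w : ℕ} {H : SimpleGraph (Fin n)} {L : List (Fin n × Fin n)}
    (hL : IsEdgeList H L) (hiso : ∀ v, ∃ u, H.Adj v u) (hm : 2 ≤ L.length) (hk : 2 ≤ k)
    (hA : 1 ≤ A) (hw : w = (A + 20) * inputBits n L.length k) {ch : ℕ → Finset ℕ}
    {R : Finset ℕ} (hT : hL.net.Truss t ch R) (ω : Tape w) :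
    hL.net.W < 2 ^ w ∧
    ∃ s : St, Halted (run ω (start (Truss.main A) L k) s.t) ∧
      (run ω (start (Truss.main A) L k) s.t).reg = s.r ∧
      (∀ τ, (run ω (start (Truss.main A) L k) τ).space ≤
        16 * (24 * L.length * threshold A L.length k)) ∧
      s.t ≤ 180000 * (A * L.length ^ 5 * k ^ 2) ∧ s.r 1 = 1 ∧
      (GoodTape hL.net k (threshold A L.length k) t ch R ω →
        k * t ≤ k * s.r 0 + t ∧ k * s.r 0 ≤ k * t + t ∧
        ∃ b, s.t * 2 ^ b ≤ 4000 * (hL.net.W + L.length * t) ∧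
          (hL.net.W < 2 * (2 ^ b * (L.length * threshold A L.length k)) ∨
            t < 4 * (threshold A L.length k * 2 ^ b))) := by
  have hn : n ≤ 2 * L.length := Net.n_le hL.net_of hiso
  have hW : hL.net.W ≤ 4 * L.length * L.length := Net.W_le_sq
  have hmW : L.length ≤ hL.net.W := Net.m_le_W (G := hL.net)
  obtain ⟨m, hmd⟩ : ∃ m, m = L.length := ⟨_, rfl⟩
  rw [← hmd] at hW hmW hn hm hw ⊢
  obtain ⟨x, hx⟩ : ∃ x, x = n + m + k := ⟨_, rfl⟩
  have hbits : inputBits n m k = Nat.size x := by rw [inputBits, hx]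
  rw [hbits] at hw
  have hx4 : 4 ≤ x := by omega
  have hnx : n ≤ x := by omega
  have hmx : m ≤ x := by omega
  have hkx : k ≤ x := by omega
  have hth := threshold_le_nat A m k
  have hth0 : 0 < threshold A m k := by
    have : 0 < Nat.size m := Nat.size_pos.2 (by omega)
    unfold threshold; positivity
  have hx1 : x < wordBound w :=
    mul_lt_wordBound (j := 1) hw hx4 (by norm_num) (by nlinarith)
  have hI : 16 * (24 * m * threshold A m k) < wordBound w := by
    refine mul_lt_wordBound (j := 4) hw hx4 (by norm_num) ?_
    calc 16 * (24 * m * threshold A m k) ≤ 16 * (24 * m * (8 * (A * m * k * k))) := by gcongr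
      _ = 3072 * A * (m * m * k * k) := by ring
      _ ≤ 4096 * A * (x * x * x * x) := by gcongr; norm_num
      _ = _ := by ring
  have hE1 : (2 * m + 1) * n < wordBound w := by
    refine mul_lt_wordBound (j := 2) hw hx4 (by norm_num) ?_
    calc (2 * m + 1) * n ≤ (2 * x + x) * x := by gcongr; omega
      _ = 3 * 1 * x ^ 2 := by ring
      _ ≤ 4096 * A * x ^ 2 := by gcongr; norm_num
  have hE2 : 24 * m * threshold A m k * hL.net.W < wordBound w := by
    refine mul_lt_wordBound (j := 6) hw hx4 (by norm_num) ?_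
    calc 24 * m * threshold A m k * hL.net.W
        ≤ 24 * m * (8 * (A * m * k * k)) * (4 * m * m) := by gcongr
      _ = 768 * A * (m * m * k * k * m * m) := by ring
      _ ≤ 4096 * A * (x * x * x * x * x * x) := by gcongr; norm_num
      _ = _ := by ring
  have hmL : m ≤ m * threshold A m k := Nat.le_mul_of_pos_right _ hth0
  have e24 : 24 * m * threshold A m k = 24 * (m * threshold A m k) := by ring
  have : Mach w (24 * m * threshold A m k) := ⟨hI, by omega⟩
  have hWw : hL.net.W < 2 ^ w := by
    refine lt_of_le_of_lt ?_ hE2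
    exact Nat.le_mul_of_pos_left _ (by omega)
  refine ⟨hWw, ?_⟩
  have hlt : ∀ q, ends L q < wordBound w := by
    intro q
    rcases lt_or_ge q (2 * L.length) with h | h
    · have : ends L q < n := hL.net.c_lt q h
      omega
    · rw [ends_eq_zero L h]; omega
  have hc : memOf (St.ofConfig (start (Truss.main A) L k)).A = ends L := memOf_ofConfig _
  have hwp := Truss.wp_main (G := hL.net) (w := w) (I := 24 * m * threshold A m k) ω
    (St.ofConfig (start (Truss.main A) L k)) (A := A) (k := k) hT rfl rfl rfl hc
    (fun x hx => ends_eq_zero L hx) rfl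
  simp only [show hL.net.n = n from rfl, show hL.net.m = m from hmd.symm] at hwp
  obtain ⟨s, ⟨hs1, hs2, hs3⟩, hh, hr, hsp⟩ := WP.run (hwp (by omega) (by omega) hn (by omega) hA hk
    hmW hW le_rfl hE1 hE2) rfl
    (by show 2 * L.length ≤ _; omega)
    (by
      intro i
      show [n, L.length, k].getD i 0 < _
      rw [← hmd]
      rcases i with _ | _ | _ | i <;> simp <;> omega)
    hlt
  refine ⟨s, hh, hr, hsp, ?_, hs2, fun hg => ?_⟩
  · have h0 : (St.ofConfig (start (Truss.main A) L k)).t = 0 := rfl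
    have := worstCost_le hW hn (by omega) hA (show 1 ≤ k by omega)
    omega
  · exact hs3 hg

end Truss

theorem mainTheorem1 (a : ℕ) :
    ∃ (P : Truss.Prog) (c : ℕ) (C : ℝ), 1 ≤ c ∧
      ∀ (n : ℕ) (G : SimpleGraph (Fin n)),
        (∀ v, ∃ u, G.Adj v u) → 2 ≤ Truss.numEdges G →
        ∀ L : List (Fin n × Fin n), Truss.IsEdgeList G L →
        ∀ ε : ℝ, 0 < ε → ε < 1 →
        ∀ w : ℕ, w = c * Truss.inputBits n (Truss.numEdges G) ⌈1 / ε⌉₊ →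
          -- success with high probability
          ENNReal.ofReal (1 - 1 / (Truss.numEdges G : ℝ) ^ a) ≤
            Truss.tapeMeasure w {ω | ∃ x : ℝ,
              Truss.Outputs ω (Truss.start P L ⌈1 / ε⌉₊) x ∧
              Truss.IsApprox ε (Truss.trussness G) x} ∧
          -- expected time
          ∫⁻ ω, Truss.runTime ω (Truss.start P L ⌈1 / ε⌉₊) ∂(Truss.tapeMeasure w) ≤
            ENNReal.ofReal (C * (1 / ε ^ 3 *
              min ((Truss.numEdges G : ℝ) * Real.log (Truss.numEdges G) /
                ((Truss.numTriangles G : ℝ) + 1)) 1 *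
              Truss.numEdges G * Truss.arboricity G *
              Real.log ((Truss.trussness G : ℝ) + 2))) ∧
          -- space, on every run and at every time
          ∀ (ω : Truss.Tape w) (τ : ℕ),
            ((Truss.run ω (Truss.start P L ⌈1 / ε⌉₊) τ).space : ℝ) ≤
              C * (1 / ε ^ 2 * Truss.numEdges G * Real.log (Truss.numEdges G)) := by
  open Truss in
  -- Of the exponent, `16` is spent on the union bound over all samples, leaving failure probability
  -- `m ^ (-(a + 24))`. This covers the required `m ^ (-a)` and the factor `m ^ 5` of the worst-case
  -- time.
  refine ⟨Truss.main (a + 24 + 16), a + 24 + 16 + 20, 30000000 * (a + 24 + 16 : ℕ), by omega, ?_⟩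
  intro n H hiso hm L hL ε h0 h1 w hw
  have hlen := hL.length_eq
  rw [hlen] at hm hw ⊢
  have hA : 1 ≤ a + 24 + 16 := by omega
  have hk := two_le_ceil h0 h1
  have hne : H ≠ ⊥ := by
    rintro rfl
    have := hL.adj (show 0 < L.length by omega)
    exact this
  obtain ⟨ch, R, hT⟩ := Net.exists_truss hL.net_of hne
  have ht : trussness H + 1 ≤ 2 * arboricity H := trussness_lt_two_mul_arboricity H hne
  have hspec := fun ω : Tape w => hL.run_spec hiso hm hk hA hw hT ω
  -- This part of the specification does not involve the tape, so any tape serves.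
  have hWw : hL.net.W < 2 ^ w := (hspec fun _ => ⟨0, by positivity⟩).1
  have hbad := Net.not_goodTape_le (a := a + 24) hT hk hm hWw
  rw [show hL.net.m = L.length from rfl] at hbad
  have hW : hL.net.W ≤ 4 * L.length * L.length := Net.W_le_sq
  have hWα : hL.net.W ≤ 2 * L.length * arboricity H := Net.W_le_arboricity hL.net_of
  have hT1 : numTriangles H ≤ hL.net.W :=
    (Net.numTriangles_le hL.net_of).trans Net.card_triangles_le_W
  have hT2 : numTriangles H ≤ L.length * trussness H :=
    (Net.numTriangles_le hL.net_of).trans (Net.card_triangles_le hT.charge)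
  have hth := threshold_le h0 h1 hm (a + 24 + 16)
  have hth0 : 0 < threshold (a + 24 + 16) L.length ⌈1 / ε⌉₊ := by
    have : 0 < Nat.size L.length := Nat.size_pos.2 (by omega)
    unfold threshold; positivity
  have hlog := half_le_log hm
  have hm0 : (2 : ℝ) ≤ L.length := by exact_mod_cast hm
  refine ⟨?_, ?_, ?_⟩
  · refine ofReal_le_of_good (fun ω hω => ?_) (hbad.trans (one_div_le_one_div_of_le
      (by positivity) (pow_le_pow_right₀ (by linarith) (by omega))))
    obtain ⟨-, s, hh, hr, -, -, hr1, hg⟩ := hspec ω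
    obtain ⟨a1, a2, -⟩ := hg (not_not.1 hω)
    refine ⟨s.r 0, ⟨s.t, hh, ?_, ?_⟩, isApprox_of_mul_le h0 (one_div_le_ceil ε) a1 a2⟩
    · rw [hr, hr1]; exact one_ne_zero
    · rw [hr, hr1, Nat.cast_one, div_one]
  · set F : ℝ := min ((L.length : ℝ) * Real.log L.length / ((numTriangles H : ℝ) + 1)) 1 *
      L.length * arboricity H with hF
    have hF0 : 0 ≤ F := by
      have : 0 ≤ min ((L.length : ℝ) * Real.log L.length / ((numTriangles H : ℝ) + 1)) 1 :=
        le_min (by positivity) zero_le_one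
      positivity
    refine (lintegral_le_of_good
      (S := {ω | ¬ GoodTape hL.net ⌈1 / ε⌉₊
        (threshold (a + 24 + 16) L.length ⌈1 / ε⌉₊) (trussness H) ch R ω})
      (x := 6144000 * (a + 24 + 16 : ℕ) * (1 / ε ^ 2 * F))
      (y := ((180000 * ((a + 24 + 16) * L.length ^ 5 * ⌈1 / ε⌉₊ ^ 2) : ℕ) : ℝ))
      (by positivity) (by positivity) (fun ω hω => ?_) (fun ω => ?_)).trans
      (ENNReal.ofReal_le_ofReal ?_)
    · obtain ⟨-, s, hh, -, -, -, -, hg⟩ := hspec ω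
      obtain ⟨-, -, b, hb, hb'⟩ := hg (not_not.1 hω)
      refine (runTime_le hh).trans ?_
      rw [← ENNReal.ofReal_natCast]
      exact ENNReal.ofReal_le_ofReal
        (good_time_le h0 h1 hm hA hb hWα ht hT1 hT2 hth hth0 hb')
    · obtain ⟨-, s, hh, -, -, hs, -⟩ := hspec ω
      refine (runTime_le hh).trans ?_
      rw [ENNReal.ofReal_natCast]
      exact Nat.cast_le.2 hs
    · refine (time_sum_le (t := trussness H) h0 h1 hF0 le_rfl
        (bad_time_le h0 h1 hm ht (hT1.trans hW) le_rfl measureReal_nonneg hbad)).trans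
        (le_of_eq ?_)
      rw [hF]; ring
  · intro ω τ
    obtain ⟨-, s, -, -, hsp, -⟩ := hspec ω
    have h2 : ((run ω (start (Truss.main (a + 24 + 16)) L ⌈1 / ε⌉₊) τ).space : ℝ) ≤
        384 * (L.length * (threshold (a + 24 + 16) L.length ⌈1 / ε⌉₊ : ℝ)) := by
      refine (Nat.cast_le.2 (hsp τ)).trans (le_of_eq ?_)
      push_cast; ring
    refine h2.trans ?_
    calc 384 * (L.length * (threshold (a + 24 + 16) L.length ⌈1 / ε⌉₊ : ℝ))
        ≤ 384 * (L.length * (96 * (a + 24 + 16 : ℕ) * Real.log L.length / ε ^ 2)) := by gcongr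
      _ = 36864 * (a + 24 + 16 : ℕ) * (1 / ε ^ 2 * L.length * Real.log L.length) := by ring
      _ ≤ _ := by gcongr; norm_num
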